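/- Let $M$ be a smooth finite-dimensional (Hausdorff, second countable) manifold, $\pi:E\to M$ a smooth real vector bundle of finite rank, and $\mathcal M=\Pi E$ the supermanifold with superfunctions $\mathcal O_{\mathcal M}=\Gamma(\Lambda E^\ast)$. Let $\nabla$ be a connection on $\mathcal M$, i.e. an even $\mathbb R$-bilinear map on superderivations of $\mathcal O_{\mathcal M}$, $\mathcal O_{\mathcal M}$-linear in the first argument, with $\nabla_X(fY)=X(f)Y+(-1)^{|X||f|}f\nabla_XY$. Notation. Let $\mathcal F=\Gamma(\mathbb R\oplus E^\ast)\subset\mathcal O_{\mathcal M}$, let $pr:\mathcal O_{\mathcal M}\to\mathcal F$ be the projection along $\Gamma(\bigoplus_{k\ge 2}\Lambda^kE^\ast)$, and let $\psi$ send $s_0+s_1\in\mathcal F$ to the function $e\mapsto s_0(\pi(e))+s_1(\pi(e))(e)$ on $E$. Let $\mathcal L_{\bar 0}$ be the set of even superderivations $X$ with $X(\mathcal F)\subset\mathcal F$; for $X\in\mathcal L_{\bar 0}$ let $\Psi(X)$ be the vector field on the manifold $E$ with $\Psi(X)(\psi(s))=\psi(X(s))$ for all $s\in\mathcal F$. The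 associated objects exist and are unique: * there is exactly one smooth connection $\nabla^{TE}$ on the tangent bundle of the manifold $E$ with $\big(\nabla^{TE}_{\Psi(X)}\Psi(Y)\big)(\psi(s))=\psi\big(pr((\nabla_XY)(s))\big)$ for all $X,Y\in\mathcal L_{\bar 0}$, $s\in\mathcal F$; * for every even or odd Riemannian metric $g$ on $\mathcal M$ (a homogeneous, supersymmetric, non-degenerate $\mathcal O_{\mathcal M}$-bilinear form on superderivations) there is exactly one smooth symmetric bilinear form $g^{TE}$ on the manifold $E$ with $g^{TE}(\Psi(X),\Psi(Y))=\psi(pr(g(X,Y)))$ for all $X,Y\in\mathcal L_{\bar 0}$; * for every morphism $\Phi:\mathbb R^{1|1}\to\mathcal M$ there is exactly one smooth curve $\gamma_\Phi:\mathbb R\to E$ with $\psi(s)\circ\gamma_\Phi=T(\Phi^\ast s)$ for all $s\in\mathcal F$, where $T(f+h\tau)=f+h$ and $\tau$ is the odd coordinate; * for every morphism $A:\mathbb R^{0|1}\to T\mathcal M$, i.e. every pair of a morphism $a:\mathbb R^{0|1}\to\mathcal M$ and an even superderivation $v:\mathcal O_{\mathcal M}\to\mathcal O_{\mathbb R^{0|1}}$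 along $a$, there is exactly one $\alpha_A\in TE$, with base point $e\in E$, such that $\psi(s)(e)=T(a^\ast s)$ and $d(\psi(s))(\alpha_A)=T(v(s))$ for all $s\in\mathcal F$. Moreover: (1) If $\nabla$ is torsion-free, then $\nabla^{TE}$ is torsion-free. If $\nabla$ is compatible with an even or odd Riemannian metric $g$, i.e. $(-1)^{|g||X|}X(g(Y,Z))=g(\nabla_XY,Z)+(-1)^{|X||Y|}g(Y,\nabla_XZ)$ for all homogeneous superderivations $X,Y,Z$, then $\nabla^{TE}$ is compatible with $g^{TE}$. (2) Let $\Phi:\mathbb R^{1|1}\to\mathcal M$ be a geodesic of $(\mathcal M,\nabla)$, i.e. $\frac{\nabla}{dt}(\Phi_\ast\partial_t)=0$ for the pullback of $\nabla$ along $\Phi$ evaluated at $\partial_t$, with initial condition $A$, i.e. $A$ is the restriction of $\Phi_\ast\partial_t$ to $\{t=0\}$. Then $\gamma_\Phi$ is a geodesic of $(E,\nabla^{TE})$ with initial condition $\gamma_\Phi'(0)=\alpha_A$. -/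

import Mathlib

open Bundle Filter
open scoped Manifold ContDiff Topology

/-! ### Linear superalgebra

Real superalgebras `A` with even and odd parts `𝒜 0`, `𝒜 1`, superderivations, connections and
metrics on the module of superderivations. All graded objects are described by their homogeneous
components. -/

namespace SuperAlg

noncomputable section

/-- The Koszul sign `(-1)^{pq}`. -/
def koszul (p q : ZMod 2) : ℝ := (-1) ^ (p.val * q.val)

variable {A C : Type*} [Ring A] [Algebra ℝ A] [Ring C] [Algebra ℝ C]

/-- Homogeneous superderivations of parity `p` along an algebra morphism `φ : A → C`:
`D (f g) = D f · φ g + (-1)^{p |f|} φ f · D g`. -/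
def derAlong (𝒜 : ZMod 2 → Submodule ℝ A) (𝒞 : ZMod 2 → Submodule ℝ C) (φ : A →ₐ[ℝ] C)
    (p : ZMod 2) : Submodule ℝ (A →ₗ[ℝ] C) where
  carrier := {D | (∀ q, ∀ f ∈ 𝒜 q, D f ∈ 𝒞 (p + q)) ∧
    ∀ q, ∀ f ∈ 𝒜 q, ∀ g, D (f * g) = D f * φ g + koszul p q • (φ f * D g)}
  zero_mem' := ⟨fun _ _ _ => by simp, fun _ _ _ _ => by simp⟩
  add_mem' := by
    rintro D D' ⟨h1, h2⟩ ⟨h1', h2'⟩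
    refine ⟨fun q f hf => ?_, fun q f hf g => ?_⟩
    · simpa using add_mem (h1 q f hf) (h1' q f hf)
    · simp only [LinearMap.add_apply, h2 q f hf g, h2' q f hf g, add_mul, mul_add, smul_add]
      abel
  smul_mem' := by
    rintro c D ⟨h1, h2⟩
    refine ⟨fun q f hf => ?_, fun q f hf g => ?_⟩
    · simpa using Submodule.smul_mem _ c (h1 q f hf)
    · simp only [LinearMap.smul_apply, h2 q f hf g, smul_add, smul_mul_assoc, mul_smul_comm,
        smul_comm c]

/-- Homogeneous superderivations of parity `p` of a superalgebra. -/
abbrev der (𝒜 : ZMod 2 → Submodule ℝ A) (p : ZMod 2) : Submodule ℝ (A →ₗ[ℝ] A) :=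
  derAlong 𝒜 𝒜 (AlgHom.id ℝ A) p

/-- A connection: an even `ℝ`-bilinear map `(X, Y) ↦ ∇_X Y` on superderivations, `A`-linear in `X`
and with `∇_X (f Y) = X(f) Y + (-1)^{|X||f|} f ∇_X Y`. -/
structure Connection (𝒜 : ZMod 2 → Submodule ℝ A) where
  /-- the value `∇_X Y` on homogeneous `X`, `Y` -/
  nabla : ∀ {p q : ZMod 2}, der 𝒜 p →ₗ[ℝ] der 𝒜 q →ₗ[ℝ] der 𝒜 (p + q)
  smul_left : ∀ {r p q : ZMod 2} (f : A) (X : der 𝒜 p) (fX : der 𝒜 (r + p)) (Y : der 𝒜 q),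
    f ∈ 𝒜 r → (∀ a, fX.1 a = f * X.1 a) → ∀ a, (nabla fX Y).1 a = f * (nabla X Y).1 a
  leibniz : ∀ {r p q : ZMod 2} (f : A) (X : der 𝒜 p) (Y : der 𝒜 q) (fY : der 𝒜 (r + q)),
    f ∈ 𝒜 r → (∀ a, fY.1 a = f * Y.1 a) →
      ∀ a, (nabla X fY).1 a = X.1 f * Y.1 a + koszul p r • (f * (nabla X Y).1 a)

/-- Vanishing torsion: `∇_X Y - (-1)^{|X||Y|} ∇_Y X - [X, Y] = 0`, where
`[X, Y] = X Y - (-1)^{|X||Y|} Y X`. -/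
def Connection.IsTorsionFree {𝒜 : ZMod 2 → Submodule ℝ A} (D : Connection 𝒜) : Prop :=
  ∀ (p q : ZMod 2) (X : der 𝒜 p) (Y : der 𝒜 q) (a : A),
    (D.nabla X Y).1 a - koszul p q • (D.nabla Y X).1 a
      - (X.1 (Y.1 a) - koszul p q • Y.1 (X.1 a)) = 0

/-- Homogeneous one-forms of parity `r`, i.e. `A`-linear maps from superderivations to `A`:
`η (f Y) = (-1)^{r |f|} f η(Y)`. -/
structure OneForm (𝒜 : ZMod 2 → Submodule ℝ A) (r : ZMod 2) where
  /-- the value on homogeneous superderivations -/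
  val : ∀ {q : ZMod 2}, der 𝒜 q →ₗ[ℝ] A
  parity : ∀ {q : ZMod 2} (Y : der 𝒜 q), val Y ∈ 𝒜 (r + q)
  smul : ∀ {s q : ZMod 2} (f : A) (Y : der 𝒜 q) (fY : der 𝒜 (s + q)),
    f ∈ 𝒜 s → (∀ a, fY.1 a = f * Y.1 a) → val fY = koszul r s • (f * val Y)

/-- A Riemannian metric of parity `ε`: a supersymmetric, `A`-bilinear form of parity `ε` on
superderivations such that `X ↦ g(X, ·)` is bijective from superderivations to one-forms
(shifting the parity by `ε`). -/
structure Metric (𝒜 : ZMod 2 → Submodule ℝ A) (ε : ZMod 2) where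
  /-- the value `g(X, Y)` on homogeneous `X`, `Y` -/
  val : ∀ {p q : ZMod 2}, der 𝒜 p →ₗ[ℝ] der 𝒜 q →ₗ[ℝ] A
  parity : ∀ {p q : ZMod 2} (X : der 𝒜 p) (Y : der 𝒜 q), val X Y ∈ 𝒜 (ε + p + q)
  smul_left : ∀ {r p q : ZMod 2} (f : A) (X : der 𝒜 p) (fX : der 𝒜 (r + p)) (Y : der 𝒜 q),
    f ∈ 𝒜 r → (∀ a, fX.1 a = f * X.1 a) → val fX Y = koszul ε r • (f * val X Y)
  supersymm : ∀ {p q : ZMod 2} (X : der 𝒜 p) (Y : der 𝒜 q), val X Y = koszul p q • val Y X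
  nondegenerate : ∀ (r : ZMod 2) (η : OneForm 𝒜 r),
    ∃! X : der 𝒜 (r + ε), ∀ (q : ZMod 2) (Y : der 𝒜 q), val X Y = η.val Y

/-- Compatibility of connection and metric:
`(-1)^{|g||X|} X(g(Y, Z)) - g(∇_X Y, Z) - (-1)^{|X||Y|} g(Y, ∇_X Z) = 0`. -/
def Connection.IsMetric {𝒜 : ZMod 2 → Submodule ℝ A} {ε : ZMod 2} (D : Connection 𝒜)
    (g : Metric 𝒜 ε) : Prop :=
  ∀ (p q r : ZMod 2) (X : der 𝒜 p) (Y : der 𝒜 q) (Z : der 𝒜 r),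
    koszul ε p • X.1 (g.val Y Z) - g.val (D.nabla X Y) Z
      - koszul p q • g.val Y (D.nabla X Z) = 0

/-! ### The superalgebras of `ℝ^{0|1}` and `ℝ^{1|1}` -/

/-- Parity on `ℝ[τ]/(τ²)`, the superfunctions on `ℝ^{0|1}`: the even elements are `a`, the odd
elements are `b τ`. -/
def dualParity (p : ZMod 2) : Submodule ℝ (DualNumber ℝ) where
  carrier := {z | if p = 0 then z.snd = 0 else z.fst = 0}
  zero_mem' := by split_ifs <;> simp
  add_mem' := by
    intro a b ha hb
    simp only [Set.mem_ofPred_eq] at *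
    split_ifs at * <;> simp_all
  smul_mem' := by
    intro c a ha
    simp only [Set.mem_ofPred_eq] at *
    split_ifs at * <;> simp_all

/-- The superfunctions `f + h τ` on `ℝ^{1|1}`, with `f`, `h` smooth on `ℝ`. -/
def lineAlg : Subalgebra ℝ (ℝ → DualNumber ℝ) where
  carrier := {b | ContDiff ℝ ∞ (fun t => (b t).fst) ∧ ContDiff ℝ ∞ (fun t => (b t).snd)}
  mul_mem' := by
    rintro a b ⟨ha, ha'⟩ ⟨hb, hb'⟩
    refine ⟨?_, ?_⟩
    · simpa using ha.mul hb
    · simpa [mul_comm] using (ha.mul hb').add (hb.mul ha')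
  add_mem' := by
    rintro a b ⟨ha, ha'⟩ ⟨hb, hb'⟩
    refine ⟨?_, ?_⟩
    · simpa using ha.add hb
    · simpa using ha'.add hb'
  algebraMap_mem' := by
    intro r
    refine ⟨?_, ?_⟩
    · simpa [Pi.algebraMap_apply, TrivSqZeroExt.algebraMap_eq_inl] using contDiff_const
    · simpa [Pi.algebraMap_apply, TrivSqZeroExt.algebraMap_eq_inl] using contDiff_const

/-- Parity on superfunctions of `ℝ^{1|1}`. -/
def lineParity (p : ZMod 2) : Submodule ℝ lineAlg where
  carrier := {b | ∀ t, b.1 t ∈ dualParity p}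
  zero_mem' := fun _ => zero_mem _
  add_mem' := fun ha hb t => add_mem (ha t) (hb t)
  smul_mem' := fun c _ ha t => Submodule.smul_mem _ c (ha t)

/-- The even vector field `∂_t` on `ℝ^{1|1}`. -/
def dt : lineAlg →ₗ[ℝ] lineAlg where
  toFun b := ⟨fun t => (deriv (fun s => (b.1 s).fst) t, deriv (fun s => (b.1 s).snd) t),
    (contDiff_infty_iff_deriv.1 b.2.1).2, (contDiff_infty_iff_deriv.1 b.2.2).2⟩
  map_add' a b := by
    have h1 := fun t => (a.2.1.differentiable (by simp) t)
    have h2 := fun t => (a.2.2.differentiable (by simp) t)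
    have h3 := fun t => (b.2.1.differentiable (by simp) t)
    have h4 := fun t => (b.2.2.differentiable (by simp) t)
    apply Subtype.ext
    funext t
    refine Prod.ext ?_ ?_
    · exact deriv_add (h1 t) (h3 t)
    · exact deriv_add (h2 t) (h4 t)
  map_smul' c a := by
    have h1 := fun t => (a.2.1.differentiable (by simp) t)
    have h2 := fun t => (a.2.2.differentiable (by simp) t)
    apply Subtype.ext
    funext t
    refine Prod.ext ?_ ?_
    · exact deriv_const_smul c (h1 t)
    · exact deriv_const_smul c (h2 t)

theorem dt_mem_lineParity {q : ZMod 2} {b : lineAlg} (hb : b ∈ lineParity q) :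
    dt b ∈ lineParity q := by
  intro t
  have hb' : ∀ t, if q = 0 then (b.1 t).snd = 0 else (b.1 t).fst = 0 := hb
  change if q = 0 then deriv (fun s => (b.1 s).snd) t = 0 else deriv (fun s => (b.1 s).fst) t = 0
  split_ifs at * with h
  · simp [hb']
  · simp [hb']

theorem dt_mul (a b : lineAlg) : dt (a * b) = dt a * b + a * dt b := by
  have h1 := fun t => (a.2.1.differentiable (by simp) t)
  have h2 := fun t => (a.2.2.differentiable (by simp) t)
  have h3 := fun t => (b.2.1.differentiable (by simp) t)
  have h4 := fun t => (b.2.2.differentiable (by simp) t)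
  apply Subtype.ext
  funext t
  refine TrivSqZeroExt.ext ?_ ?_
  · change deriv (fun s => (a.1 s).fst * (b.1 s).fst) t =
      deriv (fun s => (a.1 s).fst) t * (b.1 t).fst + (a.1 t).fst * deriv (fun s => (b.1 s).fst) t
    exact deriv_mul (h1 t) (h3 t)
  · change deriv (fun s => (a.1 s).fst • (b.1 s).snd + MulOpposite.op (b.1 s).fst • (a.1 s).snd) t =
      (deriv (fun s => (a.1 s).fst) t • (b.1 t).snd
        + MulOpposite.op (b.1 t).fst • deriv (fun s => (a.1 s).snd) t)
      + ((a.1 t).fst • deriv (fun s => (b.1 s).snd) t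
        + MulOpposite.op (deriv (fun s => (b.1 s).fst) t) • (a.1 t).snd)
    simp only [smul_eq_mul, MulOpposite.smul_eq_mul_unop, MulOpposite.unop_op]
    have := ((h1 t).hasDerivAt.mul (h4 t).hasDerivAt).add
      ((h2 t).hasDerivAt.mul (h3 t).hasDerivAt)
    refine (HasDerivAt.deriv this).trans ?_
    ring

end

end SuperAlg

/-! ### Classical connections, bilinear forms and geodesics -/

namespace Classical

noncomputable section

variable {V : Type*} [NormedAddCommGroup V] [NormedSpace ℝ V]
  {H : Type*} [TopologicalSpace H] {I : ModelWithCorners ℝ V H}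
  {N : Type*} [TopologicalSpace N] [ChartedSpace H N] [IsManifold I ∞ N]

/-- Smooth vector fields. -/
def IsSmoothField (X : ∀ x : N, TangentSpace I x) : Prop :=
  ContMDiff I I.tangent ∞ (fun x => (⟨x, X x⟩ : TangentBundle I N))

/-- Smooth symmetric bilinear forms on a manifold. -/
structure IsSmoothSymmetricForm (h : ∀ x : N, TangentSpace I x →L[ℝ] TangentSpace I x →L[ℝ] ℝ) :
    Prop where
  symm : ∀ x v w, h x v w = h x w v
  smooth : ContMDiff I (I.prod 𝓘(ℝ, V →L[ℝ] V →L[ℝ] ℝ)) ∞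
    (fun x => TotalSpace.mk' (V →L[ℝ] V →L[ℝ] ℝ) (E := fun x : N =>
      TangentSpace I x →L[ℝ] TangentSpace I x →L[ℝ] ℝ) x (h x))

/-- Compatibility `X(h(Y, Z)) = h(∇_X Y, Z) + h(Y, ∇_X Z)` of a connection with a symmetric
bilinear form; `cov Y x (X x)` is `∇_X Y` at `x`. -/
def IsCompatible (cov : CovariantDerivative I V (TangentSpace I : N → Type _))
    (h : ∀ x : N, TangentSpace I x →L[ℝ] TangentSpace I x →L[ℝ] ℝ) : Prop :=
  ∀ X Y Z : ∀ x : N, TangentSpace I x, IsSmoothField X → IsSmoothField Y → IsSmoothField Z →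
    ∀ x, mvfderiv I (fun y => h y (Y y) (Z y)) x (X x) =
      h x (cov Y x (X x)) (Z x) + h x (Y x) (cov Z x (X x))

/-- Vanishing of the torsion tensor. -/
def IsTorsionFree [FiniteDimensional ℝ V]
    (cov : CovariantDerivative I V (TangentSpace I : N → Type _)) : Prop :=
  haveI : CompleteSpace V := FiniteDimensional.complete ℝ V
  cov.torsion = 0

/-- The velocity of a curve. -/
def velocity (γ : ℝ → N) (t : ℝ) : TangentSpace I (γ t) :=
  mfderiv 𝓘(ℝ, ℝ) I γ t (1 : ℝ)

/-- Smooth vector fields along a curve. -/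
def IsSmoothAlong (γ : ℝ → N) (X : ∀ t, TangentSpace I (γ t)) : Prop :=
  ContMDiff 𝓘(ℝ, ℝ) I.tangent ∞ (fun t => (⟨γ t, X t⟩ : TangentBundle I N))

/-- `D` is the covariant derivative along the curve `γ`: it is additive, satisfies the Leibniz rule,
and `D (Y ∘ γ) = ∇_{γ'} Y`. -/
structure IsCovariantDerivativeAlong (cov : CovariantDerivative I V (TangentSpace I : N → Type _))
    (γ : ℝ → N) (D : (∀ t, TangentSpace I (γ t)) → ∀ t, TangentSpace I (γ t)) : Prop where
  add : ∀ X Y, IsSmoothAlong γ X → IsSmoothAlong γ Y → D (X + Y) = D X + D Y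
  leibniz : ∀ (f : ℝ → ℝ) X, ContDiff ℝ ∞ f → IsSmoothAlong γ X →
    D (fun t => f t • X t) = fun t => deriv f t • X t + f t • D X t
  pullback : ∀ Y : ∀ x : N, TangentSpace I x, IsSmoothField Y →
    D (fun t => Y (γ t)) = fun t => cov Y (γ t) (velocity γ t)

/-- Geodesics: smooth curves with `(∇/dt) γ' = 0`. -/
def IsGeodesic (cov : CovariantDerivative I V (TangentSpace I : N → Type _)) (γ : ℝ → N) : Prop :=
  ContMDiff 𝓘(ℝ, ℝ) I ∞ γ ∧ ∃ D, IsCovariantDerivativeAlong cov γ D ∧ D (velocity γ) = 0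

end

end Classical

/-! ### The supermanifold `ΠE` of a vector bundle `E → M` -/

namespace BatchelorModel

open SuperAlg

noncomputable section

variable (B F : Type*) [NormedAddCommGroup B] [NormedSpace ℝ B]
  [NormedAddCommGroup F] [NormedSpace ℝ F]
  {M : Type*} [TopologicalSpace M] [ChartedSpace B M]
  (E : M → Type*) [∀ x, AddCommGroup (E x)] [∀ x, Module ℝ (E x)]
  [TopologicalSpace (TotalSpace F E)] [∀ x, TopologicalSpace (E x)] [FiberBundle F E]

/-- A section of `E*` is smooth if it is smooth as a fibrewise linear function on `E`. -/
def IsSmoothDualSection (η : ∀ x, Module.Dual ℝ (E x)) : Prop :=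
  ContMDiff (𝓘(ℝ, B).prod 𝓘(ℝ, F)) 𝓘(ℝ, ℝ) ∞ (fun v : TotalSpace F E => η v.1 v.2)

/-- The subalgebra, of all sections of `ΛE*`, generated by the smooth functions on `M` and the
smooth sections of `E*`. -/
def generated : Subalgebra ℝ (∀ x, ExteriorAlgebra ℝ (Module.Dual ℝ (E x))) :=
  Algebra.adjoin ℝ
    ({f | ∃ c : M → ℝ, ContMDiff 𝓘(ℝ, B) 𝓘(ℝ, ℝ) ∞ c ∧ ∀ x, f x = algebraMap ℝ _ (c x)} ∪
     {f | ∃ η, IsSmoothDualSection B F E η ∧ ∀ x, f x = ExteriorAlgebra.ι ℝ (η x)})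

/-- The superfunctions on `ΠE`: the smooth sections of `ΛE*`, i.e. the sections which near every
point of `M` are a polynomial expression in smooth functions and smooth sections of `E*`. -/
def superFun : Subalgebra ℝ (∀ x, ExteriorAlgebra ℝ (Module.Dual ℝ (E x))) where
  carrier := {f | ∀ x₀, ∃ g ∈ generated B F E, ∀ᶠ x in 𝓝 x₀, f x = g x}
  mul_mem' := by
    intro a b ha hb x₀
    obtain ⟨g, hg, h⟩ := ha x₀
    obtain ⟨g', hg', h'⟩ := hb x₀
    refine ⟨g * g', mul_mem hg hg', ?_⟩
    filter_upwards [h, h'] with x hx hx'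
    simp [hx, hx']
  add_mem' := by
    intro a b ha hb x₀
    obtain ⟨g, hg, h⟩ := ha x₀
    obtain ⟨g', hg', h'⟩ := hb x₀
    refine ⟨g + g', add_mem hg hg', ?_⟩
    filter_upwards [h, h'] with x hx hx'
    simp [hx, hx']
  algebraMap_mem' := fun r x₀ => ⟨_, Subalgebra.algebraMap_mem _ r, Eventually.of_forall fun _ => rfl⟩

/-- The parity of superfunctions on `ΠE`: sections of `Λ^{even}E*` and of `Λ^{odd}E*`. -/
def parity (p : ZMod 2) : Submodule ℝ (superFun B F E) where
  carrier := {f | ∀ x, f.1 x ∈ CliffordAlgebra.evenOdd (0 : QuadraticForm ℝ (Module.Dual ℝ (E x))) p}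
  zero_mem' := fun _ => zero_mem _
  add_mem' := fun ha hb x => add_mem (ha x) (hb x)
  smul_mem' := fun c _ ha x => Submodule.smul_mem _ c (ha x)

variable {B F E}

/-- The reduction of a superfunction to a function on `M` (its component in `Λ⁰E*`). -/
def body (f : superFun B F E) (x : M) : ℝ := ExteriorAlgebra.algebraMapInv (f.1 x)

/-- A superfunction is affine if it is a section of `ℝ ⊕ E* ⊆ ΛE*`. -/
def IsAffine (f : superFun B F E) : Prop :=
  ∀ x, ∃ (c : ℝ) (η : Module.Dual ℝ (E x)), f.1 x = algebraMap ℝ _ c + ExteriorAlgebra.ι ℝ η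

/-- The function on the total space `E` given by the affine part of a superfunction: if `f` has
components `f₀` in `Λ⁰E*` and `f₁` in `Λ¹E*`, it is `e ↦ f₀(π(e)) + f₁(π(e))(e)`. -/
def affinePart (f : superFun B F E) (v : TotalSpace F E) : ℝ :=
  body f v.1 + ExteriorAlgebra.ιInv (f.1 v.1) v.2

/-- Even superderivations which preserve the affine superfunctions. -/
def PreservesAffine (X : der (parity B F E) 0) : Prop := ∀ s, IsAffine s → IsAffine (X.1 s)

/-- The pullback `Φ^* : O(ΠE) → O(ℝ^{1|1})` and underlying map of a morphism `ℝ^{1|1} → ΠE`. -/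
structure Supercurve (B F : Type*) [NormedAddCommGroup B] [NormedSpace ℝ B]
    [NormedAddCommGroup F] [NormedSpace ℝ F]
    {M : Type*} [TopologicalSpace M] [ChartedSpace B M]
    (E : M → Type*) [∀ x, AddCommGroup (E x)] [∀ x, Module ℝ (E x)]
    [TopologicalSpace (TotalSpace F E)] [∀ x, TopologicalSpace (E x)] [FiberBundle F E] where
  /-- the underlying smooth curve -/
  base : ℝ → M
  smooth_base : ContMDiff 𝓘(ℝ, ℝ) 𝓘(ℝ, B) ∞ base
  /-- the pullback of superfunctions -/
  pullback : superFun B F E →ₐ[ℝ] lineAlg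
  even : ∀ p, ∀ f ∈ parity B F E p, pullback f ∈ lineParity p
  body_pullback : ∀ f t, ((pullback f).1 t).fst = body f (base t)

/-- Initial conditions `A : ℝ^{0|1} → T(ΠE)`. Such a morphism is a pair consisting of a morphism
`ℝ^{0|1} → ΠE` and an even superderivation of superfunctions along it. -/
structure InitialCondition (B F : Type*) [NormedAddCommGroup B] [NormedSpace ℝ B]
    [NormedAddCommGroup F] [NormedSpace ℝ F]
    {M : Type*} [TopologicalSpace M] [ChartedSpace B M]
    (E : M → Type*) [∀ x, AddCommGroup (E x)] [∀ x, Module ℝ (E x)]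
    [TopologicalSpace (TotalSpace F E)] [∀ x, TopologicalSpace (E x)] [FiberBundle F E] where
  /-- the underlying point of `M` -/
  base : M
  /-- the pullback of superfunctions along `ℝ^{0|1} → ΠE` -/
  pullback : superFun B F E →ₐ[ℝ] DualNumber ℝ
  even : ∀ p, ∀ f ∈ parity B F E p, pullback f ∈ dualParity p
  body_pullback : ∀ f, (pullback f).fst = body f base
  /-- the even superderivation along `ℝ^{0|1} → ΠE` -/
  vec : derAlong (parity B F E) dualParity pullback 0

/-- Superderivations along a supercurve, i.e. elements of `Der(O(ΠE), Φ_* O(ℝ^{1|1}))`. -/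
abbrev Supercurve.Der (Φ : Supercurve B F E) (p : ZMod 2) :
    Submodule ℝ (superFun B F E →ₗ[ℝ] lineAlg) :=
  derAlong (parity B F E) lineParity Φ.pullback p

/-- The velocity `Φ_* ∂_t = ∂_t ∘ Φ^*`. -/
def Supercurve.velocity (Φ : Supercurve B F E) : Φ.Der 0 :=
  ⟨dt ∘ₗ Φ.pullback.toLinearMap, by
    refine ⟨fun q f hf => ?_, fun q f hf g => ?_⟩
    · simpa using dt_mem_lineParity (Φ.even q f hf)
    · simp [koszul, dt_mul]⟩

/-- The restriction `Φ^* ∘ X` of a superderivation to a supercurve. -/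
def Supercurve.restrict (Φ : Supercurve B F E) {q : ZMod 2} (X : der (parity B F E) q) : Φ.Der q :=
  ⟨Φ.pullback.toLinearMap ∘ₗ X.1, by
    refine ⟨fun r f hf => Φ.even _ _ (X.2.1 r f hf), fun r f hf g => ?_⟩
    simp [X.2.2 r f hf g]⟩

/-- `D` is the operator `∇/dt` along `Φ`: the pullback of `∇` along `Φ`, evaluated at `∂_t`. It is
even, satisfies `D (b V) = ∂_t b · V + b · D V`, and if `Φ_* ∂_t = ∑ⱼ aⱼ Φ^* ∘ Zⱼ` near `t₀` then
`D (Φ^* ∘ X) = ∑ⱼ aⱼ Φ^* ∘ ∇_{Zⱼ} X` near `t₀`. -/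
structure IsSuperCovariantDerivativeAlong (nabla : Connection (parity B F E))
    (Φ : Supercurve B F E) (D : ∀ p : ZMod 2, Φ.Der p →ₗ[ℝ] Φ.Der p) : Prop where
  leibniz : ∀ (r p : ZMod 2) (b : lineAlg) (V : Φ.Der p) (bV : Φ.Der (r + p)),
    b ∈ lineParity r → (∀ f, bV.1 f = b * V.1 f) →
      ∀ f, (D _ bV).1 f = dt b * V.1 f + b * (D _ V).1 f
  pullback : ∀ (t₀ : ℝ) (n : ℕ) (p : Fin n → ZMod 2) (a : Fin n → lineAlg)
    (Z : ∀ j, der (parity B F E) (p j)), (∀ j, a j ∈ lineParity (p j)) →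
    (∀ f, ∀ᶠ t in 𝓝 t₀, (Φ.velocity.1 f).1 t = ∑ j, (a j).1 t * (Φ.pullback ((Z j).1 f)).1 t) →
    ∀ (q : ZMod 2) (X : der (parity B F E) q) (f : superFun B F E), ∀ᶠ t in 𝓝 t₀,
      ((D q (Φ.restrict X)).1 f).1 t =
        ∑ j, (a j).1 t * (Φ.pullback ((nabla.nabla (Z j) X).1 f)).1 t

/-- Geodesics of `(ΠE, ∇)`: supercurves with `(∇/dt)(Φ_* ∂_t) = 0`. -/
def IsSuperGeodesic (nabla : Connection (parity B F E)) (Φ : Supercurve B F E) : Prop :=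
  ∃ D, IsSuperCovariantDerivativeAlong nabla Φ D ∧ D 0 Φ.velocity = 0

/-- `Φ` has initial condition `A`: the restriction of `Φ_* ∂_t` to `t = 0` is `A`. -/
def HasInitialCondition (Φ : Supercurve B F E) (A : InitialCondition B F E) : Prop :=
  A.base = Φ.base 0 ∧ (∀ f, A.pullback f = (Φ.pullback f).1 0) ∧
    ∀ f, A.vec.1 f = (Φ.velocity.1 f).1 0

/-- `γ = γ_Φ`: the smooth curve in `E` with `f₀(π(γ)) + f₁(π(γ))(γ) = T(Φ^* s)` for all affine
superfunctions `s = f₀ + f₁`, where `T(f + h τ) = f + h`. -/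
def IsAssociatedCurve (Φ : Supercurve B F E) (γ : ℝ → TotalSpace F E) : Prop :=
  ContMDiff 𝓘(ℝ, ℝ) (𝓘(ℝ, B).prod 𝓘(ℝ, F)) ∞ γ ∧
    ∀ s, IsAffine s → ∀ t,
      affinePart s (γ t) = ((Φ.pullback s).1 t).fst + ((Φ.pullback s).1 t).snd

variable [VectorBundle ℝ F E] [IsManifold 𝓘(ℝ, B) ∞ M] [ContMDiffVectorBundle ∞ F E 𝓘(ℝ, B)]

/-- `α = α_A`: the tangent vector of `E` whose base point and whose derivative on fibrewise affine
functions are given by the two components of `A`, via `T(a + b τ) = a + b`. -/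
def IsAssociatedVector (A : InitialCondition B F E)
    (α : TangentBundle (𝓘(ℝ, B).prod 𝓘(ℝ, F)) (TotalSpace F E)) : Prop :=
  ∀ s, IsAffine s →
    affinePart s α.1 = (A.pullback s).fst + (A.pullback s).snd ∧
    mvfderiv (𝓘(ℝ, B).prod 𝓘(ℝ, F)) (affinePart s) α.1 α.2 = (A.vec.1 s).fst + (A.vec.1 s).snd

/-- `X'` is a smooth vector field on the manifold `E` corresponding to the even superderivation `X`:
on functions `affinePart s` with `s` affine, `X'` acts as `X` acts on `s`. -/
def Corresponds (X : der (parity B F E) 0)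
    (X' : ∀ v : TotalSpace F E, TangentSpace (𝓘(ℝ, B).prod 𝓘(ℝ, F)) v) : Prop :=
  Classical.IsSmoothField X' ∧ ∀ s, IsAffine s → ∀ v,
    mvfderiv (𝓘(ℝ, B).prod 𝓘(ℝ, F)) (affinePart s) v (X' v) = affinePart (X.1 s) v

/-- `cov` is a smooth connection on `E` associated to `∇`: if `X'`, `Y'` correspond to the even
superderivations `X`, `Y`, which preserve affine superfunctions, then `cov_{X'} Y'` corresponds to
the projection of `∇_X Y` to a superderivation preserving affine superfunctions. -/
structure IsAssociatedConnection (nabla : Connection (parity B F E))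
    (cov : CovariantDerivative (𝓘(ℝ, B).prod 𝓘(ℝ, F)) (B × F)
      (TangentSpace (𝓘(ℝ, B).prod 𝓘(ℝ, F)) : TotalSpace F E → Type _)) : Prop where
  smooth : cov.ContMDiffCovariantDerivative ∞
  associated : ∀ X Y X' Y', PreservesAffine X → PreservesAffine Y →
    Corresponds X X' → Corresponds Y Y' → ∀ s, IsAffine s → ∀ v,
      mvfderiv (𝓘(ℝ, B).prod 𝓘(ℝ, F)) (affinePart s) v (cov Y' v (X' v)) =
        affinePart ((nabla.nabla X Y).1 s) v

/-- `h` is a smooth symmetric bilinear form on `E` associated to `g`: if `X'`, `Y'` correspond to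
the even superderivations `X`, `Y`, which preserve affine superfunctions, then `h(X', Y')`
corresponds to the affine part of `g(X, Y)`. -/
structure IsAssociatedForm {ε : ZMod 2} (g : SuperAlg.Metric (parity B F E) ε)
    (h : ∀ v : TotalSpace F E, TangentSpace (𝓘(ℝ, B).prod 𝓘(ℝ, F)) v →L[ℝ]
      TangentSpace (𝓘(ℝ, B).prod 𝓘(ℝ, F)) v →L[ℝ] ℝ) : Prop where
  smooth : Classical.IsSmoothSymmetricForm h
  associated : ∀ X Y X' Y', PreservesAffine X → PreservesAffine Y →
    Corresponds X X' → Corresponds Y Y' → ∀ v, h v (X' v) (Y' v) = affinePart (g.val X Y) v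

end

end BatchelorModel

set_option linter.unusedSectionVars false

/-! ### Signs of the Koszul rule. -/

namespace SuperAlg

/-! Points of `E` are points of `ΠE` with values in the dual numbers `ℝ[τ]/(τ²)`. A vector `v` over
`x` gives the algebra morphism `evAt v : f ↦ f₀(x) + f₁(x)(v) τ`, and every parity-preserving
morphism over `x` has this form (`exists_eq_evAt`). In the same way the tangent vectors of `E` at
`v` are the even superderivations along `evAt v` (`vecAt_mem`, `vecAt_toTangent`), because a
superderivation at a point is determined by its values on coordinates (`IsLeibniz.eq_zero`, which
rests on cut-offs and Hadamard's lemma). The map `T`, here `tot`, loses nothing on homogeneous dual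
numbers, and `affinePart f v = tot (evAt v f)`. Curves `γ_Φ` and vectors `α_A` follow from this
dictionary, since affine functions separate points and tangent vectors of `E`.

A homogeneous superderivation `X` gives a vector field `tanVec X` on `E`: evaluate `X f` at `v` and,
if `X` is odd, multiply by `τ`. An operation on pairs of superderivations that is bilinear over
superfunctions up to signs (`SuperForm`) descends to a bilinear form on `TE`, determined by its
values on such fields (`SuperForm.form_tanVec`). A metric is one example. The Hessian `(X, Y) ↦ X(Y
f) - (∇_X Y) f` is another, and it produces the connection: `∇^{TE}` is fixed by `df(∇_w Y) =
w(df(Y)) - Hess_f(w, Y)` for coordinates `f`, and this formula then holds for every superfunction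
(`mvfderiv_covAt`). On the fields `tanVec X`, `tanVec Y` of even `X`, `Y` its right side is the
affine part of `(∇_X Y) f`.

Uniqueness is delicate on the zero section, where superderivations preserving affine functions give
no vertical vectors. Off the zero section they span: the product of an odd coordinate `z_b` and an
odd coordinate superderivation `∂_a` acts as `ψ(z_b) ∂_a`. Those points are dense (in rank zero all
points are good), so continuity finishes (`eq_of_eq_isRegular`).

The torsion is, up to sign, the antisymmetric part of the Hessian. Super signs differ from classical
ones only on pairs of odd arguments, and there `τ² = 0` removes the term; the symmetry of `g^{TE}`
has the same reason. Compatibility is checked at the good points, where tensoriality of its defect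
allows all fields to be replaced by fields `tanVec X`, and extends by continuity. For geodesics, the
equation on `ΠE` written in coordinates is an equation in dual numbers
(`IsSuperCovariantDerivativeAlong.geodesic_equation`); applying `tot` to it gives the geodesic
equation of `∇^{TE}`. -/

@[simp] theorem koszul_zero_left (q : ZMod 2) : koszul 0 q = 1 := by simp [koszul]

@[simp] theorem koszul_zero_right (q : ZMod 2) : koszul q 0 = 1 := by simp [koszul]

@[simp] theorem koszul_one_one : koszul 1 1 = -1 := by simp [koszul, ZMod.val_one]

theorem parity_cases (p : ZMod 2) : p = 0 ∨ p = 1 := by revert p; decide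

theorem koszul_comm (p q : ZMod 2) : koszul p q = koszul q p := by simp [koszul, mul_comm]

theorem koszul_mul_self (p q : ZMod 2) : koszul p q * koszul p q = 1 := by
  rcases parity_cases p with rfl | rfl <;> rcases parity_cases q with rfl | rfl <;> simp

theorem koszul_add_left (p q r : ZMod 2) : koszul (p + q) r = koszul p r * koszul q r := by
  rcases parity_cases p with rfl | rfl <;> rcases parity_cases q with rfl | rfl <;>
    rcases parity_cases r with rfl | rfl <;>
    simp [show (1 + 1 : ZMod 2) = 0 from rfl]

theorem koszul_add_right (p q r : ZMod 2) : koszul r (p + q) = koszul r p * koszul r q := by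
  rw [koszul_comm, koszul_add_left, koszul_comm p, koszul_comm q]

theorem parity_add_self (p : ZMod 2) : p + p = 0 := by revert p; decide

end SuperAlg

/-! ### Exterior algebras -/

namespace ExteriorAlgebra

section

variable {V : Type*} [AddCommGroup V] [Module ℝ V]

open CliffordAlgebra (involute evenOdd)

/-- Generators anticommute, so moving `ι m` past `b` costs one sign per generator in `b`. The
involution records these signs for inhomogeneous `b`, which makes the induction on sums and products
possible. -/
theorem ι_mul_eq_involute_mul (m : V) (b : ExteriorAlgebra ℝ V) :
    ι ℝ m * b = involute (Q := (0 : QuadraticForm ℝ V)) b * ι ℝ m := by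
  induction b using ExteriorAlgebra.induction with
  | algebraMap r =>
    rw [show involute (Q := (0 : QuadraticForm ℝ V)) (algebraMap ℝ (ExteriorAlgebra ℝ V) r) =
      algebraMap ℝ (ExteriorAlgebra ℝ V) r from AlgHom.commutes _ r, Algebra.commutes]
  | ι x =>
    rw [show involute (Q := (0 : QuadraticForm ℝ V)) (ι ℝ x) = -ι ℝ x from
      CliffordAlgebra.involute_ι x, neg_mul]
    exact eq_neg_of_add_eq_zero_left (ι_add_mul_swap m x)
  | mul a b ha hb => 
    rw [map_mul, ← mul_assoc, ha, mul_assoc, hb, mul_assoc]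
  | add a b ha hb => rw [map_add, mul_add, add_mul, ha, hb]

theorem mul_comm_of_mem_even {b : ExteriorAlgebra ℝ V}
    (hb : b ∈ evenOdd (0 : QuadraticForm ℝ V) 0) (a : ExteriorAlgebra ℝ V) : a * b = b * a := by
  induction a using ExteriorAlgebra.induction with
  | algebraMap r => exact Algebra.commutes _ _
  | ι x => rw [ι_mul_eq_involute_mul, CliffordAlgebra.involute_eq_of_mem_even hb]
  | mul a c ha hc => rw [mul_assoc, hc, ← mul_assoc, ha, mul_assoc]
  | add a c ha hc => rw [mul_add, add_mul, ha, hc]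

theorem mul_eq_mul_involute_of_mem_odd {b : ExteriorAlgebra ℝ V}
    (hb : b ∈ evenOdd (0 : QuadraticForm ℝ V) 1) (a : ExteriorAlgebra ℝ V) :
    a * b = b * involute (Q := (0 : QuadraticForm ℝ V)) a := by
  induction a using ExteriorAlgebra.induction with
  | algebraMap r =>
    rw [show involute (Q := (0 : QuadraticForm ℝ V)) (algebraMap ℝ (ExteriorAlgebra ℝ V) r) =
      algebraMap ℝ (ExteriorAlgebra ℝ V) r from AlgHom.commutes _ r, Algebra.commutes]
  | ι x =>
    rw [ι_mul_eq_involute_mul, CliffordAlgebra.involute_eq_of_mem_odd hb,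
      show involute (Q := (0 : QuadraticForm ℝ V)) (ι ℝ x) = -ι ℝ x from
      CliffordAlgebra.involute_ι x, neg_mul, mul_neg]
  | mul a c ha hc => rw [map_mul, mul_assoc, hc, ← mul_assoc, ha, mul_assoc]
  | add a c ha hc => rw [map_add, mul_add, add_mul, ha, hc]

/-- The involution is multiplication by `(-1)^q` on elements of parity `q`. -/
theorem involute_eq_koszul {q : ZMod 2} {a : ExteriorAlgebra ℝ V}
    (ha : a ∈ evenOdd (0 : QuadraticForm ℝ V) q) :
    involute (Q := (0 : QuadraticForm ℝ V)) a = SuperAlg.koszul 1 q • a := by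
  rcases SuperAlg.parity_cases q with rfl | rfl
  · simpa using CliffordAlgebra.involute_eq_of_mem_even ha
  · simpa using CliffordAlgebra.involute_eq_of_mem_odd ha

/-- The exterior algebra is supercommutative. -/
theorem mul_eq_koszul_smul_mul {p q : ZMod 2} {a b : ExteriorAlgebra ℝ V}
    (ha : a ∈ evenOdd (0 : QuadraticForm ℝ V) p) (hb : b ∈ evenOdd (0 : QuadraticForm ℝ V) q) :
    a * b = SuperAlg.koszul p q • (b * a) := by
  rcases SuperAlg.parity_cases q with rfl | rfl
  · simpa using mul_comm_of_mem_even hb a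
  · rw [mul_eq_mul_involute_of_mem_odd hb a, involute_eq_koszul ha, mul_smul_comm,
      SuperAlg.koszul_comm]

/-- Contraction is an odd derivation. The rule for a generator times an element propagates to
products by induction on `a`; `contract` takes its Leibniz rule from here. -/
theorem contractLeft_mul (d : Module.Dual ℝ V) (a b : ExteriorAlgebra ℝ V) :
    CliffordAlgebra.contractLeft (Q := (0 : QuadraticForm ℝ V)) d (a * b) =
      CliffordAlgebra.contractLeft (Q := (0 : QuadraticForm ℝ V)) d a * b +
      involute (Q := (0 : QuadraticForm ℝ V)) a *
        CliffordAlgebra.contractLeft (Q := (0 : QuadraticForm ℝ V)) d b := by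
  induction a using ExteriorAlgebra.induction generalizing b with
  | algebraMap r =>
    rw [show involute (Q := (0 : QuadraticForm ℝ V)) (algebraMap ℝ (ExteriorAlgebra ℝ V) r) =
      algebraMap ℝ (ExteriorAlgebra ℝ V) r from AlgHom.commutes _ r]
    have h1 := CliffordAlgebra.contractLeft_algebraMap_mul (Q := (0 : QuadraticForm ℝ V)) d r b
    have h2 := CliffordAlgebra.contractLeft_algebraMap (Q := (0 : QuadraticForm ℝ V)) d r
    erw [h1, h2]; rw [zero_mul, zero_add]
  | ι x =>
    have h1 := CliffordAlgebra.contractLeft_ι_mul (Q := (0 : QuadraticForm ℝ V)) d x b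
    have h2 := CliffordAlgebra.contractLeft_ι (Q := (0 : QuadraticForm ℝ V)) d x
    have h3 := CliffordAlgebra.involute_ι (Q := (0 : QuadraticForm ℝ V)) x
    erw [h1, h2, h3]
    rw [neg_mul, ← sub_eq_add_neg]
    congr 1
  | mul a c ha hc => rw [mul_assoc, ha, hc, ha c, map_mul]; noncomm_ring
  | add a c ha hc => rw [add_mul, map_add, ha, hc, map_add, map_add]; noncomm_ring

theorem contractLeft_mem_evenOdd (d : Module.Dual ℝ V) {q : ZMod 2} {a : ExteriorAlgebra ℝ V}
    (ha : a ∈ evenOdd (0 : QuadraticForm ℝ V) q) :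
    CliffordAlgebra.contractLeft (Q := (0 : QuadraticForm ℝ V)) d a ∈
      evenOdd (0 : QuadraticForm ℝ V) (1 + q) := by
  induction a, ha using CliffordAlgebra.evenOdd_induction with
  | range_ι_pow v h =>
    rcases SuperAlg.parity_cases q with rfl | rfl
    · obtain ⟨r, rfl⟩ : ∃ r, algebraMap ℝ _ r = v := by simpa [Submodule.mem_one] using h
      rw [CliffordAlgebra.contractLeft_algebraMap]
      exact zero_mem _
    · obtain ⟨m, rfl⟩ : ∃ m, CliffordAlgebra.ι (0 : QuadraticForm ℝ V) m = v := by
        simpa [ZMod.val_one] using h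
      rw [CliffordAlgebra.contractLeft_ι]
      exact CliffordAlgebra.one_le_evenOdd_zero _ (Submodule.mem_one.2 ⟨_, rfl⟩)
  | add x y hx hy ihx ihy => rw [map_add]; exact add_mem ihx ihy
  | ι_mul_ι_mul m₁ m₂ x hx ih =>
    have h1 := CliffordAlgebra.ι_mem_evenOdd_one (0 : QuadraticForm ℝ V) m₁
    have h2 := CliffordAlgebra.ι_mem_evenOdd_one (0 : QuadraticForm ℝ V) m₂
    have hmul : ∀ {i j k : ZMod 2} {a b : CliffordAlgebra (0 : QuadraticForm ℝ V)},
        i + j = k → a ∈ evenOdd 0 i → b ∈ evenOdd 0 j → a * b ∈ evenOdd 0 k := by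
      rintro i j _ a b rfl ha hb
      exact CliffordAlgebra.evenOdd_mul_le _ i j (Submodule.mul_mem_mul ha hb)
    rw [mul_assoc, CliffordAlgebra.contractLeft_ι_mul, CliffordAlgebra.contractLeft_ι_mul]
    refine sub_mem (Submodule.smul_mem _ _ (hmul rfl h2 hx)) (hmul rfl h1 (sub_mem
      (Submodule.smul_mem _ _ hx) (hmul ?_ h2 ih)))
    clear hx ih
    revert q
    decide

/-- Products of more vectors than the rank are products of dependent vectors and vanish, so finitely
many exterior powers exhaust the algebra. This allows linear coordinates, and hence differentiation,
on `ΛE*`. -/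
instance instFiniteReal [Module.Finite ℝ V] : Module.Finite ℝ (ExteriorAlgebra ℝ V) := by
  refine ⟨?_⟩
  have h : (⊤ : Submodule ℝ (ExteriorAlgebra ℝ V)) =
      ⨆ n ∈ Finset.range (Module.finrank ℝ V + 1), ⋀[ℝ]^n V := by
    refine le_antisymm ?_ le_top
    rw [← ιMulti_span, Submodule.span_le]
    rintro _ ⟨⟨n, v⟩, rfl⟩
    by_cases hn : n ∈ Finset.range (Module.finrank ℝ V + 1)
    · exact Submodule.mem_iSup_of_mem n (Submodule.mem_iSup_of_mem hn
        (ιMulti_range ℝ n ⟨v, rfl⟩))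
    · have hv : ¬LinearIndependent ℝ v := fun hv => hn <| by
        simpa [Nat.lt_succ_iff] using hv.fintype_card_le_finrank
      simp [(ιMulti ℝ n).map_linearDependent v hv]
  rw [h]
  exact Submodule.fg_biSup _ _ fun n _ => Module.Finite.iff_fg.1 inferInstance

/-- The algebra morphism from the exterior algebra of a dual space to the dual numbers given by
evaluation of linear forms at a vector. -/
noncomputable def ev {W : Type*} [AddCommGroup W] [Module ℝ W] (w : W) :
    ExteriorAlgebra ℝ (Module.Dual ℝ W) →ₐ[ℝ] DualNumber ℝ :=
  ExteriorAlgebra.lift ℝ ⟨(TrivSqZeroExt.inrHom ℝ ℝ).comp (Module.Dual.eval ℝ W w), fun m => by simp⟩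

variable {W : Type*} [AddCommGroup W] [Module ℝ W] (w : W)

@[simp] theorem ev_ι (η : Module.Dual ℝ W) : ev w (ι ℝ η) = TrivSqZeroExt.inr (η w) := by
  simp [ev]

theorem fst_ev (a : ExteriorAlgebra ℝ (Module.Dual ℝ W)) :
    (ev w a).fst = algebraMapInv a := by
  induction a using ExteriorAlgebra.induction with
  | algebraMap r => simp [TrivSqZeroExt.algebraMap_eq_inl, algebraMap_leftInverse _ r]
  | ι x => simp [algebraMapInv]
  | mul a c ha hc => simp [ha, hc]
  | add a c ha hc => simp [ha, hc]

/-- The degree-one part is the second component of a morphism to a square-zero extension, and the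
formula is the product of that extension. -/
theorem ιInv_mul (a b : ExteriorAlgebra ℝ V) :
    ιInv (a * b) = algebraMapInv a • ιInv b + algebraMapInv b • ιInv a := by
  -- The square-zero extension needs a right action on `V`; it is the left action, read on the
  -- right.
  let : Module ℝᵐᵒᵖ V := Module.compHom _ ((RingHom.id ℝ).fromOpposite mul_comm)
  have : IsCentralScalar ℝ V := ⟨fun r m => rfl⟩
  have hf : ∀ x : ExteriorAlgebra ℝ V, (toTrivSqZeroExt x).fst = algebraMapInv x := fun x => by
    induction x using ExteriorAlgebra.induction with
    | algebraMap r => simp [TrivSqZeroExt.algebraMap_eq_inl, algebraMap_leftInverse _ r]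
    | ι x => simp [algebraMapInv]
    | mul a c ha hc => simp [ha, hc]
    | add a c ha hc => simp [ha, hc]
  have h : ∀ x : ExteriorAlgebra ℝ V, ιInv x = (toTrivSqZeroExt x).snd := fun x => rfl
  simp only [h, map_mul, TrivSqZeroExt.snd_mul, hf]
  simp

theorem snd_ev (a : ExteriorAlgebra ℝ (Module.Dual ℝ W)) :
    (ev w a).snd = ιInv a w := by
  induction a using ExteriorAlgebra.induction with
  | algebraMap r =>
    have : ιInv (algebraMap ℝ (ExteriorAlgebra ℝ (Module.Dual ℝ W)) r) = 0 := by
      simp [ιInv, TrivSqZeroExt.algebraMap_eq_inl]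
    simp [TrivSqZeroExt.algebraMap_eq_inl, this]
  | ι x => simp [ι_leftInverse x]
  | mul a c ha hc => simp [ha, hc, ιInv_mul, fst_ev, mul_comm]
  | add a c ha hc => simp [ha, hc]

end

end ExteriorAlgebra

/-! ### Smooth functions: parametric integrals, cut-offs, Hadamard's lemma -/

section Hadamard

open MeasureTheory in
-- The integral is the value at `0` of the convolution of the indicator of `(0, 1]` with `s ↦ χ(s)
-- g(p, -s)`. The bump `χ` is `1` on `[-2, 2]`, so it does not change the integrand where it counts,
-- and it makes the second factor compactly supported; smooth dependence on parameters is then a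
-- theorem on convolutions.
theorem ContDiff.parametric_intervalIntegral {P G : Type*} [NormedAddCommGroup P]
    [NormedSpace ℝ P] [NormedAddCommGroup G] [NormedSpace ℝ G] [CompleteSpace G] {g : P → ℝ → G}
    (hg : ContDiff ℝ ∞ (Function.uncurry g)) :
    ContDiff ℝ ∞ (fun p => ∫ t in (0 : ℝ)..1, g p t) := by
  let χ : ContDiffBump (0 : ℝ) := ⟨2, 3, by norm_num, by norm_num⟩
  have h := contDiffOn_convolution_right_with_param_comp (𝕜 := ℝ) (μ := volume) (n := ⊤)
    (ContinuousLinearMap.lsmul ℝ ℝ : ℝ →L[ℝ] G →L[ℝ] G) (s := Set.univ) (v := fun _ : P => (0 : ℝ))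
    contDiffOn_const (f := (Set.Ioc (0 : ℝ) 1).indicator 1) (g := fun p s => χ s • g p (-s))
    isOpen_univ (isCompact_closedBall (0 : ℝ) 3)
    (fun p x _ hx => by
      rw [χ.zero_of_le_dist (le_of_lt (by simpa using hx)), zero_smul])
    ((integrable_indicator_iff measurableSet_Ioc).2
      (integrableOn_const (by simp))).locallyIntegrable
    (ContDiff.contDiffOn ((χ.contDiff.comp contDiff_snd).smul
      (hg.comp (contDiff_fst.prodMk contDiff_snd.neg))))
  rw [contDiffOn_univ] at h
  convert h using 1
  ext p
  rw [intervalIntegral.integral_of_le zero_le_one, convolution, ← integral_indicator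
    measurableSet_Ioc]
  refine integral_congr_ae (Eventually.of_forall fun t => ?_)
  by_cases ht : t ∈ Set.Ioc (0 : ℝ) 1
  · have : χ (-t) = 1 := χ.one_of_mem_closedBall (by
      simp only [mem_closedBall_zero_iff, norm_neg, Real.norm_eq_abs, χ]
      rw [abs_le]; constructor <;> linarith [ht.1, ht.2])
    simp [ht, this]
  · simp [ht]

/-- Hadamard's lemma. -/
theorem ContDiff.exists_eq_apply_sub {V : Type*} [NormedAddCommGroup V] [NormedSpace ℝ V]
    {f : V → ℝ} (hf : ContDiff ℝ ∞ f) (y₀ : V) :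
    ∃ G : V → V →L[ℝ] ℝ, ContDiff ℝ ∞ G ∧ G y₀ = fderiv ℝ f y₀ ∧
      ∀ y, f y = f y₀ + G y (y - y₀) := by
  have hf' : ContDiff ℝ ∞ (fderiv ℝ f) := hf.fderiv_right (by simp)
  refine ⟨fun y => ∫ t in (0 : ℝ)..1, fderiv ℝ f (y₀ + t • (y - y₀)),
    ContDiff.parametric_intervalIntegral (g := fun y t => fderiv ℝ f (y₀ + t • (y - y₀))) ?_,
    by simp, fun y => ?_⟩
  · exact hf'.comp (contDiff_const.add (contDiff_snd.smul (contDiff_fst.sub contDiff_const)))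
  · have hc : Continuous fun t : ℝ => fderiv ℝ f (y₀ + t • (y - y₀)) :=
      hf'.continuous.comp (by fun_prop)
    beta_reduce
    rw [ContinuousLinearMap.intervalIntegral_apply (hc.intervalIntegrable _ _)]
    have h := intervalIntegral.integral_eq_sub_of_hasDerivAt
      (f := fun t : ℝ => f (y₀ + t • (y - y₀))) (a := 0) (b := 1)
      (f' := fun t => fderiv ℝ f (y₀ + t • (y - y₀)) (y - y₀)) (fun t _ => ?_)
      ((hc.clm_apply continuous_const).intervalIntegrable _ _)
    · rw [h]; simp
    · have h1 : HasDerivAt (fun t : ℝ => y₀ + t • (y - y₀)) (y - y₀) t := by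
        simpa using ((hasDerivAt_id t).smul_const (y - y₀)).const_add y₀
      exact ((hf.differentiable (by simp) _).hasFDerivAt).comp_hasDerivAt t h1

end Hadamard

section Cutoff

variable {B : Type*} [NormedAddCommGroup B] [NormedSpace ℝ B] [FiniteDimensional ℝ B]
  {M : Type*} [TopologicalSpace M] [T2Space M] [ChartedSpace B M] [IsManifold 𝓘(ℝ, B) ∞ M]

theorem exists_contMDiff_bump {x : M} {s : Set M} (hs : s ∈ 𝓝 x) :
    ∃ χ : M → ℝ, ContMDiff 𝓘(ℝ, B) 𝓘(ℝ, ℝ) ∞ χ ∧ (∀ᶠ y in 𝓝 x, χ y = 1) ∧ tsupport χ ⊆ s := by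
  obtain ⟨f, -, hf⟩ := (SmoothBumpFunction.nhds_basis_tsupport (I := 𝓘(ℝ, B)) x).mem_iff.1 hs
  exact ⟨f, f.contMDiff, f.eventuallyEq_one, hf⟩

omit [FiniteDimensional ℝ B] [T2Space M] [IsManifold 𝓘(ℝ, B) ∞ M] in
theorem ContMDiffOn.smul_of_tsupport_subset {G : Type*} [NormedAddCommGroup G] [NormedSpace ℝ G]
    {χ : M → ℝ} {f : M → G} {u : Set M} (hu : IsOpen u) (hχ : ContMDiff 𝓘(ℝ, B) 𝓘(ℝ, ℝ) ∞ χ)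
    (hf : ContMDiffOn 𝓘(ℝ, B) 𝓘(ℝ, G) ∞ f u) (h : tsupport χ ⊆ u) :
    ContMDiff 𝓘(ℝ, B) 𝓘(ℝ, G) ∞ (fun x => χ x • f x) := by
  refine contMDiff_of_tsupport fun x hx => ?_
  exact hχ.contMDiffAt.smul (hf.contMDiffAt (hu.mem_nhds (h (tsupport_smul_subset_left χ f hx))))

theorem exists_contMDiff_extension {G : Type*} [NormedAddCommGroup G] [NormedSpace ℝ G]
    {f : M → G} {u : Set M} (hu : IsOpen u) {x : M} (hx : x ∈ u)
    (hf : ContMDiffOn 𝓘(ℝ, B) 𝓘(ℝ, G) ∞ f u) :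
    ∃ g : M → G, ContMDiff 𝓘(ℝ, B) 𝓘(ℝ, G) ∞ g ∧ g =ᶠ[𝓝 x] f := by
  obtain ⟨χ, h1, h2, h3⟩ := exists_contMDiff_bump (B := B) (hu.mem_nhds hx)
  exact ⟨_, hf.smul_of_tsupport_subset hu h1 h3, by filter_upwards [h2] with y hy; simp [hy]⟩

/-- A function with vanishing one-jet is near the point a sum of products of functions vanishing
at the point. -/
theorem ContMDiff.exists_eq_sum_mul {c : M → ℝ} (hc : ContMDiff 𝓘(ℝ, B) 𝓘(ℝ, ℝ) ∞ c) {x : M}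
    (h0 : c x = 0) (h1 : mvfderiv 𝓘(ℝ, B) c x = 0) :
    ∃ (n : ℕ) (g h : Fin n → M → ℝ), (∀ i, ContMDiff 𝓘(ℝ, B) 𝓘(ℝ, ℝ) ∞ (g i)) ∧
      (∀ i, ContMDiff 𝓘(ℝ, B) 𝓘(ℝ, ℝ) ∞ (h i)) ∧ (∀ i, g i x = 0) ∧ (∀ i, h i x = 0) ∧
      ∀ᶠ y in 𝓝 x, c y = ∑ i, g i y * h i y := by
  set e := extChartAt 𝓘(ℝ, B) x with he
  have hopen : IsOpen e.target := isOpen_extChartAt_target x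
  have hF : ContMDiffOn 𝓘(ℝ, B) 𝓘(ℝ, ℝ) ∞ (c ∘ e.symm) e.target :=
    hc.comp_contMDiffOn (contMDiffOn_extChartAt_symm x)
  obtain ⟨F, hFs, hFe⟩ := exists_contMDiff_extension (B := B) hopen (mem_extChartAt_target x) hF
  obtain ⟨G, hG, hG0, hGF⟩ := (contMDiff_iff_contDiff.1 hFs).exists_eq_apply_sub (e x)
  have hxs : x ∈ e.source := mem_extChartAt_source x
  have hsrc : IsOpen e.source := isOpen_extChartAt_source x
  have hsm : ContMDiffOn 𝓘(ℝ, B) 𝓘(ℝ, B) ∞ e e.source := by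
    rw [he, extChartAt_source]; exact contMDiffOn_extChartAt
  have hFx : F (e x) = 0 := by
    rw [hFe.self_of_nhds, Function.comp_apply, e.left_inv hxs, h0]
  have hFd : fderiv ℝ F (e x) = 0 := by
    rw [hFe.fderiv_eq]
    have := (hc.mdifferentiableAt (x := x) (by simp)).mvfderiv
    rw [h1] at this
    rw [ModelWithCorners.range_eq_univ, fderivWithin_univ] at this
    exact this.symm
  let b := Module.finBasis ℝ B
  have hlin : ∀ i, ContDiff ℝ ∞ fun y => b.coord i (y - e x) := fun i =>
    ((b.coord i).toContinuousLinearMap.contDiff).comp (contDiff_id.sub contDiff_const)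
  -- The first factors are the centred coordinates, the second ones the components of the map `G` of
  -- Hadamard's lemma. The latter vanish at `x` because `G` is there the differential of `F`, which
  -- is zero.
  choose g hg hge using fun i => exists_contMDiff_extension (B := B) hsrc hxs
    ((hlin i).contMDiff.comp_contMDiffOn hsm)
  choose h hh hhe using fun i => exists_contMDiff_extension (B := B) hsrc hxs
    ((hG.clm_apply (contDiff_const (c := b i))).contMDiff.comp_contMDiffOn hsm)
  refine ⟨_, g, h, hg, hh, fun i => ?_, fun i => ?_, ?_⟩
  · rw [(hge i).self_of_nhds]; simp
  · rw [(hhe i).self_of_nhds]; simp [hG0, hFd]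
  · have h3 : ∀ᶠ y in 𝓝 x, F (e y) = (c ∘ e.symm) (e y) :=
      (continuousAt_extChartAt (I := 𝓘(ℝ, B)) x).eventually hFe
    filter_upwards [h3, hsrc.mem_nhds hxs, eventually_all.2 hge, eventually_all.2 hhe]
      with y hy hys hgy hhy
    have h4 : c y = F (e y) := by rw [hy]; simp [e.left_inv hys]
    rw [h4, hGF, hFx, zero_add]
    conv_lhs => rw [← b.sum_repr (e y - e x), map_sum]
    refine Finset.sum_congr rfl fun i _ => ?_
    rw [hgy, hhy]
    simp

end Cutoff

/-! ### Superfunctions on `ΠE` -/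

namespace BatchelorModel

open SuperAlg

noncomputable section

variable {B F : Type*} [NormedAddCommGroup B] [NormedSpace ℝ B]
  [NormedAddCommGroup F] [NormedSpace ℝ F]
  {M : Type*} [TopologicalSpace M] [ChartedSpace B M]
  {E : M → Type*} [∀ x, AddCommGroup (E x)] [∀ x, Module ℝ (E x)]
  [TopologicalSpace (TotalSpace F E)] [∀ x, TopologicalSpace (E x)] [FiberBundle F E]

theorem generated_le_superFun : generated B F E ≤ superFun B F E :=
  fun g hg _ => ⟨g, hg, Eventually.of_forall fun _ => rfl⟩

/-- Smooth functions on `M` as superfunctions. -/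
def fn (c : M → ℝ) (hc : ContMDiff 𝓘(ℝ, B) 𝓘(ℝ, ℝ) ∞ c) : superFun B F E :=
  ⟨fun x => algebraMap ℝ _ (c x),
    generated_le_superFun (Algebra.subset_adjoin (Or.inl ⟨c, hc, fun _ => rfl⟩))⟩

/-- Smooth sections of `E*` as superfunctions. -/
def sec (η : ∀ x, Module.Dual ℝ (E x)) (hη : IsSmoothDualSection B F E η) : superFun B F E :=
  ⟨fun x => ExteriorAlgebra.ι ℝ (η x),
    generated_le_superFun (Algebra.subset_adjoin (Or.inr ⟨η, hη, fun _ => rfl⟩))⟩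

theorem fn_mem_parity (c : M → ℝ) (hc : ContMDiff 𝓘(ℝ, B) 𝓘(ℝ, ℝ) ∞ c) :
    (fn c hc : superFun B F E) ∈ parity B F E 0 :=
  fun _ => CliffordAlgebra.one_le_evenOdd_zero _ (Submodule.mem_one.2 ⟨_, rfl⟩)

theorem sec_mem_parity (η : ∀ x, Module.Dual ℝ (E x)) (hη : IsSmoothDualSection B F E η) :
    sec η hη ∈ parity B F E 1 :=
  fun _ => CliffordAlgebra.ι_mem_evenOdd_one _ _

theorem isAffine_fn (c : M → ℝ) (hc : ContMDiff 𝓘(ℝ, B) 𝓘(ℝ, ℝ) ∞ c) :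
    IsAffine (fn c hc : superFun B F E) := fun x => ⟨c x, 0, by simp [fn]⟩

theorem isAffine_sec (η : ∀ x, Module.Dual ℝ (E x)) (hη : IsSmoothDualSection B F E η) :
    IsAffine (sec η hη) := fun x => ⟨0, η x, by simp [sec]⟩

theorem mul_mem_parity {p q : ZMod 2} {f g : superFun B F E} (hf : f ∈ parity B F E p)
    (hg : g ∈ parity B F E q) : f * g ∈ parity B F E (p + q) :=
  fun x => CliffordAlgebra.evenOdd_mul_le _ p q (Submodule.mul_mem_mul (hf x) (hg x))

/-- Superfunctions supercommute. -/
theorem superFun_mul_comm {p q : ZMod 2} {f g : superFun B F E} (hf : f ∈ parity B F E p)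
    (hg : g ∈ parity B F E q) : f * g = koszul p q • (g * f) :=
  Subtype.ext (funext fun x => ExteriorAlgebra.mul_eq_koszul_smul_mul (hf x) (hg x))

/-- Induction on superfunctions for germs: a property of germs at `x` which is stable under sums
and products with smooth functions and smooth sections of `E*`, and holds for `1`. -/
theorem superFun_induction {x : M} {P : superFun B F E → Prop}
    (hlocal : ∀ f g, (∀ᶠ y in 𝓝 x, f.1 y = g.1 y) → P f → P g)
    (hone : P 1) (hadd : ∀ f g, P f → P g → P (f + g))
    (hfn : ∀ c hc f, P f → P (fn c hc * f)) (hsec : ∀ η hη f, P f → P (sec η hη * f))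
    (f : superFun B F E) : P f := by
  obtain ⟨g, hg, hfg⟩ := f.2 x
  refine hlocal ⟨g, generated_le_superFun hg⟩ f (hfg.mono fun y hy => hy.symm) ?_
  -- Strengthened to multiplication by an arbitrary `k`, so that the product case is two successive
  -- multiplications.
  suffices h : ∀ k, P k → P (⟨g, generated_le_superFun hg⟩ * k) by simpa using h 1 hone
  clear hfg
  induction hg using Algebra.adjoin_induction with
  | mem g hg =>
    intro k hk
    rcases hg with ⟨c, hc, h⟩ | ⟨η, hη, h⟩
    · obtain rfl : g = _ := funext h
      exact hfn c hc k hk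
    · obtain rfl : g = _ := funext h
      exact hsec η hη k hk
  | algebraMap r =>
    intro k hk
    exact hfn (fun _ => r) contMDiff_const k hk
  | add g h hg hh ihg ihh =>
    intro k hk
    have := hadd _ _ (ihg k hk) (ihh k hk)
    rw [← add_mul] at this
    exact this
  | mul g h hg hh ihg ihh =>
    intro k hk
    have := ihg _ (ihh k hk)
    rw [← mul_assoc] at this
    exact this

/-- Evaluation of superfunctions at a point `v` of `E`, with values in the dual numbers. -/
def evAt (v : TotalSpace F E) : superFun B F E →ₐ[ℝ] DualNumber ℝ :=
  (ExteriorAlgebra.ev v.2).comp ((Pi.evalAlgHom ℝ _ v.1).comp (superFun B F E).val)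

theorem evAt_apply (v : TotalSpace F E) (f : superFun B F E) :
    evAt v f = ExteriorAlgebra.ev v.2 (f.1 v.1) := rfl

theorem fst_evAt (v : TotalSpace F E) (f : superFun B F E) : (evAt v f).fst = body f v.1 :=
  ExteriorAlgebra.fst_ev _ _

/-- The fibrewise linear function on `E` given by the component in `E*` of a superfunction. -/
def linPart (f : superFun B F E) (v : TotalSpace F E) : ℝ := (evAt v f).snd

theorem affinePart_eq (f : superFun B F E) (v : TotalSpace F E) :
    affinePart f v = (evAt v f).fst + (evAt v f).snd := by
  rw [fst_evAt, affinePart, evAt_apply, ExteriorAlgebra.snd_ev]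

theorem affinePart_eq_add (f : superFun B F E) (v : TotalSpace F E) :
    affinePart f v = body f v.1 + linPart f v := by
  rw [affinePart_eq, fst_evAt, linPart]

@[simp] theorem evAt_fn (v : TotalSpace F E) (c : M → ℝ) (hc) :
    evAt v (fn c hc : superFun B F E) = algebraMap ℝ _ (c v.1) := by
  rw [evAt_apply]; exact AlgHom.commutes _ _

@[simp] theorem evAt_sec (v : TotalSpace F E) (η : ∀ x, Module.Dual ℝ (E x)) (hη) :
    evAt v (sec η hη : superFun B F E) = TrivSqZeroExt.inr (η v.1 v.2) := by
  rw [evAt_apply]; exact ExteriorAlgebra.ev_ι _ _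

@[simp] theorem body_fn (c : M → ℝ) (hc) : body (fn c hc : superFun B F E) = c :=
  funext fun _ => ExteriorAlgebra.algebraMap_leftInverse _ _

/-- Since `τ² = 0`, evaluation kills every product containing two linear forms; only degrees zero
and one remain, and they land in the even and the odd part. -/
theorem evAt_mem_dualParity (v : TotalSpace F E) {p : ZMod 2} {f : superFun B F E}
    (hf : f ∈ parity B F E p) : evAt v f ∈ dualParity p := by
  have key : ∀ (q : ZMod 2) (a : ExteriorAlgebra ℝ (Module.Dual ℝ (E v.1))),
      a ∈ CliffordAlgebra.evenOdd (0 : QuadraticForm ℝ (Module.Dual ℝ (E v.1))) q →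
      ExteriorAlgebra.ev v.2 a ∈ dualParity q := by
    intro q a ha
    induction a, ha using CliffordAlgebra.evenOdd_induction with
    | range_ι_pow a h =>
      rcases parity_cases q with rfl | rfl
      · obtain ⟨r, rfl⟩ : ∃ r, algebraMap ℝ _ r = a := by simpa [Submodule.mem_one] using h
        have : ExteriorAlgebra.ev v.2 (algebraMap ℝ
          (ExteriorAlgebra ℝ (Module.Dual ℝ (E v.1))) r) = algebraMap ℝ _ r := AlgHom.commutes _ _
        erw [this]
        simp [dualParity, TrivSqZeroExt.algebraMap_eq_inl]
      · obtain ⟨m, rfl⟩ : ∃ m, ExteriorAlgebra.ι ℝ m = a := by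
          simpa [ZMod.val_one] using h
        rw [ExteriorAlgebra.ev_ι]
        simp [dualParity]
    | add x y hx hy ihx ihy =>
      erw [map_add]; exact add_mem ihx ihy
    | ι_mul_ι_mul m₁ m₂ x hx ih =>
      have h : ExteriorAlgebra.ev v.2 (ExteriorAlgebra.ι ℝ m₁ * ExteriorAlgebra.ι ℝ m₂ * x) = 0 := by
        simp only [map_mul, ExteriorAlgebra.ev_ι]
        rw [TrivSqZeroExt.inr_mul_inr, zero_mul]
      erw [h]
      exact zero_mem _
  exact key p _ (hf v.1)

theorem body_eq_zero_of_odd {f : superFun B F E} (hf : f ∈ parity B F E 1) (x : M) :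
    body f x = 0 := by
  have h : evAt (⟨x, 0⟩ : TotalSpace F E) f ∈ dualParity 1 := evAt_mem_dualParity _ hf
  rw [← fst_evAt (⟨x, 0⟩ : TotalSpace F E) f]
  simpa [dualParity] using h

theorem linPart_eq_zero_of_even {f : superFun B F E} (hf : f ∈ parity B F E 0)
    (v : TotalSpace F E) : linPart f v = 0 := by
  have h : evAt v f ∈ dualParity 0 := evAt_mem_dualParity _ hf
  exact h

theorem body_mul (f g : superFun B F E) : body (f * g) = body f * body g :=
  funext fun x => by simp [body]

theorem body_add (f g : superFun B F E) : body (f + g) = body f + body g :=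
  funext fun x => by simp [body]

theorem linPart_mul (f g : superFun B F E) (v : TotalSpace F E) :
    linPart (f * g) v = body f v.1 * linPart g v + body g v.1 * linPart f v := by
  simp [linPart, fst_evAt, mul_comm]

end

end BatchelorModel

/-! ### Smooth sections of bundles of linear maps -/

section

variable {V : Type*} [NormedAddCommGroup V] [NormedSpace ℝ V]
  {H : Type*} [TopologicalSpace H] {I : ModelWithCorners ℝ V H}
  {N : Type*} [TopologicalSpace N] [ChartedSpace H N]
  {V' : Type*} [NormedAddCommGroup V'] [NormedSpace ℝ V']
  {H' : Type*} [TopologicalSpace H'] {I' : ModelWithCorners ℝ V' H'}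
  {N' : Type*} [TopologicalSpace N'] [ChartedSpace H' N']

/-- Stated for fields along a map `b`, so that it serves vector fields on `M` and on `E` as well as
fields along curves. -/
theorem ContMDiffAt.mvfderiv_apply [IsManifold I ∞ N] {G : Type*} [NormedAddCommGroup G]
    [NormedSpace ℝ G] {f : N → G} {b : N' → N} {v : ∀ m, TangentSpace I (b m)} {m₀ : N'}
    (hf : ContMDiffAt I 𝓘(ℝ, G) ∞ f (b m₀))
    (hv : ContMDiffAt I' I.tangent ∞ (fun m => (⟨b m, v m⟩ : TangentBundle I N)) m₀) :
    ContMDiffAt I' 𝓘(ℝ, G) ∞ (fun m => mvfderiv I f (b m) (v m)) m₀ := by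
  have : IsManifold I 1 N := IsManifold.of_le (n := ∞) (by simp)
  have hb : ContMDiffAt I' I ∞ b m₀ := (contMDiffAt_totalSpace.1 hv).1
  have h1 : ContMDiffAt I 𝓘(ℝ, V →L[ℝ] G) ∞ _ (b m₀) := hf.mfderiv_const (m := ∞) (by simp)
  have h2 := h1.comp m₀ hb
  have h3 := ContMDiffAt.clm_apply_of_inCoordinates (b₁ := b) (b₂ := fun m => f (b m))
    (ϕ := fun m => mfderiv I 𝓘(ℝ, G) f (b m)) (E₂ := (TangentSpace 𝓘(ℝ, G) : G → Type _))
    (F₂ := G) h2 hv (hf.comp m₀ hb)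
  exact (contMDiff_snd_tangentBundle_modelSpace G 𝓘(ℝ, G)).contMDiffAt.comp m₀ h3

variable {F₁ F₂ : Type*} [NormedAddCommGroup F₁] [NormedSpace ℝ F₁] [FiniteDimensional ℝ F₁]
  [NormedAddCommGroup F₂] [NormedSpace ℝ F₂]
  {E₁ : N → Type*} [∀ x, AddCommGroup (E₁ x)] [∀ x, Module ℝ (E₁ x)]
  [TopologicalSpace (TotalSpace F₁ E₁)] [∀ x, TopologicalSpace (E₁ x)]
  {E₂ : N → Type*} [∀ x, AddCommGroup (E₂ x)] [∀ x, Module ℝ (E₂ x)]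
  [TopologicalSpace (TotalSpace F₂ E₂)] [∀ x, TopologicalSpace (E₂ x)]
  [FiberBundle F₁ E₁] [VectorBundle ℝ F₁ E₁] [FiberBundle F₂ E₂] [VectorBundle ℝ F₂ E₂]
  [∀ x, IsTopologicalAddGroup (E₂ x)] [∀ x, ContinuousSMul ℝ (E₂ x)]

/-- A section of a bundle of linear maps is smooth if its values on a local frame are. -/
theorem contMDiffAt_hom_of_localFrame {n : WithTop ℕ∞} {ϕ : ∀ x, E₁ x →L[ℝ] E₂ x} {x₀ : N}
    {ι : Type*} [Finite ι] (b : Module.Basis ι ℝ F₁)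
    (h : ∀ i, ContMDiffAt I (I.prod 𝓘(ℝ, F₂)) n (fun x => TotalSpace.mk' F₂ x
      (ϕ x ((trivializationAt F₁ E₁ x₀).localFrame b i x))) x₀) :
    ContMDiffAt I (I.prod 𝓘(ℝ, F₁ →L[ℝ] F₂)) n
      (fun x => TotalSpace.mk' (F₁ →L[ℝ] F₂) (E := fun x => E₁ x →L[ℝ] E₂ x) x (ϕ x)) x₀ := by
  have := Fintype.ofFinite ι
  refine (contMDiffAt_hom_bundle _).2 ⟨contMDiffAt_id, ?_⟩
  -- A linear map depends linearly on its finitely many values on a basis, so smooth values give a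
  -- smooth map.
  have h1 : ∀ A : F₁ →L[ℝ] F₂, A = ∑ i, ContinuousLinearMap.smulRightL ℝ F₁ F₂
      (b.coord i).toContinuousLinearMap (A (b i)) := by
    intro A
    refine ContinuousLinearMap.coe_inj.1 (b.ext fun j => ?_)
    classical simp [Finsupp.single_apply]
  have h2 : ∀ i, ContMDiffAt I 𝓘(ℝ, F₂) n (fun x => ContinuousLinearMap.inCoordinates F₁ E₁ F₂ E₂
      x₀ x x₀ x (ϕ x) (b i)) x₀ := by
    intro i
    refine ((contMDiffAt_totalSpace).1 (h i)).2.congr_of_eventuallyEq ?_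
    filter_upwards [(trivializationAt F₁ E₁ x₀).open_baseSet.mem_nhds
      (FiberBundle.mem_baseSet_trivializationAt' x₀),
      (trivializationAt F₂ E₂ x₀).open_baseSet.mem_nhds
      (FiberBundle.mem_baseSet_trivializationAt' x₀)] with x hx hx'
    rw [ContinuousLinearMap.inCoordinates_eq hx hx']
    simp [hx, Trivialization.basisAt]
  have h3 : ContMDiffAt I 𝓘(ℝ, F₁ →L[ℝ] F₂) n
      (fun x => ∑ i, ContinuousLinearMap.smulRightL ℝ F₁ F₂
      (b.coord i).toContinuousLinearMap (ContinuousLinearMap.inCoordinates F₁ E₁ F₂ E₂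
      x₀ x x₀ x (ϕ x) (b i))) x₀ :=
    contMDiffAt_finsetSum fun i _ =>
      ((ContinuousLinearMap.smulRightL ℝ F₁ F₂
        (b.coord i).toContinuousLinearMap).contDiff.contMDiff.contMDiffAt.comp x₀ (h2 i))
  exact h3.congr_of_eventuallyEq (Eventually.of_forall fun x => h1 _)

end

/-! ### Smoothness of the components of a superfunction -/

namespace BatchelorModel

open SuperAlg

noncomputable section

variable {B F : Type*} [NormedAddCommGroup B] [NormedSpace ℝ B]
  [NormedAddCommGroup F] [NormedSpace ℝ F]
  {M : Type*} [TopologicalSpace M] [ChartedSpace B M]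
  {E : M → Type*} [∀ x, AddCommGroup (E x)] [∀ x, Module ℝ (E x)]
  [TopologicalSpace (TotalSpace F E)] [∀ x, TopologicalSpace (E x)] [FiberBundle F E]

theorem contMDiff_body (f : superFun B F E) : ContMDiff 𝓘(ℝ, B) 𝓘(ℝ, ℝ) ∞ (body f) := by
  intro x
  refine superFun_induction (x := x) (P := fun f => ContMDiffAt 𝓘(ℝ, B) 𝓘(ℝ, ℝ) ∞ (body f) x)
    ?_ ?_ ?_ ?_ ?_ f
  · intro f g h hf
    exact hf.congr_of_eventuallyEq (h.mono fun y hy => by simp [body, hy])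
  · have : body (1 : superFun B F E) = fun _ => 1 := funext fun y => by simp [body]
    rw [this]; exact contMDiffAt_const
  · intro f g hf hg
    rw [body_add]; exact hf.add hg
  · intro c hc f hf
    rw [body_mul, body_fn]; exact hc.contMDiffAt.mul hf
  · intro η hη f hf
    have : body (sec η hη * f) = fun _ => 0 := funext fun y => by
      rw [body_mul, Pi.mul_apply, body_eq_zero_of_odd (sec_mem_parity η hη), zero_mul]
    rw [this]; exact contMDiffAt_const


end

noncomputable section

variable {B F : Type*} [NormedAddCommGroup B] [NormedSpace ℝ B]
  [NormedAddCommGroup F] [NormedSpace ℝ F]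
  {M : Type*} [TopologicalSpace M] [ChartedSpace B M]
  {E : M → Type*} [∀ x, AddCommGroup (E x)] [∀ x, Module ℝ (E x)]
  [TopologicalSpace (TotalSpace F E)] [∀ x, TopologicalSpace (E x)] [FiberBundle F E]
  [VectorBundle ℝ F E] [IsManifold 𝓘(ℝ, B) ∞ M] [ContMDiffVectorBundle ∞ F E 𝓘(ℝ, B)]

/-- Induction on germs: a factor `c` on `M` scales the linear part, and a factor `η` in `E*`
replaces it by the body of `f` times `η`. -/
theorem contMDiff_linPart (f : superFun B F E) :
    ContMDiff (𝓘(ℝ, B).prod 𝓘(ℝ, F)) 𝓘(ℝ, ℝ) ∞ (linPart f) := by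
  intro v
  have hπ : ContMDiff (𝓘(ℝ, B).prod 𝓘(ℝ, F)) 𝓘(ℝ, B) ∞ (TotalSpace.proj : TotalSpace F E → M) :=
    contMDiff_proj E
  refine superFun_induction (x := v.1)
    (P := fun f => ContMDiffAt (𝓘(ℝ, B).prod 𝓘(ℝ, F)) 𝓘(ℝ, ℝ) ∞ (linPart f) v) ?_ ?_ ?_ ?_ ?_ f
  · intro f g h hf
    refine hf.congr_of_eventuallyEq ?_
    filter_upwards [(hπ.continuous.tendsto v).eventually h] with w hw
    simp [linPart, evAt_apply, hw]
  · have : linPart (1 : superFun B F E) = fun _ => 0 := funext fun y => by simp [linPart]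
    rw [this]; exact contMDiffAt_const
  · intro f g hf hg
    have : linPart (f + g) = linPart f + linPart g := funext fun w => by simp [linPart]
    rw [this]; exact hf.add hg
  · intro c hc f hf
    have : linPart (fn c hc * f) = fun w => c w.1 * linPart f w := funext fun w => by
      rw [linPart_mul, body_fn, linPart_eq_zero_of_even (fn_mem_parity c hc), mul_zero, add_zero]
    rw [this]
    exact (hc.comp hπ).contMDiffAt.mul hf
  · intro η hη f hf
    have : linPart (sec η hη * f) = fun w => body f w.1 * η w.1 w.2 := funext fun w => by
      rw [linPart_mul, body_eq_zero_of_odd (sec_mem_parity η hη), zero_mul, zero_add]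
      simp [linPart]
    rw [this]
    exact ((contMDiff_body f).comp hπ).contMDiffAt.mul hη.contMDiffAt

theorem contMDiff_affinePart (f : superFun B F E) :
    ContMDiff (𝓘(ℝ, B).prod 𝓘(ℝ, F)) 𝓘(ℝ, ℝ) ∞ (affinePart f) := by
  have : affinePart f = fun v => body f v.1 + linPart f v := funext (affinePart_eq_add f)
  rw [this]
  exact ((contMDiff_body f).comp (contMDiff_proj E)).add (contMDiff_linPart f)

/-- Smooth sections of `E*` over an open set can be extended from a smaller neighbourhood. -/
theorem exists_isSmoothDualSection_extension [FiniteDimensional ℝ B] [T2Space M]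
    {η : ∀ x, Module.Dual ℝ (E x)} {u : Set M} (hu : IsOpen u) {x : M} (hx : x ∈ u)
    (hη : ContMDiffOn (𝓘(ℝ, B).prod 𝓘(ℝ, F)) 𝓘(ℝ, ℝ) ∞ (fun v : TotalSpace F E => η v.1 v.2)
      (TotalSpace.proj ⁻¹' u)) :
    ∃ (χ : M → ℝ), IsSmoothDualSection B F E (fun x => χ x • η x) ∧ (∀ᶠ y in 𝓝 x, χ y = 1) ∧
      tsupport χ ⊆ u ∧ ContMDiff 𝓘(ℝ, B) 𝓘(ℝ, ℝ) ∞ χ := by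
  obtain ⟨χ, h1, h2, h3⟩ := exists_contMDiff_bump (M := M) (B := B) (hu.mem_nhds hx)
  have hπ : ContMDiff (𝓘(ℝ, B).prod 𝓘(ℝ, F)) 𝓘(ℝ, B) ∞ (TotalSpace.proj : TotalSpace F E → M) :=
    contMDiff_proj E
  refine ⟨χ, ?_, h2, h3, h1⟩
  intro v
  by_cases hv : v.1 ∈ u
  · exact ((h1.comp hπ).contMDiffAt).mul
      (hη.contMDiffAt ((hu.preimage hπ.continuous).mem_nhds hv))
  · have h0 : ∀ᶠ w : TotalSpace F E in 𝓝 v, χ w.1 = 0 := by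
      have := notMem_tsupport_iff_eventuallyEq.1 fun h => hv (h3 h)
      exact (hπ.continuous.tendsto v).eventually this
    refine (contMDiffAt_const (c := (0 : ℝ))).congr_of_eventuallyEq (h0.mono fun w hw => ?_)
    simp [hw]

end

end BatchelorModel

/-! ### Differentials of vector-valued functions -/

section

variable {V : Type*} [NormedAddCommGroup V] [NormedSpace ℝ V]
  {H : Type*} [TopologicalSpace H] {I : ModelWithCorners ℝ V H}
  {N : Type*} [TopologicalSpace N] [ChartedSpace H N]
  {G G' G'' : Type*} [NormedAddCommGroup G] [NormedSpace ℝ G]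
  [NormedAddCommGroup G'] [NormedSpace ℝ G'] [NormedAddCommGroup G''] [NormedSpace ℝ G'']

theorem Filter.EventuallyEq.mvfderiv_eq {f g : N → G} {x : N} (h : f =ᶠ[𝓝 x] g) :
    mvfderiv I f x = mvfderiv I g x := by
  simp only [mvfderiv, h.mfderiv_eq]
  rw [h.eq_of_nhds]

theorem mvfderiv_clm_apply₂ (β : G →L[ℝ] G' →L[ℝ] G'') {f : N → G} {g : N → G'} {x : N}
    (hf : MDifferentiableAt I 𝓘(ℝ, G) f x) (hg : MDifferentiableAt I 𝓘(ℝ, G') g x)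
    (v : TangentSpace I x) :
    mvfderiv I (fun y => β (f y) (g y)) x v =
      β (f x) (mvfderiv I g x v) + β (mvfderiv I f x v) (g x) := by
  have hfg : HasMFDerivAt I 𝓘(ℝ, G × G') (fun y => (f y, g y)) x _ :=
    hf.hasMFDerivAt.prodMk hg.hasMFDerivAt
  have h := HasMFDerivAt.comp x (g := fun p : G × G' => β p.1 p.2)
    (f := fun y => (f y, g y))
    (β.isBoundedBilinearMap.hasFDerivAt (f x, g x)).hasMFDerivAt hfg
  have h' := h.mfderiv
  change mfderiv I 𝓘(ℝ, G'') (fun y => β (f y) (g y)) x = _ at h'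
  simp only [mvfderiv, h']
  rfl

theorem mvfderiv_clm_apply (L : G →L[ℝ] G') {f : N → G} {x : N}
    (hf : MDifferentiableAt I 𝓘(ℝ, G) f x) (v : TangentSpace I x) :
    mvfderiv I (fun y => L (f y)) x v = L (mvfderiv I f x v) := by
  have h := (L.hasFDerivAt.hasMFDerivAt).comp x hf.hasMFDerivAt
  have h' := h.mfderiv
  change mfderiv I 𝓘(ℝ, G') (fun y => L (f y)) x = _ at h'
  simp only [mvfderiv, h']
  rfl

theorem mvfderiv_sum_smul {ι : Type*} [Fintype ι] {r : ι → N → ℝ} (w : ι → G) {x : N}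
    (hr : ∀ i, MDifferentiableAt I 𝓘(ℝ, ℝ) (r i) x) (v : TangentSpace I x) :
    mvfderiv I (fun y => ∑ i, r i y • w i) x v = ∑ i, mvfderiv I (r i) x v • w i := by
  classical
  have key : ∀ s : Finset ι, MDifferentiableAt I 𝓘(ℝ, G) (fun y => ∑ i ∈ s, r i y • w i) x ∧
      mvfderiv I (fun y => ∑ i ∈ s, r i y • w i) x v = ∑ i ∈ s, mvfderiv I (r i) x v • w i := by
    intro s
    induction s using Finset.induction_on with
    | empty => 
      simp only [Finset.sum_empty]
      exact ⟨mdifferentiableAt_const, by rw [mvfderiv_const]; rfl⟩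
    | insert a s ha ih =>
      simp only [Finset.sum_insert ha]
      have h1 : MDifferentiableAt I 𝓘(ℝ, G) (fun y => r a y • w a) x :=
        (hr a).smul mdifferentiableAt_const
      refine ⟨h1.add ih.1, ?_⟩
      rw [mvfderiv_fun_add h1 ih.1, _root_.add_apply, ih.2]
      congr 1
      have h2 := mvfderiv_clm_apply ((ContinuousLinearMap.id ℝ ℝ).smulRight (w a)) (hr a) v
      simpa using h2
  exact (key Finset.univ).2

/-- A linear functional vanishing on `S` is zero along `f`, hence zero on the derivative; such
functionals detect membership in `S`. This is how derivatives keep parity and affineness. -/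
theorem mvfderiv_mem_submodule [FiniteDimensional ℝ G] {f : N → G} {x : N} (S : Submodule ℝ G)
    (hf : MDifferentiableAt I 𝓘(ℝ, G) f x) (h : ∀ y, f y ∈ S) (v : TangentSpace I x) :
    mvfderiv I f x v ∈ S := by
  by_contra hn
  obtain ⟨φ, h1, h2⟩ := Submodule.exists_le_ker_of_notMem hn
  have h3 := mvfderiv_clm_apply (LinearMap.toContinuousLinearMap φ) hf v
  have h4 : (fun y => (LinearMap.toContinuousLinearMap φ) (f y)) = fun _ => 0 :=
    funext fun y => h2 (h y)
  rw [h4, mvfderiv_const] at h3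
  exact h1 h3.symm

end

/-! ### Functoriality of the exterior algebra and parity. -/

namespace ExteriorAlgebra

open SuperAlg

theorem map_mem_evenOdd {V W : Type*} [AddCommGroup V] [Module ℝ V] [AddCommGroup W] [Module ℝ W]
    (L : V →ₗ[ℝ] W) {p : ZMod 2} {a : ExteriorAlgebra ℝ V}
    (ha : a ∈ CliffordAlgebra.evenOdd (0 : QuadraticForm ℝ V) p) :
    map L a ∈ CliffordAlgebra.evenOdd (0 : QuadraticForm ℝ W) p := by
  induction a, ha using CliffordAlgebra.evenOdd_induction with
  | range_ι_pow a h =>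
    rcases parity_cases p with rfl | rfl
    · obtain ⟨r, rfl⟩ : ∃ r, algebraMap ℝ _ r = a := by simpa [Submodule.mem_one] using h
      have : map L (algebraMap ℝ (ExteriorAlgebra ℝ V) r) = algebraMap ℝ _ r :=
        AlgHom.commutes _ _
      erw [this]
      exact CliffordAlgebra.one_le_evenOdd_zero _ (Submodule.mem_one.2 ⟨_, rfl⟩)
    · obtain ⟨m, rfl⟩ : ∃ m, ExteriorAlgebra.ι ℝ m = a := by simpa [ZMod.val_one] using h
      rw [ExteriorAlgebra.map_apply_ι]
      exact CliffordAlgebra.ι_mem_evenOdd_one _ _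
  | add x y hx hy ihx ihy =>
    erw [map_add]; exact add_mem ihx ihy
  | ι_mul_ι_mul m₁ m₂ x hx ih =>
    have h : map L (ExteriorAlgebra.ι ℝ m₁ * ExteriorAlgebra.ι ℝ m₂ * x) =
        ExteriorAlgebra.ι ℝ (L m₁) * ExteriorAlgebra.ι ℝ (L m₂) * map L x := by
      simp
    erw [h]
    have h2 := CliffordAlgebra.evenOdd_mul_le _ 0 _ (Submodule.mul_mem_mul
      (CliffordAlgebra.ι_mul_ι_mem_evenOdd_zero (0 : QuadraticForm ℝ W) (L m₁) (L m₂)) ih)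
    rwa [zero_add] at h2

end ExteriorAlgebra

/-! ### Superfunctions and their derivatives in a local trivialization of `E`. -/

namespace BatchelorModel

open SuperAlg

noncomputable section

variable (F : Type*) [NormedAddCommGroup F] [NormedSpace ℝ F] [FiniteDimensional ℝ F]

/-- Linear coordinates on the exterior algebra. -/
def extCoord : ExteriorAlgebra ℝ (Module.Dual ℝ F) ≃ₗ[ℝ]
    (Fin (Module.finrank ℝ (ExteriorAlgebra ℝ (Module.Dual ℝ F))) → ℝ) :=
  (Module.finBasis ℝ _).equivFun

/-- Multiplication of the exterior algebra in linear coordinates. -/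
def extMul : (Fin (Module.finrank ℝ (ExteriorAlgebra ℝ (Module.Dual ℝ F))) → ℝ) →L[ℝ]
    (Fin (Module.finrank ℝ (ExteriorAlgebra ℝ (Module.Dual ℝ F))) → ℝ) →L[ℝ]
    (Fin (Module.finrank ℝ (ExteriorAlgebra ℝ (Module.Dual ℝ F))) → ℝ) :=
  LinearMap.toContinuousBilinearMap
    (((LinearMap.mul ℝ (ExteriorAlgebra ℝ (Module.Dual ℝ F))).compl₁₂
      (extCoord F).symm.toLinearMap (extCoord F).symm.toLinearMap).compr₂
        (extCoord F).toLinearMap)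

/-- Differentiation takes place in the normed space of coordinates. This identity turns the product
of the exterior algebra into a continuous bilinear map, to which the product rule applies. -/
theorem extMul_extCoord (a b : ExteriorAlgebra ℝ (Module.Dual ℝ F)) :
    extMul F (extCoord F a) (extCoord F b) = extCoord F (a * b) := by
  simp [extMul]

end

noncomputable section

variable {B F : Type*} [NormedAddCommGroup B] [NormedSpace ℝ B]
  [NormedAddCommGroup F] [NormedSpace ℝ F] [FiniteDimensional ℝ F]
  {M : Type*} [TopologicalSpace M] [ChartedSpace B M]
  {E : M → Type*} [∀ x, AddCommGroup (E x)] [∀ x, Module ℝ (E x)]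
  [TopologicalSpace (TotalSpace F E)] [∀ x, TopologicalSpace (E x)] [FiberBundle F E]
  [VectorBundle ℝ F E]

/-- A superfunction in the trivialization of `E` around `x₀`. -/
def trivFun (x₀ : M) (f : superFun B F E) (x : M) : ExteriorAlgebra ℝ (Module.Dual ℝ F) :=
  ExteriorAlgebra.map ((trivializationAt F E x₀).symmₗ ℝ x).dualMap (f.1 x)

/-- The inverse of the trivialization of `ΛE*` around `x₀`. -/
def trivInv (F E) [NormedAddCommGroup F] [NormedSpace ℝ F] 
  [∀ x, AddCommGroup (E x)] [∀ x, Module ℝ (E x)]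
  [TopologicalSpace (TotalSpace F E)] [∀ x, TopologicalSpace (E x)] [FiberBundle F E]
  [VectorBundle ℝ F E] (x₀ x : M) :
    ExteriorAlgebra ℝ (Module.Dual ℝ F) →ₐ[ℝ] ExteriorAlgebra ℝ (Module.Dual ℝ (E x)) :=
  ExteriorAlgebra.map ((trivializationAt F E x₀).linearMapAt ℝ x).dualMap

theorem trivInv_trivFun {x₀ x : M} (hx : x ∈ (trivializationAt F E x₀).baseSet)
    (f : superFun B F E) : trivInv F E x₀ x (trivFun x₀ f x) = f.1 x := by
  have h : ((trivializationAt F E x₀).linearMapAt ℝ x).dualMap ∘ₗ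
      ((trivializationAt F E x₀).symmₗ ℝ x).dualMap = LinearMap.id := by
    ext η y
    simp [Trivialization.symmₗ_linearMapAt _ hx]
  rw [trivInv, trivFun, ← AlgHom.comp_apply, ExteriorAlgebra.map_comp_map, h,
    ExteriorAlgebra.map_id, AlgHom.id_apply]

theorem trivFun_mul (x₀ : M) (f g : superFun B F E) (x : M) :
    trivFun x₀ (f * g) x = trivFun x₀ f x * trivFun x₀ g x := by simp [trivFun]

theorem trivFun_add (x₀ : M) (f g : superFun B F E) (x : M) :
    trivFun x₀ (f + g) x = trivFun x₀ f x + trivFun x₀ g x := by simp [trivFun]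

theorem trivFun_smul (x₀ : M) (r : ℝ) (f : superFun B F E) (x : M) :
    trivFun x₀ (r • f) x = r • trivFun x₀ f x := by simp [trivFun]

theorem trivFun_fn (x₀ : M) (c : M → ℝ) (hc) (x : M) :
    trivFun x₀ (fn c hc : superFun B F E) x = c x • 1 := by
  simp [trivFun, fn, Algebra.algebraMap_eq_smul_one]

theorem trivFun_sec (x₀ : M) (η : ∀ x, Module.Dual ℝ (E x)) (hη) (x : M) :
    trivFun x₀ (sec η hη : superFun B F E) x = ∑ a,
      η x ((trivializationAt F E x₀).localFrame (Module.finBasis ℝ F) a x) •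
        ExteriorAlgebra.ι ℝ ((Module.finBasis ℝ F).coord a) := by
  have h : ((trivializationAt F E x₀).symmₗ ℝ x).dualMap (η x) = ∑ a,
      η x ((trivializationAt F E x₀).localFrame (Module.finBasis ℝ F) a x) •
        (Module.finBasis ℝ F).coord a := by
    refine (Module.finBasis ℝ F).ext fun j => ?_
    have h1 : (trivializationAt F E x₀).symmₗ ℝ x (Module.finBasis ℝ F j) =
        (trivializationAt F E x₀).localFrame (Module.finBasis ℝ F) j x := by
      -- Outside the base set both sides take the default value zero.
      by_cases hx : x ∈ (trivializationAt F E x₀).baseSet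
      · simp [hx, Trivialization.basisAt]
      · rw [Trivialization.localFrame_apply_of_notMem _ _ hx,
          Trivialization.symmₗ_apply_of_notMem _ hx]
    simp [h1, Finsupp.single_apply]
  have h2 : trivFun x₀ (sec η hη : superFun B F E) x =
      ExteriorAlgebra.ι ℝ (((trivializationAt F E x₀).symmₗ ℝ x).dualMap (η x)) :=
    ExteriorAlgebra.map_apply_ι _ _
  rw [h2, h, map_sum]
  simp only [map_smul]

theorem trivFun_mem_evenOdd (x₀ : M) {p : ZMod 2} {f : superFun B F E} (hf : f ∈ parity B F E p)
    (x : M) : trivFun x₀ f x ∈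
      CliffordAlgebra.evenOdd (0 : QuadraticForm ℝ (Module.Dual ℝ F)) p :=
  ExteriorAlgebra.map_mem_evenOdd _ (hf x)

end

noncomputable section

variable {B F : Type*} [NormedAddCommGroup B] [NormedSpace ℝ B]
  [NormedAddCommGroup F] [NormedSpace ℝ F] [FiniteDimensional ℝ F]
  {M : Type*} [TopologicalSpace M] [ChartedSpace B M] [IsManifold 𝓘(ℝ, B) ∞ M]
  {E : M → Type*} [∀ x, AddCommGroup (E x)] [∀ x, Module ℝ (E x)]
  [TopologicalSpace (TotalSpace F E)] [∀ x, TopologicalSpace (E x)] [FiberBundle F E]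
  [VectorBundle ℝ F E] [ContMDiffVectorBundle ∞ F E 𝓘(ℝ, B)]

theorem contMDiffAt_apply_localFrame {x₀ x : M} (hx : x ∈ (trivializationAt F E x₀).baseSet)
    {η : ∀ x, Module.Dual ℝ (E x)} (hη : IsSmoothDualSection B F E η) (a) :
    ContMDiffAt 𝓘(ℝ, B) 𝓘(ℝ, ℝ) ∞ (fun y => η y ((trivializationAt F E x₀).localFrame
      (Module.finBasis ℝ F) a y)) x :=
  ContMDiffAt.comp x (f := fun y => (⟨y, (trivializationAt F E x₀).localFrame
    (Module.finBasis ℝ F) a y⟩ : TotalSpace F E)) hη.contMDiffAt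
    (contMDiffAt_localFrame_of_mem (I := 𝓘(ℝ, B)) ∞ _ _ a hx)

theorem contMDiffAt_trivFun {x₀ x : M} (hx : x ∈ (trivializationAt F E x₀).baseSet)
    (f : superFun B F E) :
    ContMDiffAt 𝓘(ℝ, B) 𝓘(ℝ, Fin (Module.finrank ℝ (ExteriorAlgebra ℝ (Module.Dual ℝ F))) → ℝ) ∞ (fun y => extCoord F (trivFun x₀ f y)) x := by
  refine superFun_induction (x := x) (P := fun f =>
    ContMDiffAt 𝓘(ℝ, B) 𝓘(ℝ, Fin (Module.finrank ℝ (ExteriorAlgebra ℝ (Module.Dual ℝ F))) → ℝ) ∞ (fun y => extCoord F (trivFun x₀ f y)) x) ?_ ?_ ?_ ?_ ?_ f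
  · intro f g h hf
    exact hf.congr_of_eventuallyEq (h.mono fun y hy => by simp [trivFun, hy])
  · have : (fun y => extCoord F (trivFun x₀ (1 : superFun B F E) y)) = fun _ => extCoord F 1 :=
      funext fun y => by simp [trivFun]
    rw [this]; exact contMDiffAt_const
  · intro f g hf hg
    simp only [trivFun_add, map_add]
    exact hf.add hg
  · intro c hc f hf
    simp only [trivFun_mul, trivFun_fn, smul_mul_assoc, one_mul, map_smul]
    exact hc.contMDiffAt.smul hf
  · intro η hη f hf
    simp only [trivFun_mul, ← extMul_extCoord]
    refine ContMDiffAt.clm_apply ((extMul F).contDiff.contMDiff.contMDiffAt.comp x ?_) hf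
    simp only [trivFun_sec, map_sum, map_smul]
    exact contMDiffAt_finsetSum fun a _ =>
      (contMDiffAt_apply_localFrame hx hη a).smul contMDiffAt_const

theorem mdifferentiableAt_trivFun {x₀ x : M} (hx : x ∈ (trivializationAt F E x₀).baseSet)
    (f : superFun B F E) :
    MDifferentiableAt 𝓘(ℝ, B) 𝓘(ℝ, Fin (Module.finrank ℝ (ExteriorAlgebra ℝ (Module.Dual ℝ F))) → ℝ) (fun y => extCoord F (trivFun x₀ f y)) x :=
  (contMDiffAt_trivFun hx f).mdifferentiableAt (by simp)

/-- The derivative of a superfunction in the trivialization around `x₀`. -/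
def dTriv (x₀ : M) (f : superFun B F E) (x : M) (v : TangentSpace 𝓘(ℝ, B) x) :
    ExteriorAlgebra ℝ (Module.Dual ℝ F) :=
  (extCoord F).symm (mvfderiv 𝓘(ℝ, B) (fun y => extCoord F (trivFun x₀ f y)) x v)

theorem dTriv_congr {x₀ x : M} {f g : superFun B F E} (h : ∀ᶠ y in 𝓝 x, f.1 y = g.1 y)
    (v : TangentSpace 𝓘(ℝ, B) x) : dTriv x₀ f x v = dTriv x₀ g x v := by
  have : (fun y => extCoord F (trivFun x₀ f y)) =ᶠ[𝓝 x] fun y => extCoord F (trivFun x₀ g y) :=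
    h.mono fun y hy => by simp [trivFun, hy]
  rw [dTriv, dTriv, this.mvfderiv_eq]

theorem dTriv_add {x₀ x : M} (hx : x ∈ (trivializationAt F E x₀).baseSet)
    (f g : superFun B F E) (v : TangentSpace 𝓘(ℝ, B) x) :
    dTriv x₀ (f + g) x v = dTriv x₀ f x v + dTriv x₀ g x v := by
  simp only [dTriv, trivFun_add, map_add]
  rw [mvfderiv_fun_add (mdifferentiableAt_trivFun hx f) (mdifferentiableAt_trivFun hx g),
    _root_.add_apply, map_add]

theorem dTriv_mul {x₀ x : M} (hx : x ∈ (trivializationAt F E x₀).baseSet)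
    (f g : superFun B F E) (v : TangentSpace 𝓘(ℝ, B) x) :
    dTriv x₀ (f * g) x v = dTriv x₀ f x v * trivFun x₀ g x + trivFun x₀ f x * dTriv x₀ g x v := by
  simp only [dTriv, trivFun_mul, ← extMul_extCoord]
  rw [mvfderiv_clm_apply₂ _ (mdifferentiableAt_trivFun hx f) (mdifferentiableAt_trivFun hx g),
    map_add, add_comm]
  simp [extMul]

theorem dTriv_fn (x₀ x : M) (c : M → ℝ) (hc) (v : TangentSpace 𝓘(ℝ, B) x) :
    dTriv x₀ (fn c hc : superFun B F E) x v = mvfderiv 𝓘(ℝ, B) c x v • 1 := by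
  have h := mvfderiv_sum_smul (I := 𝓘(ℝ, B)) (r := fun _ : Fin 1 => c)
    (fun _ => extCoord F 1) (x := x) (fun _ => hc.mdifferentiableAt (by simp)) v
  simp only [Finset.univ_unique, Finset.sum_const, Finset.card_singleton, one_smul] at h
  simp only [dTriv, trivFun_fn, map_smul, h, LinearEquiv.symm_apply_apply]

theorem dTriv_sec {x₀ x : M} (hx : x ∈ (trivializationAt F E x₀).baseSet)
    (η : ∀ x, Module.Dual ℝ (E x)) (hη) (v : TangentSpace 𝓘(ℝ, B) x) :
    dTriv x₀ (sec η hη : superFun B F E) x v = ∑ a, mvfderiv 𝓘(ℝ, B) (fun y => η y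
      ((trivializationAt F E x₀).localFrame (Module.finBasis ℝ F) a y)) x v •
        ExteriorAlgebra.ι ℝ ((Module.finBasis ℝ F).coord a) := by
  simp only [dTriv, trivFun_sec, map_sum, map_smul]
  rw [mvfderiv_sum_smul _ fun a => (contMDiffAt_apply_localFrame hx hη a).mdifferentiableAt
    (by simp)]
  simp only [map_sum, map_smul, LinearEquiv.symm_apply_apply]

/-- The trivialized function stays in a fixed linear subspace, so its derivative does. -/
theorem dTriv_mem_evenOdd {x₀ x : M} (hx : x ∈ (trivializationAt F E x₀).baseSet) {p : ZMod 2}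
    {f : superFun B F E} (hf : f ∈ parity B F E p) (v : TangentSpace 𝓘(ℝ, B) x) :
    dTriv x₀ f x v ∈ CliffordAlgebra.evenOdd (0 : QuadraticForm ℝ (Module.Dual ℝ F)) p := by
  have h := mvfderiv_mem_submodule
    ((CliffordAlgebra.evenOdd (0 : QuadraticForm ℝ (Module.Dual ℝ F)) p).map
      (extCoord F : _ →ₗ[ℝ] _)) (mdifferentiableAt_trivFun hx f)
    (fun y => Submodule.mem_map_of_mem (trivFun_mem_evenOdd x₀ hf y)) v
  obtain ⟨a, ha, h⟩ := h
  have h' : dTriv x₀ f x v = (extCoord F).symm (extCoord F a) := congrArg (extCoord F).symm h.symm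
  rw [h', LinearEquiv.symm_apply_apply]
  exact ha

end

end BatchelorModel

/-! ### Superderivations from sections of `E` and from vector fields on `M` -/

namespace BatchelorModel

open SuperAlg

noncomputable section

variable {B F : Type*} [NormedAddCommGroup B] [NormedSpace ℝ B]
  [NormedAddCommGroup F] [NormedSpace ℝ F]
  {M : Type*} [TopologicalSpace M] [ChartedSpace B M]
  {E : M → Type*} [∀ x, AddCommGroup (E x)] [∀ x, Module ℝ (E x)]
  [TopologicalSpace (TotalSpace F E)] [∀ x, TopologicalSpace (E x)] [FiberBundle F E]

theorem mem_superFun_of_germ {f : ∀ x, ExteriorAlgebra ℝ (Module.Dual ℝ (E x))}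
    (h : ∀ x, ∃ g : superFun B F E, ∀ᶠ y in 𝓝 x, f y = g.1 y) : f ∈ superFun B F E := by
  intro x
  obtain ⟨g, hg⟩ := h x
  obtain ⟨k, hk, hgk⟩ := g.2 x
  exact ⟨k, hk, by filter_upwards [hg, hgk] with y h1 h2 using h1.trans h2⟩

/-- Contraction of the superfunction `f` with the section `s` of `E`. -/
def contractFun (s : ∀ x, E x) (f : superFun B F E) (x : M) :
    ExteriorAlgebra ℝ (Module.Dual ℝ (E x)) :=
  CliffordAlgebra.contractLeft (Q := (0 : QuadraticForm ℝ (Module.Dual ℝ (E x))))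
    (Module.Dual.eval ℝ (E x) (s x)) (f.1 x)

/-- Induction on germs: contraction commutes with functions, and sends `η f` to `η(s) f` minus `η`
times the contraction of `f`, which is again smooth. -/
theorem contractFun_mem {s : ∀ x, E x}
    (hs : ContMDiff 𝓘(ℝ, B) (𝓘(ℝ, B).prod 𝓘(ℝ, F)) ∞ (fun x => (⟨x, s x⟩ : TotalSpace F E)))
    (f : superFun B F E) : contractFun s f ∈ superFun B F E := by
  refine mem_superFun_of_germ fun x => ?_
  refine superFun_induction (x := x)
    (P := fun f => ∃ g : superFun B F E, ∀ᶠ y in 𝓝 x, contractFun s f y = g.1 y) ?_ ?_ ?_ ?_ ?_ f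
  · rintro f g h ⟨k, hk⟩
    exact ⟨k, by filter_upwards [h, hk] with y h1 h2; rw [← h2, contractFun, contractFun, h1]⟩
  · exact ⟨0, Eventually.of_forall fun y => CliffordAlgebra.contractLeft_one
      (Q := (0 : QuadraticForm ℝ (Module.Dual ℝ (E y)))) (d := Module.Dual.eval ℝ (E y) (s y))⟩
  · rintro f g ⟨k, hk⟩ ⟨l, hl⟩
    refine ⟨k + l, ?_⟩
    filter_upwards [hk, hl] with y h1 h2
    exact (map_add _ _ _).trans (congrArg₂ _ h1 h2)
  · rintro c hc f ⟨k, hk⟩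
    refine ⟨fn c hc * k, ?_⟩
    filter_upwards [hk] with y h1
    exact (CliffordAlgebra.contractLeft_algebraMap_mul _ _ _).trans (congrArg₂ _ rfl h1)
  · rintro η hη f ⟨k, hk⟩
    refine ⟨fn (fun y => η y (s y)) (ContMDiff.comp hη hs) * f - sec η hη * k, ?_⟩
    filter_upwards [hk] with y h1
    have h2 := CliffordAlgebra.contractLeft_ι_mul
      (Q := (0 : QuadraticForm ℝ (Module.Dual ℝ (E y)))) (d := Module.Dual.eval ℝ (E y) (s y))
      (η y) (f.1 y)
    refine h2.trans (congrArg₂ _ ?_ (congrArg₂ _ rfl h1))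
    exact (Algebra.smul_def _ _)

/-- The odd superderivation given by contraction with a smooth section of `E`. -/
def contract (s : ∀ x, E x)
    (hs : ContMDiff 𝓘(ℝ, B) (𝓘(ℝ, B).prod 𝓘(ℝ, F)) ∞ (fun x => (⟨x, s x⟩ : TotalSpace F E))) :
    der (parity B F E) 1 :=
  ⟨{ toFun := fun f => ⟨contractFun s f, contractFun_mem hs f⟩
     map_add' := fun f g => Subtype.ext (funext fun x => LinearMap.map_add
      (CliffordAlgebra.contractLeft (Q := (0 : QuadraticForm ℝ (Module.Dual ℝ (E x))))
        (Module.Dual.eval ℝ (E x) (s x))) (f.1 x) (g.1 x))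
     map_smul' := fun r f => Subtype.ext (funext fun x => LinearMap.map_smul
      (CliffordAlgebra.contractLeft (Q := (0 : QuadraticForm ℝ (Module.Dual ℝ (E x))))
        (Module.Dual.eval ℝ (E x) (s x))) r (f.1 x)) }, by
    refine ⟨fun q f hf x => ExteriorAlgebra.contractLeft_mem_evenOdd _ (hf x),
      fun q f hf g => Subtype.ext (funext fun x => ?_)⟩
    refine (ExteriorAlgebra.contractLeft_mul _ _ _).trans (congrArg₂ _ rfl ?_)
    rw [ExteriorAlgebra.involute_eq_koszul (hf x), smul_mul_assoc]
    rfl⟩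

end

noncomputable section

variable {B F : Type*} [NormedAddCommGroup B] [NormedSpace ℝ B] [FiniteDimensional ℝ B]
  [NormedAddCommGroup F] [NormedSpace ℝ F] [FiniteDimensional ℝ F]
  {M : Type*} [TopologicalSpace M] [T2Space M] [ChartedSpace B M] [IsManifold 𝓘(ℝ, B) ∞ M]
  {E : M → Type*} [∀ x, AddCommGroup (E x)] [∀ x, Module ℝ (E x)]
  [TopologicalSpace (TotalSpace F E)] [∀ x, TopologicalSpace (E x)] [FiberBundle F E]
  [VectorBundle ℝ F E] [ContMDiffVectorBundle ∞ F E 𝓘(ℝ, B)]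

theorem dTriv_smul {x₀ x : M} (hx : x ∈ (trivializationAt F E x₀).baseSet)
    (r : ℝ) (f : superFun B F E) (v : TangentSpace 𝓘(ℝ, B) x) :
    dTriv x₀ (r • f) x v = r • dTriv x₀ f x v := by
  have h := mvfderiv_clm_apply (r • ContinuousLinearMap.id ℝ
    (Fin (Module.finrank ℝ (ExteriorAlgebra ℝ (Module.Dual ℝ F))) → ℝ))
    (mdifferentiableAt_trivFun hx f) v
  have h2 : (fun y => extCoord F (trivFun x₀ (r • f) y)) = fun y => (r • ContinuousLinearMap.id ℝ
    (Fin (Module.finrank ℝ (ExteriorAlgebra ℝ (Module.Dual ℝ F))) → ℝ))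
      (extCoord F (trivFun x₀ f y)) := funext fun y => by
    rw [trivFun_smul, map_smul]; rfl
  rw [dTriv, h2, h, dTriv, ← map_smul]
  rfl

/-- The derivative of a superfunction along a vector field on `M`, in the trivialization of `E`
around `x₀`. -/
def liftFun (x₀ : M) (V : ∀ x : M, TangentSpace 𝓘(ℝ, B) x) (f : superFun B F E) (x : M) :
    ExteriorAlgebra ℝ (Module.Dual ℝ (E x)) :=
  trivInv F E x₀ x (dTriv x₀ f x (V x))

variable {x₀ : M} {V : ∀ x : M, TangentSpace 𝓘(ℝ, B) x}

theorem liftFun_mul {x : M} (hx : x ∈ (trivializationAt F E x₀).baseSet) (f g : superFun B F E) :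
    liftFun x₀ V (f * g) x = liftFun x₀ V f x * g.1 x + f.1 x * liftFun x₀ V g x := by
  simp only [liftFun, dTriv_mul hx, map_add, map_mul, trivInv_trivFun hx]

theorem liftFun_add {x : M} (hx : x ∈ (trivializationAt F E x₀).baseSet) (f g : superFun B F E) :
    liftFun x₀ V (f + g) x = liftFun x₀ V f x + liftFun x₀ V g x := by
  rw [liftFun, dTriv_add hx, map_add]; rfl

theorem liftFun_smul {x : M} (hx : x ∈ (trivializationAt F E x₀).baseSet) (r : ℝ)
    (f : superFun B F E) : liftFun x₀ V (r • f) x = r • liftFun x₀ V f x := by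
  rw [liftFun, dTriv_smul hx, map_smul]; rfl

theorem liftFun_eq_zero {x : M} (hx : V x = 0) (f : superFun B F E) : liftFun x₀ V f x = 0 := by
  rw [liftFun, hx, dTriv, map_zero, map_zero, map_zero]

theorem liftFun_fn (x : M) (c : M → ℝ) (hc) :
    liftFun x₀ V (fn c hc : superFun B F E) x =
      algebraMap ℝ _ (mvfderiv 𝓘(ℝ, B) c x (V x)) := by
  rw [liftFun, dTriv_fn, map_smul, map_one, Algebra.algebraMap_eq_smul_one]

/-- The trivialization acts as a flat connection: only the coefficients of `η` in the dual frame are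
differentiated, and the result is again a section of `E*`. -/
theorem liftFun_sec {x : M} (hx : x ∈ (trivializationAt F E x₀).baseSet)
    (η : ∀ x, Module.Dual ℝ (E x)) (hη) :
    liftFun x₀ V (sec η hη : superFun B F E) x = ExteriorAlgebra.ι ℝ
      (∑ a, mvfderiv 𝓘(ℝ, B) (fun y => η y
      ((trivializationAt F E x₀).localFrame (Module.finBasis ℝ F) a y)) x (V x) •
        ((Module.finBasis ℝ F).coord a ∘ₗ (trivializationAt F E x₀).linearMapAt ℝ x)) := by
  rw [liftFun, dTriv_sec hx, map_sum, map_sum]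
  refine Finset.sum_congr rfl fun a _ => ?_
  rw [map_smul, map_smul, trivInv, ExteriorAlgebra.map_apply_ι]
  rfl

theorem contMDiffAt_coord_triv {v : TotalSpace F E}
    (hv : v.1 ∈ (trivializationAt F E x₀).baseSet) (φ : F →L[ℝ] ℝ) :
    ContMDiffAt (𝓘(ℝ, B).prod 𝓘(ℝ, F)) 𝓘(ℝ, ℝ) ∞
      (fun w : TotalSpace F E => φ ((trivializationAt F E x₀).linearMapAt ℝ w.1 w.2)) v := by
  have h1 : ContMDiffAt (𝓘(ℝ, B).prod 𝓘(ℝ, F)) 𝓘(ℝ, F) ∞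
      (fun w : TotalSpace F E => (trivializationAt F E x₀ w).2) v :=
    contMDiffAt_snd.comp v ((Trivialization.contMDiffOn (n := ∞) (IB := 𝓘(ℝ, B))
      (trivializationAt F E x₀)).contMDiffAt
      ((trivializationAt F E x₀).open_source.mem_nhds
        ((trivializationAt F E x₀).mem_source.2 hv)))
  have h2 := (φ.contDiff (n := ∞)).contMDiff.contMDiffAt.comp v h1
  refine h2.congr_of_eventuallyEq ?_
  have := ((trivializationAt F E x₀).open_source.mem_nhds
        ((trivializationAt F E x₀).mem_source.2 hv))
  filter_upwards [this] with w hw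
  rw [Function.comp_apply, Trivialization.coe_linearMapAt_of_mem _
    ((trivializationAt F E x₀).mem_source.1 hw)]

/-- The derivative makes sense only over the base set. The closed support `K` lies inside it, so
near any point off the base set the result is zero; on the base set the Leibniz rule reduces
smoothness to functions and sections of `E*`. -/
theorem liftFun_mem (hV : ContMDiff 𝓘(ℝ, B) 𝓘(ℝ, B).tangent ∞
      (fun x => (⟨x, V x⟩ : TangentBundle 𝓘(ℝ, B) M))) {K : Set M} (hK : IsClosed K)
    (hKe : K ⊆ (trivializationAt F E x₀).baseSet) (hVK : ∀ x ∉ K, V x = 0)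
    (f : superFun B F E) : liftFun x₀ V f ∈ superFun B F E := by
  refine mem_superFun_of_germ fun x => ?_
  by_cases hx : x ∈ (trivializationAt F E x₀).baseSet
  swap
  · refine ⟨0, ?_⟩
    filter_upwards [hK.isOpen_compl.mem_nhds fun h => hx (hKe h)] with y hy
    rw [liftFun, hVK y hy, dTriv, map_zero, map_zero, map_zero]
    rfl
  have hx' := (trivializationAt F E x₀).open_baseSet.mem_nhds hx
  refine superFun_induction (x := x)
    (P := fun f => ∃ g : superFun B F E, ∀ᶠ y in 𝓝 x, liftFun x₀ V f y = g.1 y) ?_ ?_ ?_ ?_ ?_ f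
  · rintro f g h ⟨k, hk⟩
    refine ⟨k, ?_⟩
    filter_upwards [h.eventually_nhds, hk] with y h1 h2
    rw [← h2, liftFun, liftFun, dTriv_congr h1]
  · refine ⟨0, Eventually.of_forall fun y => ?_⟩
    have := liftFun_fn (x₀ := x₀) (V := V) (F := F) (E := E) y (fun _ => 1) contMDiff_const
    rw [mvfderiv_const] at this
    refine this.trans (map_zero _)
  · rintro f g ⟨k, hk⟩ ⟨l, hl⟩
    refine ⟨k + l, ?_⟩
    filter_upwards [hk, hl, hx'] with y h1 h2 hy
    rw [liftFun_add hy, h1, h2]; rfl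
  · rintro c hc f ⟨k, hk⟩
    refine ⟨fn (fun y => mvfderiv 𝓘(ℝ, B) c y (V y)) (fun y => hc.contMDiffAt.mvfderiv_apply
      hV.contMDiffAt) * f + fn c hc * k, ?_⟩
    filter_upwards [hk, hx'] with y h1 hy
    rw [liftFun_mul hy, liftFun_fn, h1]
    rfl
  · rintro η hη f ⟨k, hk⟩
    -- The derivative of `η` is known to be smooth only over the base set; a cut-off gives a global
    -- section with the same germ at `x`.
    obtain ⟨χ, h1, h2, -, -⟩ := exists_isSmoothDualSection_extension (B := B) (F := F) (E := E) (x := x)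
      (u := (trivializationAt F E x₀).baseSet)
      (η := fun y => ∑ a, mvfderiv 𝓘(ℝ, B) (fun y => η y
        ((trivializationAt F E x₀).localFrame (Module.finBasis ℝ F) a y)) y (V y) •
        ((Module.finBasis ℝ F).coord a ∘ₗ (trivializationAt F E x₀).linearMapAt ℝ y))
      (trivializationAt F E x₀).open_baseSet hx (by
        intro w hw
        refine ContMDiffAt.contMDiffWithinAt ?_
        simp only [LinearMap.sum_apply, LinearMap.smul_apply]
        refine contMDiffAt_finsetSum fun a _ => ?_
        have h1 : ContMDiffAt (𝓘(ℝ, B).prod 𝓘(ℝ, F)) 𝓘(ℝ, ℝ) ∞ (fun w : TotalSpace F E =>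
            mvfderiv 𝓘(ℝ, B) (fun y => η y ((trivializationAt F E x₀).localFrame
              (Module.finBasis ℝ F) a y)) w.1 (V w.1)) w :=
          ContMDiffAt.comp w (g := fun y => mvfderiv 𝓘(ℝ, B) (fun y => η y
            ((trivializationAt F E x₀).localFrame (Module.finBasis ℝ F) a y)) y (V y))
            (ContMDiffAt.mvfderiv_apply (b := fun y => y) (m₀ := w.1)
              (contMDiffAt_apply_localFrame hw hη a) hV.contMDiffAt)
            (contMDiff_proj E).contMDiffAt
        exact h1.smul (contMDiffAt_coord_triv hw
            (LinearMap.toContinuousLinearMap ((Module.finBasis ℝ F).coord a))))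
    refine ⟨sec _ h1 * f + sec η hη * k, ?_⟩
    filter_upwards [hk, hx', h2] with y h3 hy h4
    rw [liftFun_mul hy, liftFun_sec hy, h3]
    refine congrArg₂ _ (congrArg₂ _ ?_ rfl) rfl
    exact congrArg _ ((one_smul ℝ _).symm.trans (by rw [← h4]))

/-- The even superderivation given by a vector field on `M`, supported in the domain of the
trivialization of `E` around `x₀`. -/
def lift (x₀ : M) (V : ∀ x : M, TangentSpace 𝓘(ℝ, B) x) (hV : ContMDiff 𝓘(ℝ, B) 𝓘(ℝ, B).tangent ∞
      (fun x => (⟨x, V x⟩ : TangentBundle 𝓘(ℝ, B) M))) {K : Set M} (hK : IsClosed K)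
    (hKe : K ⊆ (trivializationAt F E x₀).baseSet) (hVK : ∀ x ∉ K, V x = 0) :
    der (parity B F E) 0 :=
  ⟨{ toFun := fun f => ⟨liftFun x₀ V f, liftFun_mem hV hK hKe hVK f⟩
     map_add' := fun f g => Subtype.ext (funext fun x => by
      change liftFun x₀ V (f + g) x = liftFun x₀ V f x + liftFun x₀ V g x
      by_cases hx : x ∈ K
      · exact liftFun_add (hKe hx) f g
      · simp only [liftFun_eq_zero (hVK x hx), add_zero])
     map_smul' := fun r f => Subtype.ext (funext fun x => by
      change liftFun x₀ V (r • f) x = r • liftFun x₀ V f x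
      by_cases hx : x ∈ K
      · exact liftFun_smul (hKe hx) r f
      · simp only [liftFun_eq_zero (hVK x hx), smul_zero]) }, by
    refine ⟨fun q f hf x => ?_, fun q f hf g => Subtype.ext (funext fun x => ?_)⟩
    · change liftFun x₀ V f x ∈ _
      by_cases hx : x ∈ K
      · rw [zero_add]
        exact ExteriorAlgebra.map_mem_evenOdd _ (dTriv_mem_evenOdd (hKe hx) hf _)
      · rw [liftFun_eq_zero (hVK x hx)]
        exact zero_mem _
    · rw [koszul_zero_left, one_smul]
      change liftFun x₀ V (f * g) x = liftFun x₀ V f x * g.1 x + f.1 x * liftFun x₀ V g x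
      by_cases hx : x ∈ K
      · exact liftFun_mul (hKe hx) f g
      · simp only [liftFun_eq_zero (hVK x hx), zero_mul, mul_zero, add_zero]⟩

theorem lift_apply (hV : ContMDiff 𝓘(ℝ, B) 𝓘(ℝ, B).tangent ∞
      (fun x => (⟨x, V x⟩ : TangentBundle 𝓘(ℝ, B) M))) {K : Set M} (hK : IsClosed K)
    (hKe : K ⊆ (trivializationAt F E x₀).baseSet) (hVK : ∀ x ∉ K, V x = 0) (f : superFun B F E)
    (x : M) : ((lift x₀ V hV hK hKe hVK).1 f).1 x = liftFun x₀ V f x := rfl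

end

end BatchelorModel

/-! ### Local coordinates and coordinate superderivations on `ΠE` -/

namespace BatchelorModel

open SuperAlg

noncomputable section

/-- Indices of the coordinates of `ΠE`, even and odd. -/
abbrev Idx (B F : Type*) [NormedAddCommGroup B] [NormedSpace ℝ B]
    [NormedAddCommGroup F] [NormedSpace ℝ F] : Type :=
  Fin (Module.finrank ℝ B) ⊕ Fin (Module.finrank ℝ F)

/-- The parity of a coordinate. -/
abbrev par {B F : Type*} [NormedAddCommGroup B] [NormedSpace ℝ B]
    [NormedAddCommGroup F] [NormedSpace ℝ F] (c : Idx B F) : ZMod 2 :=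
  Sum.elim (fun _ => 0) (fun _ => 1) c

variable {B F : Type*} [NormedAddCommGroup B] [NormedSpace ℝ B] [FiniteDimensional ℝ B]
  [NormedAddCommGroup F] [NormedSpace ℝ F] [FiniteDimensional ℝ F]
  {M : Type*} [TopologicalSpace M] [T2Space M] [ChartedSpace B M] [IsManifold 𝓘(ℝ, B) ∞ M]

/-- Coordinate superfunctions near `x₀`, and superderivations which are the coordinate
superderivations near `x₀`. -/
structure Frame (B F : Type*) [NormedAddCommGroup B] [NormedSpace ℝ B] [FiniteDimensional ℝ B]
  [NormedAddCommGroup F] [NormedSpace ℝ F] [FiniteDimensional ℝ F]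
  {M : Type*} [TopologicalSpace M] [ChartedSpace B M] [IsManifold 𝓘(ℝ, B) ∞ M]
  (E : M → Type*) [∀ x, AddCommGroup (E x)] [∀ x, Module ℝ (E x)]
  [TopologicalSpace (TotalSpace F E)] [∀ x, TopologicalSpace (E x)] [FiberBundle F E]
  [VectorBundle ℝ F E] (x₀ : M) where
  /-- the coordinate domain -/
  dom : Set M
  isOpen_dom : IsOpen dom
  mem_dom : x₀ ∈ dom
  dom_subset_source : dom ⊆ (chartAt B x₀).source
  dom_subset_baseSet : dom ⊆ (trivializationAt F E x₀).baseSet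
  /-- the coordinates -/
  z : Idx B F → superFun B F E
  z_mem : ∀ c, z c ∈ parity B F E (par c)
  z_affine : ∀ c, IsAffine (z c)
  z_eq_fn : ∀ i, ∃ c hc, z (Sum.inl i) = fn c hc
  z_eq_sec : ∀ a, ∃ η hη, z (Sum.inr a) = sec η hη
  z_even : ∀ i, ∀ x ∈ dom, body (z (Sum.inl i)) x =
    (Module.finBasis ℝ B).coord i (extChartAt 𝓘(ℝ, B) x₀ x)
  z_odd : ∀ a (v : TotalSpace F E), v.1 ∈ dom → linPart (z (Sum.inr a)) v =
    (Module.finBasis ℝ F).coord a ((trivializationAt F E x₀).linearMapAt ℝ v.1 v.2)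
  /-- the coordinate superderivations -/
  D : ∀ c : Idx B F, der (parity B F E) (par c)
  D_z : ∀ c d, ∀ x ∈ dom, ((D c).1 (z d)).1 x = if c = d then 1 else 0
  D_even_affine : ∀ i, PreservesAffine (D (Sum.inl i))
  D_odd_affine : ∀ a s, IsAffine s → ∀ x, ∃ r : ℝ, ((D (Sum.inr a)).1 s).1 x = algebraMap ℝ _ r

variable {E : M → Type*} [∀ x, AddCommGroup (E x)] [∀ x, Module ℝ (E x)]
  [TopologicalSpace (TotalSpace F E)] [∀ x, TopologicalSpace (E x)] [FiberBundle F E]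
  [VectorBundle ℝ F E] [ContMDiffVectorBundle ∞ F E 𝓘(ℝ, B)]

omit [FiniteDimensional ℝ F] in
theorem linearMapAt_localFrame {N : Type*} [TopologicalSpace N] {E : N → Type*}
    [∀ x, AddCommGroup (E x)] [∀ x, Module ℝ (E x)]
    [TopologicalSpace (TotalSpace F E)] [∀ x, TopologicalSpace (E x)] [FiberBundle F E]
    [VectorBundle ℝ F E] (e : Trivialization F (TotalSpace.proj : TotalSpace F E → N))
    [MemTrivializationAtlas e] {ι : Type*} (b : Module.Basis ι ℝ F) {x : N} (hx : x ∈ e.baseSet)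
    (i : ι) : e.linearMapAt ℝ x (e.localFrame b i x) = b i := by
  rw [e.localFrame_apply_of_mem_baseSet _ hx, Trivialization.basisAt, Module.Basis.map_apply,
    Trivialization.linearMapAt_def_of_mem _ hx]
  exact LinearEquiv.apply_symm_apply _ _

omit [FiniteDimensional ℝ B] [NormedAddCommGroup B] [NormedSpace ℝ B] [ChartedSpace B M]
  [IsManifold 𝓘(ℝ, B) ∞ M] [T2Space M] [TopologicalSpace M] [FiniteDimensional ℝ F]
  [NormedAddCommGroup F] [NormedSpace ℝ F] in
-- The trivialization of the tangent bundle at `x₀` is the differential of the chart, so its local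
-- frame consists of the coordinate fields.
theorem mvfderiv_extChartAt_localFrame {V H N : Type*} [NormedAddCommGroup V] [NormedSpace ℝ V]
    [TopologicalSpace H] {I : ModelWithCorners ℝ V H} [TopologicalSpace N] [ChartedSpace H N]
    [IsManifold I ∞ N] {x₀ x : N} (hx : x ∈ (chartAt H x₀).source) {ι : Type*}
    (b : Module.Basis ι ℝ V) (i : ι) :
    haveI : IsManifold I 1 N := IsManifold.of_le (n := ∞) (by simp)
    mvfderiv I (extChartAt I x₀) x
      ((trivializationAt V (TangentSpace I : N → Type _) x₀).localFrame b i x) = b i := by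
  have : IsManifold I 1 N := IsManifold.of_le (n := ∞) (by simp)
  have hb : x ∈ (trivializationAt V (TangentSpace I) x₀).baseSet := hx
  have h := TangentBundle.continuousLinearMapAt_trivializationAt (I := I) hx
  have h2 : mvfderiv I (extChartAt I x₀) x =
    (trivializationAt V (TangentSpace I) x₀).continuousLinearMapAt ℝ x := h.symm
  rw [h2]
  exact linearMapAt_localFrame _ _ hb i

theorem exists_open_eq_one {χ : M → ℝ} {x : M} (h : ∀ᶠ y in 𝓝 x, χ y = 1) :
    ∃ U : Set M, IsOpen U ∧ x ∈ U ∧ (∀ y ∈ U, χ y = 1) ∧ U ⊆ tsupport χ := by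
  obtain ⟨U, h1, h2, h3⟩ := eventually_nhds_iff.1 h
  exact ⟨U, h2, h3, h1, fun y hy => subset_tsupport χ (by simp [h1 y hy])⟩

/-- In the trivialization an affine superfunction takes values in the fixed subspace `ℝ ⊕ F*`, so
its derivative does too; returning to `ΛE*` preserves degrees. -/
theorem preservesAffine_lift {x₀ : M} {V : ∀ x : M, TangentSpace 𝓘(ℝ, B) x}
    (hV : ContMDiff 𝓘(ℝ, B) 𝓘(ℝ, B).tangent ∞
      (fun x => (⟨x, V x⟩ : TangentBundle 𝓘(ℝ, B) M))) {K : Set M} (hK : IsClosed K)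
    (hKe : K ⊆ (trivializationAt F E x₀).baseSet) (hVK : ∀ x ∉ K, V x = 0) :
    PreservesAffine (lift (F := F) (E := E) x₀ V hV hK hKe hVK) := by
  intro s hs x
  rw [lift_apply]
  by_cases hx : x ∈ K
  swap
  · exact ⟨0, 0, by simp [liftFun_eq_zero (hVK x hx)]⟩
  let S : Submodule ℝ (ExteriorAlgebra ℝ (Module.Dual ℝ F)) :=
    LinearMap.range (Algebra.linearMap ℝ _) ⊔ LinearMap.range (ExteriorAlgebra.ι ℝ)
  have h1 : ∀ y, trivFun x₀ s y ∈ S := by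
    intro y
    obtain ⟨c, η, h⟩ := hs y
    rw [trivFun, h, map_add, ExteriorAlgebra.map_apply_ι, AlgHom.commutes]
    exact add_mem (Submodule.mem_sup_left ⟨c, rfl⟩) (Submodule.mem_sup_right ⟨_, rfl⟩)
  have h2 := mvfderiv_mem_submodule (S.map (extCoord F : _ →ₗ[ℝ] _))
    (mdifferentiableAt_trivFun (hKe hx) s) (fun y => Submodule.mem_map_of_mem (h1 y)) (V x)
  obtain ⟨a, ha, h⟩ := h2
  have h' : dTriv x₀ s x (V x) = (extCoord F).symm (extCoord F a) :=
    congrArg (extCoord F).symm h.symm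
  rw [LinearEquiv.symm_apply_apply] at h'
  rw [liftFun, h']
  obtain ⟨_, ⟨c, rfl⟩, _, ⟨η, rfl⟩, rfl⟩ := Submodule.mem_sup.1 ha
  refine ⟨c, ((trivializationAt F E x₀).linearMapAt ℝ x).dualMap η, ?_⟩
  rw [map_add, trivInv, ExteriorAlgebra.map_apply_ι, Algebra.linearMap_apply, AlgHom.commutes]

/-- Two nested cut-offs make the local data global: `χ` extends the coordinates, and `ρ`, supported
where `χ = 1`, extends the coordinate vector fields and the frame of `E`. Both are `1` on `U`, where
lifts of fields and contractions are therefore dual to the coordinates. -/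
theorem nonempty_frame (x₀ : M) : Nonempty (Frame B F E x₀) := by
  set e := trivializationAt F E x₀
  set bB := Module.finBasis ℝ B
  set bF := Module.finBasis ℝ F
  set u := (chartAt B x₀).source ∩ e.baseSet
  have hu : IsOpen u := (chartAt B x₀).open_source.inter e.open_baseSet
  have hxu : x₀ ∈ u := ⟨mem_chart_source B x₀, FiberBundle.mem_baseSet_trivializationAt' x₀⟩
  obtain ⟨χ, hχ, hχ1, hχu⟩ := exists_contMDiff_bump (B := B) (hu.mem_nhds hxu)
  obtain ⟨U₀, hU₀, hxU₀, hU₀1, hU₀t⟩ := exists_open_eq_one hχ1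
  obtain ⟨ρ, hρ, hρ1, hρu⟩ := exists_contMDiff_bump (B := B) (hU₀.mem_nhds hxU₀)
  obtain ⟨U, hU, hxU, hU1, hUt⟩ := exists_open_eq_one hρ1
  have hU₀u : U₀ ⊆ u := hU₀t.trans hχu
  have hUU₀ : U ⊆ U₀ := hUt.trans hρu
  -- coordinates
  have hx (i) : ContMDiff 𝓘(ℝ, B) 𝓘(ℝ, ℝ) ∞
      (fun x => χ x • bB.coord i (extChartAt 𝓘(ℝ, B) x₀ x)) := by
    refine ContMDiffOn.smul_of_tsupport_subset hu hχ ?_ hχu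
    have h1 := (contMDiffOn_extChartAt (I := 𝓘(ℝ, B)) (x := x₀) (n := ∞)).mono
      (Set.inter_subset_left (t := e.baseSet))
    exact ((LinearMap.toContinuousLinearMap (bB.coord i)).contDiff.contMDiff).comp_contMDiffOn h1
  have hξ (a) : IsSmoothDualSection B F E (fun x => χ x • (bF.coord a ∘ₗ e.linearMapAt ℝ x)) := by
    intro v
    by_cases hv : v.1 ∈ u
    · exact ContMDiffAt.smul (f := fun w : TotalSpace F E => χ w.1)
        (hχ.contMDiffAt.comp v (contMDiff_proj E).contMDiffAt)
        (contMDiffAt_coord_triv hv.2 (LinearMap.toContinuousLinearMap (bF.coord a)))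
    · have h0 : ∀ᶠ w : TotalSpace F E in 𝓝 v, χ w.1 = 0 := by
        have := notMem_tsupport_iff_eventuallyEq.1 fun h => hv (hχu h)
        exact ((FiberBundle.continuous_proj F E).tendsto v).eventually this
      refine (contMDiffAt_const (c := (0 : ℝ))).congr_of_eventuallyEq (h0.mono fun w hw => ?_)
      simp [hw]
  let z : Idx B F → superFun B F E := Sum.elim (fun i => fn _ (hx i)) (fun a => sec _ (hξ a))
  -- superderivations
  let V (i) (x : M) : TangentSpace 𝓘(ℝ, B) x :=
    ρ x • (trivializationAt B (TangentSpace 𝓘(ℝ, B)) x₀).localFrame bB i x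
  have hV (i) : ContMDiff 𝓘(ℝ, B) 𝓘(ℝ, B).tangent ∞
      (fun x => (⟨x, V i x⟩ : TangentBundle 𝓘(ℝ, B) M)) := by
    refine ContMDiffOn.smul_section_of_tsupport hρ.contMDiffOn (chartAt B x₀).open_source
      (hρu.trans (hU₀u.trans Set.inter_subset_left)) ?_
    exact Trivialization.contMDiffOn_localFrame_baseSet (I := 𝓘(ℝ, B)) ∞
      (trivializationAt B (TangentSpace 𝓘(ℝ, B)) x₀) bB i
  have hV0 (i) (x) (hx : x ∉ tsupport ρ) : V i x = 0 := by
    simp [V, image_eq_zero_of_notMem_tsupport hx]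
  let s (a) (x : M) : E x := ρ x • e.localFrame bF a x
  have hs (a) : ContMDiff 𝓘(ℝ, B) (𝓘(ℝ, B).prod 𝓘(ℝ, F)) ∞
      (fun x => (⟨x, s a x⟩ : TotalSpace F E)) := by
    refine ContMDiffOn.smul_section_of_tsupport hρ.contMDiffOn e.open_baseSet
      (hρu.trans (hU₀u.trans Set.inter_subset_right)) ?_
    exact Trivialization.contMDiffOn_localFrame_baseSet (I := 𝓘(ℝ, B)) ∞ e bF a
  have hρe : tsupport ρ ⊆ (trivializationAt F E x₀).baseSet :=
    hρu.trans (hU₀u.trans Set.inter_subset_right)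
  let D : ∀ c : Idx B F, der (parity B F E) (par c)
    | Sum.inl i => lift x₀ (V i) (hV i) (isClosed_tsupport ρ) hρe (hV0 i)
    | Sum.inr a => contract (s a) (hs a)
  refine ⟨⟨U, hU, hxU, hUU₀.trans (hU₀u.trans Set.inter_subset_left),
    hUU₀.trans (hU₀u.trans Set.inter_subset_right), z, ?_, ?_,
    fun i => ⟨_, hx i, rfl⟩, fun a => ⟨_, hξ a, rfl⟩, ?_, ?_, D, ?_, ?_, ?_⟩⟩
  · rintro (i | a)
    · exact fn_mem_parity _ (hx i)
    · exact sec_mem_parity _ (hξ a)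
  · rintro (i | a)
    · exact isAffine_fn _ (hx i)
    · exact isAffine_sec _ (hξ a)
  · intro i x hx
    simp [z, hU₀1 x (hUU₀ hx), bB]
  · intro a v hv
    simp [z, linPart, hU₀1 v.1 (hUU₀ hv), bF, e]
  · have hχx {x} (hx : x ∈ U) : ∀ᶠ y in 𝓝 x, χ y = 1 := by
      filter_upwards [hU₀.mem_nhds (hUU₀ hx)] with y hy using hU₀1 y hy
    rintro (i | a) (j | b) x hx'
    · change liftFun x₀ (V i) (fn _ (hx j)) x = _
      have h1 : (fun x => χ x • bB.coord j (extChartAt 𝓘(ℝ, B) x₀ x)) =ᶠ[𝓝 x]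
          fun x => LinearMap.toContinuousLinearMap (bB.coord j) (extChartAt 𝓘(ℝ, B) x₀ x) :=
        (hχx hx').mono fun y hy => by simp [hy]
      have hxs : x ∈ (chartAt B x₀).source := (hU₀u (hUU₀ hx')).1
      rw [liftFun_fn, h1.mvfderiv_eq, mvfderiv_clm_apply _
        ((contMDiffAt_extChartAt' (n := ∞) hxs).mdifferentiableAt (by simp))]
      simp only [V, hU1 x hx', one_smul]
      rw [mvfderiv_extChartAt_localFrame (I := 𝓘(ℝ, B)) hxs]
      by_cases hij : i = j
      · simp [hij, bB]
      · simp [hij, bB]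
    · change liftFun x₀ (V i) (sec _ (hξ b)) x = _
      have hxe : x ∈ e.baseSet := (hU₀u (hUU₀ hx')).2
      rw [liftFun_sec hxe, if_neg (by simp), Finset.sum_eq_zero, map_zero]
      intro a _
      -- Near `x` an odd coordinate has constant coefficients in the dual frame, so the lifted field
      -- annihilates it.
      have h1 : (fun y => (χ y • (bF.coord b ∘ₗ e.linearMapAt ℝ y)) (e.localFrame bF a y))
          =ᶠ[𝓝 x] fun _ => bF.coord b (bF a) := by
        filter_upwards [hχx hx', e.open_baseSet.mem_nhds hxe] with y hy hye
        rw [hy, one_smul, LinearMap.comp_apply, linearMapAt_localFrame e bF hye]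
      rw [h1.mvfderiv_eq, mvfderiv_const]
      exact zero_smul _ _
    · change contractFun (s a) (fn _ (hx j)) x = _
      rw [if_neg (by simp)]
      exact CliffordAlgebra.contractLeft_algebraMap (Q := (0 : QuadraticForm ℝ (Module.Dual ℝ (E x))))
        (d := Module.Dual.eval ℝ (E x) (s a x)) _
    · change contractFun (s a) (sec _ (hξ b)) x = _
      have hxe : x ∈ e.baseSet := (hU₀u (hUU₀ hx')).2
      have h1 : contractFun (s a) (sec _ (hξ b)) x =
          algebraMap ℝ _ ((χ x • (bF.coord b ∘ₗ e.linearMapAt ℝ x)) (s a x)) :=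
        CliffordAlgebra.contractLeft_ι (Q := (0 : QuadraticForm ℝ (Module.Dual ℝ (E x))))
          (d := Module.Dual.eval ℝ (E x) (s a x)) _
      have h2 : (e.linearMapAt ℝ x) (s a x) = bF a := by
        simp only [s, hU1 x hx', one_smul]
        exact linearMapAt_localFrame e bF hxe a
      rw [h1, hU₀1 x (hUU₀ hx'), one_smul, LinearMap.comp_apply, h2]
      by_cases hab : a = b
      · simp [hab]
      · simp [hab]
  · intro i
    exact preservesAffine_lift _ _ _ _
  · intro a t ht x
    obtain ⟨c, η, h⟩ := ht x
    refine ⟨η (s a x), ?_⟩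
    change contractFun (s a) t x = _
    rw [contractFun, h]
    refine (LinearMap.map_add _ _ _).trans ?_
    refine (congrArg₂ _ (CliffordAlgebra.contractLeft_algebraMap
      (Q := (0 : QuadraticForm ℝ (Module.Dual ℝ (E x)))) (d := Module.Dual.eval ℝ (E x) (s a x)) c)
      (CliffordAlgebra.contractLeft_ι (Q := (0 : QuadraticForm ℝ (Module.Dual ℝ (E x))))
        (d := Module.Dual.eval ℝ (E x) (s a x)) η)).trans ?_
    exact zero_add _

end

end BatchelorModel

/-! ### Superderivations are determined by their values on coordinates -/

namespace BatchelorModel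

open SuperAlg

noncomputable section

variable {B F : Type*} [NormedAddCommGroup B] [NormedSpace ℝ B] [FiniteDimensional ℝ B]
  [NormedAddCommGroup F] [NormedSpace ℝ F] [FiniteDimensional ℝ F]
  {M : Type*} [TopologicalSpace M] [T2Space M] [ChartedSpace B M] [IsManifold 𝓘(ℝ, B) ∞ M]
  {E : M → Type*} [∀ x, AddCommGroup (E x)] [∀ x, Module ℝ (E x)]
  [TopologicalSpace (TotalSpace F E)] [∀ x, TopologicalSpace (E x)] [FiberBundle F E]
  [VectorBundle ℝ F E] [ContMDiffVectorBundle ∞ F E 𝓘(ℝ, B)]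
  {C : Type*} [Ring C] [Algebra ℝ C]

/-- Morphisms to `C` from the superfunctions which factor through the germs at `x` and map smooth
functions to their value at `x`. -/
def IsPoint (φ : superFun B F E →ₐ[ℝ] C) (x : M) : Prop :=
  ∀ c hc, φ (fn c hc) = algebraMap ℝ C (c x)

/-- The source of locality: a morphism at `x` sends `χ` to `1`, so it must kill `f`, and a
superderivation along it is then local by the Leibniz rule. -/
theorem exists_fn_mul_eq_zero {x : M} {f : superFun B F E} (h : ∀ᶠ y in 𝓝 x, f.1 y = 0) :
    ∃ χ hχ, χ x = 1 ∧ fn χ hχ * f = 0 := by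
  obtain ⟨χ, h1, h2, h3⟩ := exists_contMDiff_bump (B := B) h
  refine ⟨χ, h1, h2.self_of_nhds, Subtype.ext (funext fun y => ?_)⟩
  change algebraMap ℝ _ (χ y) * f.1 y = 0
  by_cases hy : y ∈ tsupport χ
  · rw [show f.1 y = 0 from h3 hy, mul_zero]
  · rw [image_eq_zero_of_notMem_tsupport hy, map_zero, zero_mul]

theorem IsPoint.eq_zero_of_germ {φ : superFun B F E →ₐ[ℝ] C} {x : M} (hφ : IsPoint φ x)
    {f : superFun B F E} (h : ∀ᶠ y in 𝓝 x, f.1 y = 0) : φ f = 0 := by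
  obtain ⟨χ, hχ, h1, h2⟩ := exists_fn_mul_eq_zero h
  have := congrArg φ h2
  rwa [map_mul, hφ, h1, map_one, one_mul, map_zero] at this

theorem IsPoint.congr {φ : superFun B F E →ₐ[ℝ] C} {x : M} (hφ : IsPoint φ x)
    {f g : superFun B F E} (h : ∀ᶠ y in 𝓝 x, f.1 y = g.1 y) : φ f = φ g := by
  rw [← sub_eq_zero, ← map_sub]
  exact hφ.eq_zero_of_germ (h.mono fun y hy => sub_eq_zero.2 hy)

/-- On `fr.dom` the odd coordinates form the frame dual to the local frame of `E`; the coefficients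
`r a` are the values of `η` on that frame, extended to `M` from a neighbourhood of `x`. -/
theorem exists_germ_sec_eq {x₀ x : M} (fr : Frame B F E x₀) (hx : x ∈ fr.dom)
    (η : ∀ x, Module.Dual ℝ (E x)) (hη : IsSmoothDualSection B F E η) :
    ∃ (r : Fin (Module.finrank ℝ F) → M → ℝ) (hr : ∀ a, ContMDiff 𝓘(ℝ, B) 𝓘(ℝ, ℝ) ∞ (r a)),
      ∀ᶠ y in 𝓝 x, (sec η hη : superFun B F E).1 y =
        (∑ a, fn (r a) (hr a) * fr.z (Sum.inr a)).1 y := by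
  have h0 : ∀ a, ∃ g : M → ℝ, ContMDiff 𝓘(ℝ, B) 𝓘(ℝ, ℝ) ∞ g ∧ g =ᶠ[𝓝 x] fun y => η y
      ((trivializationAt F E x₀).localFrame (Module.finBasis ℝ F) a y) := fun a =>
    exists_contMDiff_extension (trivializationAt F E x₀).open_baseSet (fr.dom_subset_baseSet hx)
      fun y hy => (contMDiffAt_apply_localFrame hy hη a).contMDiffWithinAt
  choose r hr hr' using h0
  refine ⟨r, hr, ?_⟩
  choose ξ hξ hz using fr.z_eq_sec
  have hall : ∀ᶠ y in 𝓝 x, ∀ a, r a y = η y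
      ((trivializationAt F E x₀).localFrame (Module.finBasis ℝ F) a y) :=
    eventually_all.2 hr'
  filter_upwards [hall, fr.isOpen_dom.mem_nhds hx] with y hy hyd
  have hye := fr.dom_subset_baseSet hyd
  have h1 : η y = ∑ a, r a y • ξ a y := by
    refine ((trivializationAt F E x₀).basisAt (Module.finBasis ℝ F) hye).ext fun b => ?_
    have h2 : ∀ a, ξ a y ((trivializationAt F E x₀).localFrame (Module.finBasis ℝ F) b y) =
        if b = a then 1 else 0 := by
      intro a
      have h3 := fr.z_odd a ⟨y, (trivializationAt F E x₀).localFrame (Module.finBasis ℝ F) b y⟩ hyd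
      rw [hz, linPart, evAt_sec, linearMapAt_localFrame _ _ hye] at h3
      refine h3.trans ?_
      rw [Module.Basis.coord_apply, Module.Basis.repr_self, Finsupp.single_apply]
    rw [← (trivializationAt F E x₀).localFrame_apply_of_mem_baseSet _ hye]
    simp [h2, hy]
  change ExteriorAlgebra.ι ℝ (η y) = _
  rw [h1, map_sum]
  have h4 : (∑ a, fn (r a) (hr a) * fr.z (Sum.inr a)).1 y =
      ∑ a, (fn (r a) (hr a) * fr.z (Sum.inr a)).1 y := by
    simp [Finset.sum_apply]
  rw [h4]
  refine Finset.sum_congr rfl fun a _ => ?_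
  rw [map_smul, hz]
  exact Algebra.smul_def _ _

/-- Two morphisms at `x` coincide if they coincide on the odd coordinates. -/
theorem IsPoint.ext {φ φ' : superFun B F E →ₐ[ℝ] C} {x₀ x : M} (hφ : IsPoint φ x)
    (hφ' : IsPoint φ' x) (fr : Frame B F E x₀) (hx : x ∈ fr.dom)
    (h : ∀ a, φ (fr.z (Sum.inr a)) = φ' (fr.z (Sum.inr a))) : φ = φ' := by
  refine AlgHom.ext fun f => superFun_induction (x := x) (P := fun f => φ f = φ' f) ?_ ?_ ?_ ?_ ?_ f
  · intro f g hfg hf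
    rw [← hφ.congr hfg, ← hφ'.congr hfg, hf]
  · rw [map_one, map_one]
  · intro f g hf hg
    rw [map_add, map_add, hf, hg]
  · intro c hc f hf
    rw [map_mul, map_mul, hf, hφ, hφ']
  · intro η hη f hf
    obtain ⟨r, hr, hrz⟩ := exists_germ_sec_eq fr hx η hη
    rw [map_mul, map_mul, hf, hφ.congr hrz, hφ'.congr hrz]
    simp only [map_sum, map_mul, h, hφ _ (hr _), hφ' _ (hr _)]

/-- The Leibniz rule of parity `p` along `φ`. -/
def IsLeibniz (φ : superFun B F E →ₐ[ℝ] C) (p : ZMod 2) (W : superFun B F E →ₗ[ℝ] C) : Prop :=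
  ∀ q, ∀ f ∈ parity B F E q, ∀ g, W (f * g) = W f * φ g + koszul p q • (φ f * W g)

variable {φ : superFun B F E →ₐ[ℝ] C} {p : ZMod 2} {W : superFun B F E →ₗ[ℝ] C} {x : M}

theorem IsLeibniz.fn_mul (hW : IsLeibniz φ p W) (hφ : IsPoint φ x) (c hc f) :
    W (fn c hc * f) = W (fn c hc) * φ f + c x • W f := by
  rw [hW 0 _ (fn_mem_parity c hc), koszul_zero_right, one_smul, hφ, Algebra.smul_def]

theorem IsLeibniz.congr (hW : IsLeibniz φ p W) (hφ : IsPoint φ x)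
    {f g : superFun B F E} (h : ∀ᶠ y in 𝓝 x, f.1 y = g.1 y) : W f = W g := by
  rw [← sub_eq_zero, ← map_sub]
  have h' : ∀ᶠ y in 𝓝 x, (f - g).1 y = 0 := h.mono fun y hy => sub_eq_zero.2 hy
  obtain ⟨χ, hχ, h1, h2⟩ := exists_fn_mul_eq_zero h'
  have h3 := congrArg W h2
  rwa [hW.fn_mul hφ, h1, hφ.eq_zero_of_germ h', mul_zero, zero_add, one_smul, map_zero] at h3

theorem IsLeibniz.map_one_eq_zero (hW : IsLeibniz φ p W) : W 1 = 0 := by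
  have h : W (1 * 1) = W 1 * φ 1 + koszul p 0 • (φ 1 * W 1) :=
    hW 0 1 (fn_mem_parity (fun _ => 1) contMDiff_const) 1
  rw [mul_one, map_one φ, koszul_zero_right, mul_one, one_mul, one_smul] at h
  exact left_eq_add.1 h

theorem mvfderiv_body_z {x₀ : M} (fr : Frame B F E x₀) (hx : x ∈ fr.dom)
    (i j : Fin (Module.finrank ℝ B)) :
    mvfderiv 𝓘(ℝ, B) (body (fr.z (Sum.inl i))) x
      ((trivializationAt B (TangentSpace 𝓘(ℝ, B)) x₀).localFrame (Module.finBasis ℝ B) j x) =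
      if j = i then 1 else 0 := by
  have h1 : body (fr.z (Sum.inl i)) =ᶠ[𝓝 x] fun y => LinearMap.toContinuousLinearMap
      ((Module.finBasis ℝ B).coord i) (extChartAt 𝓘(ℝ, B) x₀ y) := by
    filter_upwards [fr.isOpen_dom.mem_nhds hx] with y hy using fr.z_even i y hy
  have hxs := fr.dom_subset_source hx
  rw [h1.mvfderiv_eq, mvfderiv_clm_apply _
    ((contMDiffAt_extChartAt' (n := ∞) hxs).mdifferentiableAt (by simp)),
    mvfderiv_extChartAt_localFrame (I := 𝓘(ℝ, B)) hxs]
  simp [Finsupp.single_apply]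

/-- Subtract from `c` its first-order Taylor polynomial at `x` in the coordinates, with linear part
`c₁` up to constants. The remainder is near `x` a sum of products of functions vanishing at `x`,
which the Leibniz rule kills; constants and coordinates are killed as well. -/
theorem IsLeibniz.map_fn (hW : IsLeibniz φ p W) (hφ : IsPoint φ x) {x₀ : M} (fr : Frame B F E x₀)
    (hx : x ∈ fr.dom) (h0 : ∀ c, W (fr.z c) = 0) (c hc) : W (fn c hc) = 0 := by
  choose y hy hz using fr.z_eq_fn
  have hbz : ∀ i, body (fr.z (Sum.inl i)) = y i := fun i => by rw [hz, body_fn]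
  let r (i) : ℝ := mvfderiv 𝓘(ℝ, B) c x
    ((trivializationAt B (TangentSpace 𝓘(ℝ, B)) x₀).localFrame (Module.finBasis ℝ B) i x)
  let c₁ : M → ℝ := fun t => ∑ i, r i * y i t
  have hc₁ : ContMDiff 𝓘(ℝ, B) 𝓘(ℝ, ℝ) ∞ c₁ := fun t =>
    contMDiffAt_finsetSum fun i _ => contMDiffAt_const.mul (hy i).contMDiffAt
  let k : ℝ := c x - c₁ x
  have hcc : ContMDiff 𝓘(ℝ, B) 𝓘(ℝ, ℝ) ∞ (fun t => c t - c₁ t) := hc.sub hc₁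
  have hc₂ : ContMDiff 𝓘(ℝ, B) 𝓘(ℝ, ℝ) ∞ (fun t => c t - c₁ t - k) := hcc.sub contMDiff_const
  have hd : mvfderiv 𝓘(ℝ, B) (fun t => c t - c₁ t - k) x = 0 := by
    have hxb : x ∈ (trivializationAt B (TangentSpace 𝓘(ℝ, B)) x₀).baseSet :=
      fr.dom_subset_source hx
    refine ContinuousLinearMap.coe_injective
      (((trivializationAt B (TangentSpace 𝓘(ℝ, B)) x₀).basisAt
        (Module.finBasis ℝ B) hxb).ext fun j => ?_)
    rw [← Trivialization.localFrame_apply_of_mem_baseSet _ _ hxb]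
    have e1 := mvfderiv_fun_sub (hcc.mdifferentiableAt (x := x) (by simp))
      (mdifferentiableAt_const (I := 𝓘(ℝ, B)) (c := k) (x := x))
    have e2 := mvfderiv_fun_sub (hc.mdifferentiableAt (x := x) (by simp))
      (hc₁.mdifferentiableAt (x := x) (by simp))
    have e3 := mvfderiv_sum_smul (I := 𝓘(ℝ, B)) (r := y) r (x := x)
      (fun i => (hy i).mdifferentiableAt (by simp))
      ((trivializationAt B (TangentSpace 𝓘(ℝ, B)) x₀).localFrame (Module.finBasis ℝ B) j x)
    have e4 : (fun t => ∑ i, y i t • r i) = c₁ := funext fun t =>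
      Finset.sum_congr rfl fun i _ => mul_comm _ _
    rw [e4] at e3
    simp only [← hbz, mvfderiv_body_z fr hx] at e3
    rw [e1, e2, mvfderiv_const, sub_zero]
    change mvfderiv 𝓘(ℝ, B) c x _ - mvfderiv 𝓘(ℝ, B) c₁ x _ = 0
    rw [e3]
    simp [r]
  obtain ⟨n, g, h, hg, hh, hg0, hh0, hgh⟩ := hc₂.exists_eq_sum_mul (x := x) (by simp [k]) hd
  have e1 : W (fn _ hc₂) = 0 := by
    have : ∀ᶠ t in 𝓝 x, (fn _ hc₂ : superFun B F E).1 t =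
        (∑ i, fn (g i) (hg i) * fn (h i) (hh i) : superFun B F E).1 t := by
      filter_upwards [hgh] with t ht
      have h4 : (∑ i, fn (g i) (hg i) * fn (h i) (hh i) : superFun B F E).1 t =
          ∑ i, (fn (g i) (hg i) * fn (h i) (hh i) : superFun B F E).1 t := by
        simp [Finset.sum_apply]
      rw [h4]
      change algebraMap ℝ _ (c t - c₁ t - k) = _
      rw [ht, map_sum]
      exact Finset.sum_congr rfl fun i _ => map_mul _ _ _
    rw [hW.congr hφ this, map_sum]
    refine Finset.sum_eq_zero fun i _ => ?_
    rw [hW.fn_mul hφ, hφ, hh0, hg0, map_zero, mul_zero, zero_smul, add_zero]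
  have e2 : (fn c hc : superFun B F E) = fn _ hc₂ + ∑ i, r i • fr.z (Sum.inl i) + k • 1 := by
    refine Subtype.ext (funext fun t => ?_)
    have h4 : (fn _ hc₂ + ∑ i, r i • fr.z (Sum.inl i) + k • 1 : superFun B F E).1 t =
        algebraMap ℝ _ (c t - c₁ t - k) + ∑ i, r i • (fr.z (Sum.inl i)).1 t + k • 1 := by
      simp [Finset.sum_apply, fn]
    rw [h4]
    have h5 : ∀ i, (fr.z (Sum.inl i)).1 t = algebraMap ℝ _ (y i t) := fun i => by rw [hz]; rfl
    change algebraMap ℝ _ (c t) = _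
    simp only [h5, ← Algebra.algebraMap_eq_smul_one, Algebra.smul_def (r _), ← map_mul, ← map_sum,
      ← map_add]
    congr 1
    simp only [c₁]
    ring
  rw [e2, map_add, map_add, e1, map_sum, map_smul, hW.map_one_eq_zero]
  simp [h0]

/-- Germs are generated by functions and sections of `E*`. Functions are handled by
`IsLeibniz.map_fn`, and sections are locally combinations of the odd coordinates. -/
theorem IsLeibniz.eq_zero (hW : IsLeibniz φ p W) (hφ : IsPoint φ x) {x₀ : M}
    (fr : Frame B F E x₀) (hx : x ∈ fr.dom) (h0 : ∀ c, W (fr.z c) = 0) : W = 0 := by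
  have hfn := hW.map_fn hφ fr hx h0
  refine LinearMap.ext fun f => superFun_induction (x := x) (P := fun f => W f = 0) ?_ ?_ ?_ ?_ ?_ f
  · intro f g hfg hf
    rw [← hW.congr hφ hfg, hf]
  · exact hW.map_one_eq_zero
  · intro f g hf hg
    rw [map_add, hf, hg, add_zero]
  · intro c hc f hf
    rw [hW.fn_mul hφ, hf, hfn, zero_mul, smul_zero, add_zero]
  · intro η hη f hf
    have h1 : W (sec η hη) = 0 := by
      obtain ⟨r, hr, hrz⟩ := exists_germ_sec_eq fr hx η hη
      rw [hW.congr hφ hrz, map_sum]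
      refine Finset.sum_eq_zero fun a _ => ?_
      rw [hW.fn_mul hφ, h0, hfn, zero_mul, smul_zero, add_zero]
    rw [hW 1 _ (sec_mem_parity η hη), h1, hf, zero_mul, mul_zero, smul_zero, add_zero]

theorem IsPoint.map_D_z (hφ : IsPoint φ x) {x₀ : M} (fr : Frame B F E x₀) (hx : x ∈ fr.dom)
    (c d : Idx B F) : φ ((fr.D c).1 (fr.z d)) = if c = d then 1 else 0 := by
  have h : φ ((fr.D c).1 (fr.z d)) = φ (if c = d then 1 else 0) := by
    refine hφ.congr ?_
    filter_upwards [fr.isOpen_dom.mem_nhds hx] with y hy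
    rw [fr.D_z c d y hy]
    split_ifs <;> rfl
  rw [h]
  split_ifs <;> simp

/-- The sign rule behind multiplying a superderivation by `a`: moving `a` past `u` costs `s t`, and
the sign `t` of the original Leibniz rule cancels, leaving the sign `s` of the product. -/
theorem mul_add_smul_mul_of_comm {a u : C} {s t : ℝ} (ht : t * t = 1)
    (h : a * u = (s * t) • (u * a)) (b g d : C) :
    a * (b * g + t • (u * d)) = a * b * g + s • (u * (a * d)) := by
  rw [mul_add, mul_smul_comm, ← mul_assoc, ← mul_assoc, h, smul_mul_assoc, smul_smul,
    mul_left_comm, ht, mul_one, mul_assoc u]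

theorem sum_eq_sum_mul_add_smul {ι : Type*} [Fintype ι] {a b d : ι → C} {g u : C} {s : ℝ}
    (h : ∀ i, a i = b i * g + s • (u * d i)) :
    ∑ i, a i = (∑ i, b i) * g + s • (u * ∑ i, d i) := by
  simp only [h, Finset.sum_add_distrib, Finset.sum_mul, Finset.mul_sum, Finset.smul_sum]

theorem add_smul_sub_add_smul (a b c d g u : C) (s : ℝ) :
    a * g + s • (u * b) - (c * g + s • (u * d)) = (a - c) * g + s • (u * (b - d)) := by
  rw [sub_mul, mul_sub, smul_sub]
  abel

/-- Expansion of a superderivation in coordinates. -/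
theorem IsLeibniz.eq_sum (hW : IsLeibniz φ p W) (hφ : IsPoint φ x) {x₀ : M}
    (fr : Frame B F E x₀) (hx : x ∈ fr.dom)
    (hcomm : ∀ c q, ∀ f ∈ parity B F E q,
      W (fr.z c) * φ f = koszul (p + par c) q • (φ f * W (fr.z c))) (f : superFun B F E) :
    W f = ∑ c, W (fr.z c) * φ ((fr.D c).1 f) := by
  obtain ⟨W', hW'a⟩ : ∃ W' : superFun B F E →ₗ[ℝ] C,
      ∀ f, W' f = W f - ∑ c, W (fr.z c) * φ ((fr.D c).1 f) :=
    ⟨{  toFun := fun f => W f - ∑ c, W (fr.z c) * φ ((fr.D c).1 f)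
        map_add' := fun f g => by
          simp only [map_add, mul_add, Finset.sum_add_distrib]
          abel
        map_smul' := fun r f => by
          simp only [map_smul, mul_smul_comm, ← Finset.smul_sum, ← smul_sub]
          rfl }, fun _ => rfl⟩
  -- Each term `W(z_c) · φ ∘ D_c` satisfies the Leibniz rule of parity `p`, with `hcomm` supplying
  -- the sign, so the difference does too; it vanishes on coordinates by duality.
  have hW' : IsLeibniz φ p W' := by
    intro q f hf g
    simp only [hW'a, hW q f hf g]
    have h1 : ∀ c, W (fr.z c) * φ ((fr.D c).1 (f * g)) =
        W (fr.z c) * φ ((fr.D c).1 f) * φ g +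
          koszul p q • (φ f * (W (fr.z c) * φ ((fr.D c).1 g))) := by
      intro c
      have e0 : (fr.D c).1 (f * g) =
          (fr.D c).1 f * g + koszul (par c) q • (f * (fr.D c).1 g) := (fr.D c).2.2 q f hf g
      rw [e0, map_add, map_smul, map_mul, map_mul]
      refine mul_add_smul_mul_of_comm (koszul_mul_self _ _) ?_ _ _ _
      rw [hcomm c q f hf, koszul_add_left]
    have h2 : ∑ c, W (fr.z c) * φ ((fr.D c).1 (f * g)) =
        (∑ c, W (fr.z c) * φ ((fr.D c).1 f)) * φ g +
          koszul p q • (φ f * ∑ c, W (fr.z c) * φ ((fr.D c).1 g)) :=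
      sum_eq_sum_mul_add_smul h1
    rw [h2]
    exact add_smul_sub_add_smul _ _ _ _ _ _ _
  have h2 := hW'.eq_zero hφ fr hx fun d => by
    rw [hW'a]
    simp [hφ.map_D_z fr hx]
  have h3 := hW'a f
  rw [h2, LinearMap.zero_apply] at h3
  exact (sub_eq_zero.1 h3.symm)

end

end BatchelorModel

/-! ### Tangent vectors of `E` as superderivations with values in the dual numbers -/

namespace BatchelorModel

open SuperAlg

noncomputable section

/-- The linear map `a + b τ ↦ a + b`. -/
def tot : DualNumber ℝ →ₗ[ℝ] ℝ where
  toFun z := z.fst + z.snd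
  map_add' a b := by simp only [TrivSqZeroExt.fst_add, TrivSqZeroExt.snd_add]; ring
  map_smul' r a := by
    simp only [TrivSqZeroExt.fst_smul, TrivSqZeroExt.snd_smul, RingHom.id_apply, smul_add]

theorem tot_apply (z : DualNumber ℝ) : tot z = z.fst + z.snd := rfl

theorem mem_dualParity_zero {z : DualNumber ℝ} : z ∈ dualParity 0 ↔ z.snd = 0 := by
  change (if (0 : ZMod 2) = 0 then z.snd = 0 else z.fst = 0) ↔ _
  simp

theorem mem_dualParity_one {z : DualNumber ℝ} : z ∈ dualParity 1 ↔ z.fst = 0 := by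
  change (if (1 : ZMod 2) = 0 then z.snd = 0 else z.fst = 0) ↔ _
  simp

theorem dual_mul_comm {p q : ZMod 2} {a b : DualNumber ℝ} (ha : a ∈ dualParity p)
    (hb : b ∈ dualParity q) : a * b = koszul p q • (b * a) := by
  rcases parity_cases p with rfl | rfl
  · rw [koszul_zero_left, one_smul, mul_comm]
  rcases parity_cases q with rfl | rfl
  · rw [koszul_zero_right, one_smul, mul_comm]
  rw [mem_dualParity_one] at ha hb
  ext <;> simp [ha, hb]

/-- A homogeneous dual number has a single possibly nonzero component. Adding components therefore
loses nothing, although `tot` is not injective and not multiplicative. -/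
theorem ext_of_tot {p : ZMod 2} {a b : DualNumber ℝ} (ha : a ∈ dualParity p)
    (hb : b ∈ dualParity p) (h : tot a = tot b) : a = b := by
  rw [tot_apply, tot_apply] at h
  rcases parity_cases p with rfl | rfl
  · rw [mem_dualParity_zero] at ha hb
    rw [ha, hb, add_zero, add_zero] at h
    exact TrivSqZeroExt.ext h (ha.trans hb.symm)
  · rw [mem_dualParity_one] at ha hb
    rw [ha, hb, zero_add, zero_add] at h
    exact TrivSqZeroExt.ext (ha.trans hb.symm) h

variable {B F : Type*} [NormedAddCommGroup B] [NormedSpace ℝ B] [FiniteDimensional ℝ B]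
  [NormedAddCommGroup F] [NormedSpace ℝ F] [FiniteDimensional ℝ F]
  {M : Type*} [TopologicalSpace M] [T2Space M] [ChartedSpace B M] [IsManifold 𝓘(ℝ, B) ∞ M]
  {E : M → Type*} [∀ x, AddCommGroup (E x)] [∀ x, Module ℝ (E x)]
  [TopologicalSpace (TotalSpace F E)] [∀ x, TopologicalSpace (E x)] [FiberBundle F E]
  [VectorBundle ℝ F E] [ContMDiffVectorBundle ∞ F E 𝓘(ℝ, B)]

theorem affinePart_eq_tot (f : superFun B F E) (v : TotalSpace F E) :
    affinePart f v = tot (evAt v f) := affinePart_eq f v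

theorem isPoint_evAt (v : TotalSpace F E) : IsPoint (evAt v : superFun B F E →ₐ[ℝ] _) v.1 :=
  fun c hc => evAt_fn v c hc

/-- The coordinate vector fields on `E`. -/
def bas {x₀ : M} (_ : Frame B F E x₀) (c : Idx B F) (v : TotalSpace F E) : TangentSpace (𝓘(ℝ, B).prod 𝓘(ℝ, F)) v :=
  (trivializationAt (B × F) (TangentSpace (𝓘(ℝ, B).prod 𝓘(ℝ, F)) : TotalSpace F E → Type _) ⟨x₀, 0⟩).localFrame
    ((Module.finBasis ℝ B).prod (Module.finBasis ℝ F)) c v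

variable {x₀ : M} (fr : Frame B F E x₀) {v : TotalSpace F E} 

theorem mem_chart_source_of_mem_dom (hv : v.1 ∈ fr.dom) :
    v ∈ (chartAt (ModelProd B F) (⟨x₀, 0⟩ : TotalSpace F E)).source := by
  rw [FiberBundle.chartedSpace_chartAt]
  simp [Trivialization.mem_source, fr.dom_subset_baseSet hv, fr.dom_subset_source hv]

/-- Even and odd coordinates of `ΠE` together become the coordinates of the bundle chart of `E`. The
chart does not depend on the fibre component of its centre, here chosen to be zero. -/
theorem affinePart_z (hv : v.1 ∈ fr.dom) (c : Idx B F) :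
    affinePart (fr.z c) v = ((Module.finBasis ℝ B).prod (Module.finBasis ℝ F)).coord c
      (extChartAt (𝓘(ℝ, B).prod 𝓘(ℝ, F)) (⟨x₀, 0⟩ : TotalSpace F E) v) := by
  have h1 : extChartAt (𝓘(ℝ, B).prod 𝓘(ℝ, F)) (⟨x₀, 0⟩ : TotalSpace F E) v =
      (extChartAt 𝓘(ℝ, B) x₀ v.1, (trivializationAt F E x₀).linearMapAt ℝ v.1 v.2) := by
    rw [FiberBundle.extChartAt, Trivialization.coe_linearMapAt_of_mem _ (fr.dom_subset_baseSet hv)]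
    refine Prod.ext ?_ rfl
    change extChartAt 𝓘(ℝ, B) x₀ (trivializationAt F E x₀ v).1 = _
    rw [(trivializationAt F E x₀).coe_fst' (fr.dom_subset_baseSet hv)]
  rw [h1, affinePart_eq_add]
  rcases c with i | a
  · rw [fr.z_even i _ hv, linPart_eq_zero_of_even (fr.z_mem (Sum.inl i)), add_zero]
    simp
  · rw [fr.z_odd a _ hv, body_eq_zero_of_odd (fr.z_mem (Sum.inr a)), zero_add]
    simp

theorem mvfderiv_z_bas (hv : v.1 ∈ fr.dom) (c d : Idx B F) :
    mvfderiv (𝓘(ℝ, B).prod 𝓘(ℝ, F)) (affinePart (fr.z c)) v (bas fr d v) = if d = c then 1 else 0 := by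
  have h1 : affinePart (fr.z c) =ᶠ[𝓝 v] fun u => LinearMap.toContinuousLinearMap
      (((Module.finBasis ℝ B).prod (Module.finBasis ℝ F)).coord c)
        (extChartAt (𝓘(ℝ, B).prod 𝓘(ℝ, F)) (⟨x₀, 0⟩ : TotalSpace F E) u) := by
    filter_upwards [(fr.isOpen_dom.preimage (FiberBundle.continuous_proj F E)).mem_nhds hv]
      with u hu using affinePart_z fr hu c
  have hs := mem_chart_source_of_mem_dom fr hv
  rw [h1.mvfderiv_eq, mvfderiv_clm_apply _
    ((contMDiffAt_extChartAt' (n := ∞) hs).mdifferentiableAt (by simp)), bas,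
    mvfderiv_extChartAt_localFrame (I := (𝓘(ℝ, B).prod 𝓘(ℝ, F))) hs]
  change ((Module.finBasis ℝ B).prod (Module.finBasis ℝ F)).coord c
    (((Module.finBasis ℝ B).prod (Module.finBasis ℝ F)) d) = _
  rw [Module.Basis.coord_apply, Module.Basis.repr_self, Finsupp.single_apply]

theorem contMDiffAt_bas (hv : v.1 ∈ fr.dom) (c : Idx B F) :
    ContMDiffAt (𝓘(ℝ, B).prod 𝓘(ℝ, F)) (𝓘(ℝ, B).prod 𝓘(ℝ, F)).tangent ∞
      (fun u => (⟨u, bas fr c u⟩ : TangentBundle (𝓘(ℝ, B).prod 𝓘(ℝ, F)) (TotalSpace F E))) v :=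
  contMDiffAt_localFrame_of_mem (I := (𝓘(ℝ, B).prod 𝓘(ℝ, F))) ∞ _ _ c (mem_chart_source_of_mem_dom fr hv)

theorem eq_sum_bas (hv : v.1 ∈ fr.dom) (w : TangentSpace (𝓘(ℝ, B).prod 𝓘(ℝ, F)) v) :
    w = ∑ c, mvfderiv (𝓘(ℝ, B).prod 𝓘(ℝ, F)) (affinePart (fr.z c)) v w • bas fr c v := by
  have hb : v ∈ (trivializationAt (B × F) (TangentSpace (𝓘(ℝ, B).prod 𝓘(ℝ, F)) : TotalSpace F E → Type _)
    ⟨x₀, 0⟩).baseSet := mem_chart_source_of_mem_dom fr hv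
  set b := (trivializationAt (B × F) (TangentSpace (𝓘(ℝ, B).prod 𝓘(ℝ, F)) : TotalSpace F E → Type _)
    ⟨x₀, 0⟩).basisAt ((Module.finBasis ℝ B).prod (Module.finBasis ℝ F)) hb
  have hbas : ∀ c, bas fr c v = b c := fun c =>
    Trivialization.localFrame_apply_of_mem_baseSet _ _ hb
  have h1 : ∀ c, mvfderiv (𝓘(ℝ, B).prod 𝓘(ℝ, F)) (affinePart (fr.z c)) v w = b.repr w c := by
    intro c
    conv_lhs => rw [← b.sum_repr w]
    simp only [map_sum, map_smul, ← hbas, mvfderiv_z_bas fr hv]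
    simp
  simp only [h1, hbas, b.sum_repr]

/-- The coordinates are affine, so the defining properties of the associated objects, which test
only affine functions, determine tangent vectors. -/
theorem tangent_ext (hv : v.1 ∈ fr.dom) {w w' : TangentSpace (𝓘(ℝ, B).prod 𝓘(ℝ, F)) v}
    (h : ∀ c, mvfderiv (𝓘(ℝ, B).prod 𝓘(ℝ, F)) (affinePart (fr.z c)) v w = mvfderiv (𝓘(ℝ, B).prod 𝓘(ℝ, F)) (affinePart (fr.z c)) v w') :
    w = w' := by
  rw [eq_sum_bas fr hv w, eq_sum_bas fr hv w']
  simp only [h]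

theorem mdifferentiableAt_bodyProj (f : superFun B F E) (v : TotalSpace F E) :
    MDifferentiableAt (𝓘(ℝ, B).prod 𝓘(ℝ, F)) 𝓘(ℝ, ℝ) (fun u : TotalSpace F E => body f u.1) v :=
  (((contMDiff_body f).comp (contMDiff_proj E)).contMDiffAt).mdifferentiableAt (by simp)

theorem mdifferentiableAt_linPart (f : superFun B F E) (v : TotalSpace F E) :
    MDifferentiableAt (𝓘(ℝ, B).prod 𝓘(ℝ, F)) 𝓘(ℝ, ℝ) (linPart f) v :=
  (contMDiff_linPart f).contMDiffAt.mdifferentiableAt (by simp)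

theorem mdifferentiableAt_affinePart (f : superFun B F E) (v : TotalSpace F E) :
    MDifferentiableAt (𝓘(ℝ, B).prod 𝓘(ℝ, F)) 𝓘(ℝ, ℝ) (affinePart f) v :=
  (contMDiff_affinePart f).contMDiffAt.mdifferentiableAt (by simp)

/-- A tangent vector of `E` as a superderivation along the evaluation at its base point. -/
def vecAt (v : TotalSpace F E) (w : TangentSpace (𝓘(ℝ, B).prod 𝓘(ℝ, F)) v) : superFun B F E →ₗ[ℝ] DualNumber ℝ where
  toFun f := TrivSqZeroExt.inl (mvfderiv (𝓘(ℝ, B).prod 𝓘(ℝ, F)) (fun u : TotalSpace F E => body f u.1) v w) +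
    TrivSqZeroExt.inr (mvfderiv (𝓘(ℝ, B).prod 𝓘(ℝ, F)) (linPart f) v w)
  map_add' f g := by
    have h1 : (fun u : TotalSpace F E => body (f + g) u.1) =
      fun u => body f u.1 + body g u.1 := funext fun u => by rw [body_add]; rfl
    have h2 : linPart (f + g) = fun u => linPart f u + linPart g u :=
      funext fun u => by simp [linPart]
    rw [h1, h2, mvfderiv_fun_add (mdifferentiableAt_bodyProj f v) (mdifferentiableAt_bodyProj g v),
      mvfderiv_fun_add (mdifferentiableAt_linPart f v) (mdifferentiableAt_linPart g v)]
    ext <;> simp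
  map_smul' r f := by
    have h1 : (fun u : TotalSpace F E => body (r • f) u.1) =
      fun u => (r • ContinuousLinearMap.id ℝ ℝ) (body f u.1) := funext fun u => by simp [body]
    have h2 : linPart (r • f) = fun u => (r • ContinuousLinearMap.id ℝ ℝ) (linPart f u) :=
      funext fun u => by simp [linPart]
    rw [h1, h2, mvfderiv_clm_apply _ (mdifferentiableAt_bodyProj f v),
      mvfderiv_clm_apply _ (mdifferentiableAt_linPart f v)]
    ext <;> simp

theorem fst_vecAt (w : TangentSpace (𝓘(ℝ, B).prod 𝓘(ℝ, F)) v) (f : superFun B F E) :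
    (vecAt v w f).fst = mvfderiv (𝓘(ℝ, B).prod 𝓘(ℝ, F)) (fun u : TotalSpace F E => body f u.1) v w := by
  simp [vecAt]

theorem snd_vecAt (w : TangentSpace (𝓘(ℝ, B).prod 𝓘(ℝ, F)) v) (f : superFun B F E) :
    (vecAt v w f).snd = mvfderiv (𝓘(ℝ, B).prod 𝓘(ℝ, F)) (linPart f) v w := by
  simp [vecAt]

theorem tot_vecAt (w : TangentSpace (𝓘(ℝ, B).prod 𝓘(ℝ, F)) v) (f : superFun B F E) :
    tot (vecAt v w f) = mvfderiv (𝓘(ℝ, B).prod 𝓘(ℝ, F)) (affinePart f) v w := by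
  have h : affinePart f = fun u => body f u.1 + linPart f u := funext (affinePart_eq_add f)
  rw [h, mvfderiv_fun_add (mdifferentiableAt_bodyProj f v) (mdifferentiableAt_linPart f v),
    tot_apply, fst_vecAt, snd_vecAt]
  rfl

/-- The components of a product of superfunctions in degrees zero and one multiply like dual
numbers, so the Leibniz rule is the product rule for these two components. -/
theorem vecAt_mem (w : TangentSpace (𝓘(ℝ, B).prod 𝓘(ℝ, F)) v) :
    vecAt v w ∈ derAlong (parity B F E) dualParity (evAt v) 0 := by
  refine ⟨fun q f hf => ?_, fun q f hf g => ?_⟩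
  · rw [zero_add]
    rcases parity_cases q with rfl | rfl
    · rw [mem_dualParity_zero, snd_vecAt]
      have : linPart f = fun _ => 0 := funext (linPart_eq_zero_of_even hf)
      rw [this, mvfderiv_const]; rfl
    · rw [mem_dualParity_one, fst_vecAt]
      have : (fun u : TotalSpace F E => body f u.1) = fun _ => 0 :=
        funext fun u => body_eq_zero_of_odd hf u.1
      rw [this, mvfderiv_const]; rfl
  · have h1 : (fun u : TotalSpace F E => body (f * g) u.1) =
      fun u => body f u.1 * body g u.1 := funext fun u => by rw [body_mul]; rfl
    have h2 : linPart (f * g) = fun u => body f u.1 * linPart g u + body g u.1 * linPart f u :=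
      funext fun u => linPart_mul f g u
    have hf := mdifferentiableAt_bodyProj f v
    have hg := mdifferentiableAt_bodyProj g v
    have hf' := mdifferentiableAt_linPart f v
    have hg' := mdifferentiableAt_linPart g v
    rw [koszul_zero_left, one_smul]
    refine TrivSqZeroExt.ext ?_ ?_
    · rw [TrivSqZeroExt.fst_add, TrivSqZeroExt.fst_mul, TrivSqZeroExt.fst_mul, fst_vecAt, fst_vecAt,
        fst_vecAt, fst_evAt, fst_evAt, h1, mvfderiv_fun_mul hf hg]
      simp
      ring
    · rw [TrivSqZeroExt.snd_add, TrivSqZeroExt.snd_mul, TrivSqZeroExt.snd_mul, fst_vecAt, fst_vecAt,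
        snd_vecAt, snd_vecAt, snd_vecAt, fst_evAt, fst_evAt, h2,
        mvfderiv_fun_add (g := fun u => body f u.1 * linPart g u)
          (g' := fun u => body g u.1 * linPart f u) (hf.mul hg') (hg.mul hf'), mvfderiv_fun_mul hf hg',
        mvfderiv_fun_mul hg hf']
      simp [linPart]
      ring

theorem isLeibniz_of_mem {p : ZMod 2} {C : Type*} [Ring C] [Algebra ℝ C]
    {𝒞 : ZMod 2 → Submodule ℝ C} {φ : superFun B F E →ₐ[ℝ] C} {W : superFun B F E →ₗ[ℝ] C}
    (hW : W ∈ derAlong (parity B F E) 𝒞 φ p) : IsLeibniz φ p W := hW.2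

/-- The tangent vector at `v` whose derivatives of the coordinates are given by `V`. -/
def toTangent (fr : Frame B F E x₀) (v : TotalSpace F E) (V : superFun B F E →ₗ[ℝ] DualNumber ℝ) :
    TangentSpace (𝓘(ℝ, B).prod 𝓘(ℝ, F)) v := ∑ c, tot (V (fr.z c)) • bas fr c v

theorem mvfderiv_z_toTangent (hv : v.1 ∈ fr.dom) (V : superFun B F E →ₗ[ℝ] DualNumber ℝ)
    (c : Idx B F) : mvfderiv (𝓘(ℝ, B).prod 𝓘(ℝ, F)) (affinePart (fr.z c)) v (toTangent fr v V) = tot (V (fr.z c)) := by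
  simp only [toTangent, map_sum, map_smul, mvfderiv_z_bas fr hv]
  simp

/-- Both sides are even superderivations along `evAt v`. They agree on coordinates after `tot`,
hence on coordinates, hence everywhere. -/
theorem vecAt_toTangent (hv : v.1 ∈ fr.dom) {V : superFun B F E →ₗ[ℝ] DualNumber ℝ}
    (hV : V ∈ derAlong (parity B F E) dualParity (evAt v) 0) :
    vecAt v (toTangent fr v V) = V := by
  have h1 := sub_mem (vecAt_mem (toTangent fr v V)) hV
  have h2 := (isLeibniz_of_mem h1).eq_zero (isPoint_evAt v) fr hv fun c => by
    rw [LinearMap.sub_apply, sub_eq_zero]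
    refine ext_of_tot (p := 0 + par c) ((vecAt_mem _).1 _ _ (fr.z_mem c)) (hV.1 _ _ (fr.z_mem c)) ?_
    rw [tot_vecAt, mvfderiv_z_toTangent fr hv]
  exact sub_eq_zero.1 h2

end

end BatchelorModel

/-! ### Points and tangent vectors of `E` from morphisms to the dual numbers -/

namespace BatchelorModel

open SuperAlg

noncomputable section

/-- The generator of parity `p` of the dual numbers. -/
def eps (p : ZMod 2) : DualNumber ℝ := if p = 0 then 1 else DualNumber.eps

@[simp] theorem eps_zero : eps 0 = 1 := rfl

@[simp] theorem eps_one : eps 1 = DualNumber.eps := rfl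

theorem tot_eps (p : ZMod 2) : tot (eps p) = 1 := by
  rcases parity_cases p with rfl | rfl <;> simp [tot_apply]

theorem eps_mem (p : ZMod 2) : eps p ∈ dualParity p := by
  rcases parity_cases p with rfl | rfl
  · rw [mem_dualParity_zero]; simp
  · rw [mem_dualParity_one]; simp

theorem dual_mul_mem {p q : ZMod 2} {a b : DualNumber ℝ} (ha : a ∈ dualParity p)
    (hb : b ∈ dualParity q) : a * b ∈ dualParity (p + q) := by
  rcases parity_cases p with rfl | rfl <;> rcases parity_cases q with rfl | rfl
  · rw [zero_add]; rw [mem_dualParity_zero] at *; simp [ha, hb]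
  · rw [zero_add]; rw [mem_dualParity_one] at *; simp [hb]
  · rw [add_zero]; rw [mem_dualParity_one] at *; simp [ha]
  · rw [parity_add_self]; rw [mem_dualParity_one] at ha hb; rw [mem_dualParity_zero]; simp [ha, hb]

theorem tot_eps_one_mul (z : DualNumber ℝ) : tot (eps 1 * z) = z.fst := by
  simp [tot_apply]

/-- For two odd indices the left side is `τ² = 0` while the right side is `1`. This exception is why
several arguments below treat the odd-odd case separately. -/
theorem eps_mul_eps {p q : ZMod 2} (h : ¬ (p = 1 ∧ q = 1)) : eps p * eps q = eps (p + q) := by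
  rcases parity_cases p with rfl | rfl <;> rcases parity_cases q with rfl | rfl <;> simp_all

variable {B F : Type*} [NormedAddCommGroup B] [NormedSpace ℝ B] [FiniteDimensional ℝ B]
  [NormedAddCommGroup F] [NormedSpace ℝ F] [FiniteDimensional ℝ F]
  {M : Type*} [TopologicalSpace M] [T2Space M] [ChartedSpace B M] [IsManifold 𝓘(ℝ, B) ∞ M]
  {E : M → Type*} [∀ x, AddCommGroup (E x)] [∀ x, Module ℝ (E x)]
  [TopologicalSpace (TotalSpace F E)] [∀ x, TopologicalSpace (E x)] [FiberBundle F E]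
  [VectorBundle ℝ F E] [ContMDiffVectorBundle ∞ F E 𝓘(ℝ, B)]

/-- A choice of coordinates near `x`. -/
def frameAt (x : M) : Frame B F E x := (nonempty_frame x).some

theorem evAt_z_odd {x₀ : M} (fr : Frame B F E x₀) (a) (v : TotalSpace F E) (hv : v.1 ∈ fr.dom) :
    evAt v (fr.z (Sum.inr a)) = TrivSqZeroExt.inr
      ((Module.finBasis ℝ F).coord a ((trivializationAt F E x₀).linearMapAt ℝ v.1 v.2)) := by
  refine TrivSqZeroExt.ext ?_ ?_
  · rw [fst_evAt, body_eq_zero_of_odd (fr.z_mem (Sum.inr a))]; rfl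
  · exact fr.z_odd a v hv

/-- Every point of `ΠE` with values in the dual numbers is the evaluation at a point of `E`. -/
theorem exists_eq_evAt {x : M} (φ : superFun B F E →ₐ[ℝ] DualNumber ℝ)
    (heven : ∀ p, ∀ f ∈ parity B F E p, φ f ∈ dualParity p) (hbody : ∀ f, (φ f).fst = body f x) :
    ∃ e : E x, φ = evAt (⟨x, e⟩ : TotalSpace F E) := by
  let fr : Frame B F E x := frameAt x
  have hx := fr.dom_subset_baseSet fr.mem_dom
  -- The coordinates of the vector are the `τ`-coefficients of the images of the odd coordinates.
  refine ⟨(trivializationAt F E x).symmₗ ℝ x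
    (∑ a, (φ (fr.z (Sum.inr a))).snd • Module.finBasis ℝ F a), ?_⟩
  have hφ : IsPoint φ x := by
    intro c hc
    refine TrivSqZeroExt.ext ?_ ?_
    · rw [hbody, body_fn]; rfl
    · exact mem_dualParity_zero.1 (heven 0 _ (fn_mem_parity c hc))
  refine hφ.ext (isPoint_evAt _) fr fr.mem_dom fun a => ?_
  rw [evAt_z_odd fr a _ fr.mem_dom, Trivialization.linearMapAt_symmₗ _ hx]
  refine TrivSqZeroExt.ext ?_ ?_
  · exact mem_dualParity_one.1 (heven 1 _ (fr.z_mem (Sum.inr a)))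
  · simp [Finsupp.single_apply]

theorem eq_of_forall_evAt_z {x₀ : M} (fr : Frame B F E x₀) {x : M} (hx : x ∈ fr.dom) {e e' : E x}
    (h : ∀ a, affinePart (fr.z (Sum.inr a)) ⟨x, e⟩ = affinePart (fr.z (Sum.inr a)) ⟨x, e'⟩) :
    e = e' := by
  have h1 : (trivializationAt F E x₀).linearMapAt ℝ x e =
      (trivializationAt F E x₀).linearMapAt ℝ x e' := by
    refine (Module.finBasis ℝ F).ext_elem fun a => ?_
    have := h a
    rw [affinePart_eq_tot, affinePart_eq_tot, evAt_z_odd fr a _ hx, evAt_z_odd fr a _ hx] at this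
    simpa [tot_apply] using this
  have h2 := congrArg ((trivializationAt F E x₀).symmₗ ℝ x) h1
  rwa [Trivialization.symmₗ_linearMapAt _ (fr.dom_subset_baseSet hx),
    Trivialization.symmₗ_linearMapAt _ (fr.dom_subset_baseSet hx)] at h2

/-- Fibrewise affine functions separate the points of `E`. -/
theorem eq_of_affinePart_eq {v v' : TotalSpace F E}
    (h : ∀ s : superFun B F E, IsAffine s → affinePart s v = affinePart s v') : v = v' := by
  obtain ⟨x, e⟩ := v
  obtain ⟨x', e'⟩ := v'
  have hx : x = x' := by
    by_contra hne
    obtain ⟨χ, h1, h2, h3⟩ := exists_contMDiff_bump (B := B)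
      (isOpen_compl_singleton.mem_nhds (show x ∈ ({x'} : Set M)ᶜ from hne))
    have h4 := h _ (isAffine_fn χ h1)
    rw [affinePart_eq_tot, affinePart_eq_tot, evAt_fn, evAt_fn, h2.self_of_nhds,
      image_eq_zero_of_notMem_tsupport fun h => h3 h rfl] at h4
    simp [tot_apply] at h4
  subst hx
  congr 1
  exact eq_of_forall_evAt_z (frameAt x) (frameAt x).mem_dom fun a => h _ ((frameAt x).z_affine _)

theorem exists_tangentVector (A : InitialCondition B F E) :
    ∃ α : TangentBundle (𝓘(ℝ, B).prod 𝓘(ℝ, F)) (TotalSpace F E), (∀ f, A.pullback f = evAt α.1 f) ∧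
      ∀ f, A.vec.1 f = vecAt α.1 α.2 f := by
  obtain ⟨x, φ, heven, hbody, V⟩ := A
  obtain ⟨e, rfl⟩ := exists_eq_evAt φ heven hbody
  refine ⟨⟨⟨x, e⟩, toTangent (frameAt x) _ V.1⟩, fun f => rfl, fun f => ?_⟩
  rw [vecAt_toTangent (v := ⟨x, e⟩) (frameAt x) (frameAt x).mem_dom V.2]

theorem isAssociatedVector_of_eq {A : InitialCondition B F E}
    {α : TangentBundle (𝓘(ℝ, B).prod 𝓘(ℝ, F)) (TotalSpace F E)} (h1 : ∀ f, A.pullback f = evAt α.1 f)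
    (h2 : ∀ f, A.vec.1 f = vecAt α.1 α.2 f) : IsAssociatedVector A α := by
  intro s _
  rw [h1, h2, affinePart_eq_tot, ← tot_vecAt]
  exact ⟨rfl, rfl⟩

theorem tangentBundle_ext {α β : TangentBundle (𝓘(ℝ, B).prod 𝓘(ℝ, F)) (TotalSpace F E)}
    (h1 : ∀ s : superFun B F E, IsAffine s → affinePart s α.1 = affinePart s β.1)
    (h2 : ∀ s : superFun B F E, IsAffine s → mvfderiv (𝓘(ℝ, B).prod 𝓘(ℝ, F)) (affinePart s) α.1 α.2 =
      mvfderiv (𝓘(ℝ, B).prod 𝓘(ℝ, F)) (affinePart s) β.1 β.2) : α = β := by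
  obtain ⟨v, w⟩ := α
  obtain ⟨v', w'⟩ := β
  obtain rfl : v = v' := eq_of_affinePart_eq h1
  congr 1
  exact tangent_ext (frameAt v.1) (frameAt v.1).mem_dom fun c => h2 _ ((frameAt v.1).z_affine c)

theorem existsUnique_isAssociatedVector (A : InitialCondition B F E) :
    ∃! α, IsAssociatedVector A α := by
  obtain ⟨α, h1, h2⟩ := exists_tangentVector A
  have h3 := isAssociatedVector_of_eq h1 h2
  refine ⟨α, h3, fun β hβ => tangentBundle_ext (fun s hs => ?_) fun s hs => ?_⟩
  · rw [(hβ s hs).1, (h3 s hs).1]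
  · rw [(hβ s hs).2, (h3 s hs).2]

/-! ### Tangent vectors of `E` from superderivations -/

/-- The superderivation `f ↦ X f`, for `X` even, or `f ↦ τ · X f`, for `X` odd, along the evaluation
at `v`. -/
def derAt {p : ZMod 2} (X : der (parity B F E) p) (v : TotalSpace F E) :
    superFun B F E →ₗ[ℝ] DualNumber ℝ :=
  LinearMap.mulLeft ℝ (eps p) ∘ₗ (evAt v).toLinearMap ∘ₗ X.1

theorem derAt_apply {p : ZMod 2} (X : der (parity B F E) p) (v : TotalSpace F E)
    (f : superFun B F E) : derAt X v f = eps p * evAt v (X.1 f) := rfl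

/-- The factor `eps p` has the parity of `X`, so the product is even; moving `eps p` past `evAt v f`
absorbs the sign in the Leibniz rule of `X`. -/
theorem derAt_mem {p : ZMod 2} (X : der (parity B F E) p) (v : TotalSpace F E) :
    derAt X v ∈ derAlong (parity B F E) dualParity (evAt v) 0 := by
  refine ⟨fun q f hf => ?_, fun q f hf g => ?_⟩
  · have h := dual_mul_mem (eps_mem p) (evAt_mem_dualParity v (X.2.1 q f hf))
    rwa [← add_assoc, parity_add_self] at h
  · have h1 : X.1 (f * g) = X.1 f * g + koszul p q • (f * X.1 g) := X.2.2 q f hf g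
    have h2 : eps p * evAt v f = koszul p q • (evAt v f * eps p) :=
      dual_mul_comm (eps_mem p) (evAt_mem_dualParity v hf)
    rw [derAt_apply, derAt_apply, derAt_apply, h1, map_add, map_smul, map_mul, map_mul]
    refine mul_add_smul_mul_of_comm (koszul_mul_self _ _) ?_ _ _ _
    rw [h2, koszul_zero_left, one_mul]

/-- The tangent vector at `v` given by a superderivation. -/
def tanVec {p : ZMod 2} (X : der (parity B F E) p) (v : TotalSpace F E) : TangentSpace (𝓘(ℝ, B).prod 𝓘(ℝ, F)) v :=
  toTangent (frameAt v.1) v (derAt X v)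

theorem vecAt_tanVec {p : ZMod 2} (X : der (parity B F E) p) (v : TotalSpace F E)
    (f : superFun B F E) : vecAt v (tanVec X v) f = eps p * evAt v (X.1 f) := by
  rw [tanVec, vecAt_toTangent _ (frameAt v.1).mem_dom (derAt_mem X v), derAt_apply]

theorem mvfderiv_tanVec {p : ZMod 2} (X : der (parity B F E) p) (v : TotalSpace F E)
    (f : superFun B F E) :
    mvfderiv (𝓘(ℝ, B).prod 𝓘(ℝ, F)) (affinePart f) v (tanVec X v) = tot (eps p * evAt v (X.1 f)) := by
  rw [← tot_vecAt, vecAt_tanVec]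

theorem mvfderiv_tanVec_even (X : der (parity B F E) 0) (v : TotalSpace F E)
    (f : superFun B F E) :
    mvfderiv (𝓘(ℝ, B).prod 𝓘(ℝ, F)) (affinePart f) v (tanVec X v) = affinePart (X.1 f) v := by
  rw [mvfderiv_tanVec, eps_zero, one_mul, affinePart_eq_tot]

variable {x₀ : M} (fr : Frame B F E x₀) {v : TotalSpace F E}

theorem bas_eq_tanVec (hv : v.1 ∈ fr.dom) (c : Idx B F) : bas fr c v = tanVec (fr.D c) v := by
  refine tangent_ext fr hv fun d => ?_
  rw [mvfderiv_z_bas fr hv, mvfderiv_tanVec, (isPoint_evAt v).map_D_z fr hv]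
  split_ifs
  · rw [mul_one, tot_eps]
  · rw [mul_zero, map_zero]

theorem tanVec_eq_sum (hv : v.1 ∈ fr.dom) (X : der (parity B F E) 0) :
    tanVec X v = ∑ c, affinePart (X.1 (fr.z c)) v • bas fr c v := by
  conv_lhs => rw [eq_sum_bas fr hv (tanVec X v)]
  simp only [mvfderiv_tanVec_even]

theorem contMDiffAt_sum_smul_bas (hv : v.1 ∈ fr.dom) {r : Idx B F → TotalSpace F E → ℝ}
    (hr : ∀ c, ContMDiffAt (𝓘(ℝ, B).prod 𝓘(ℝ, F)) 𝓘(ℝ, ℝ) ∞ (r c) v) {X : ∀ u, TangentSpace (𝓘(ℝ, B).prod 𝓘(ℝ, F)) u}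
    (hX : ∀ u, u.1 ∈ fr.dom → X u = ∑ c, r c u • bas fr c u) :
    ContMDiffAt (𝓘(ℝ, B).prod 𝓘(ℝ, F)) (𝓘(ℝ, B).prod 𝓘(ℝ, F)).tangent ∞
      (fun u => (⟨u, X u⟩ : TangentBundle (𝓘(ℝ, B).prod 𝓘(ℝ, F)) (TotalSpace F E))) v := by
  have h : ContMDiffAt (𝓘(ℝ, B).prod 𝓘(ℝ, F)) (𝓘(ℝ, B).prod 𝓘(ℝ, F)).tangent ∞
      (fun u => (⟨u, ∑ c, r c u • bas fr c u⟩ : TangentBundle (𝓘(ℝ, B).prod 𝓘(ℝ, F)) (TotalSpace F E))) v :=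
    ContMDiffAt.sum_section fun c _ => (hr c).smul_section (contMDiffAt_bas fr hv c)
  refine h.congr_of_eventuallyEq ?_
  filter_upwards [(fr.isOpen_dom.preimage (FiberBundle.continuous_proj F E)).mem_nhds hv] with u hu
  rw [hX u hu]

theorem isSmoothField_tanVec (X : der (parity B F E) 0) :
    Classical.IsSmoothField (I := (𝓘(ℝ, B).prod 𝓘(ℝ, F))) (tanVec X : ∀ _ : TotalSpace F E, _) := fun v =>
  contMDiffAt_sum_smul_bas (frameAt v.1) (frameAt v.1).mem_dom
    (fun _ => (contMDiff_affinePart _).contMDiffAt) fun _ hu => tanVec_eq_sum _ hu X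

theorem corresponds_tanVec (X : der (parity B F E) 0) : Corresponds X (tanVec X) :=
  ⟨isSmoothField_tanVec X, fun s _ u => mvfderiv_tanVec_even X u s⟩

/-- Derivatives of affine coordinates determine a field, so the field `Ψ(X)` of the theorem is
`tanVec X`. -/
theorem Corresponds.eq_tanVec {X : der (parity B F E) 0}
    {X' : ∀ v : TotalSpace F E, TangentSpace (𝓘(ℝ, B).prod 𝓘(ℝ, F)) v} (h : Corresponds X X') : X' = tanVec X :=
  funext fun v => tangent_ext (frameAt v.1) (frameAt v.1).mem_dom fun c => by
    rw [h.2 _ ((frameAt v.1).z_affine c), mvfderiv_tanVec_even]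

end

end BatchelorModel

/-! ### Bilinear forms on `E` from bilinear operations on superderivations -/

namespace BatchelorModel

open SuperAlg

noncomputable section

variable {A : Type*} [Ring A] [Algebra ℝ A] {𝒜 : ZMod 2 → Submodule ℝ A}

/-- Supercommutativity of a graded algebra. -/
structure IsSupercommutative (𝒜 : ZMod 2 → Submodule ℝ A) : Prop where
  mul_mem : ∀ {p q : ZMod 2} {f g : A}, f ∈ 𝒜 p → g ∈ 𝒜 q → f * g ∈ 𝒜 (p + q)
  comm : ∀ {p q : ZMod 2} {f g : A}, f ∈ 𝒜 p → g ∈ 𝒜 q → f * g = koszul p q • (g * f)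

theorem mulLeft_comp_mem_derAlong {C : Type*} [Ring C] [Algebra ℝ C] {𝒞 : ZMod 2 → Submodule ℝ C}
    (h𝒞 : IsSupercommutative 𝒞) {φ : A →ₐ[ℝ] C} (hφ : ∀ q, ∀ g ∈ 𝒜 q, φ g ∈ 𝒞 q) {r p : ZMod 2}
    {f : C} (hf : f ∈ 𝒞 r) {D : A →ₗ[ℝ] C} (hD : D ∈ derAlong 𝒜 𝒞 φ p) :
    LinearMap.mulLeft ℝ f ∘ₗ D ∈ derAlong 𝒜 𝒞 φ (r + p) := by
  refine ⟨fun q g hg => ?_, fun q g hg k => ?_⟩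
  · have := h𝒞.mul_mem hf (hD.1 q g hg)
    rwa [← add_assoc] at this
  · have h1 : D (g * k) = D g * φ k + koszul p q • (φ g * D k) := hD.2 q g hg k
    have h2 : f * φ g = (koszul (r + p) q * koszul p q) • (φ g * f) := by
      rw [h𝒞.comm hf (hφ q g hg), koszul_add_left, mul_assoc, koszul_mul_self, mul_one]
    change f * D (g * k) = f * D g * φ k + koszul (r + p) q • (φ g * (f * D k))
    rw [h1]
    exact mul_add_smul_mul_of_comm (koszul_mul_self _ _) h2 _ _ _

/-- The product `f D` of a superfunction and a superderivation. -/
def smulDer (h𝒜 : IsSupercommutative 𝒜) {r p p' : ZMod 2} (f : A) (hf : f ∈ 𝒜 r) (D : der 𝒜 p)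
    (h : p' = r + p) : der 𝒜 p' :=
  ⟨LinearMap.mulLeft ℝ f ∘ₗ D.1,
    h ▸ mulLeft_comp_mem_derAlong h𝒜 (fun _ _ hg => hg) hf D.2⟩

/-- Bilinear operations on superderivations with values in superfunctions, linear over
superfunctions up to the signs `σ₁` and `σ₂`. -/
structure SuperForm (𝒜 : ZMod 2 → Submodule ℝ A) (σ₁ : ZMod 2 → ℝ) (σ₂ : ZMod 2 → ZMod 2 → ℝ) where
  /-- the value on homogeneous superderivations -/
  val : ∀ {p q : ZMod 2}, der 𝒜 p →ₗ[ℝ] der 𝒜 q →ₗ[ℝ] A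
  left_zero : σ₁ 0 = 1
  right_zero : ∀ p, σ₂ p 0 = 1
  smul_left : ∀ {r p q : ZMod 2} (f : A) (X : der 𝒜 p) (fX : der 𝒜 (r + p)) (Y : der 𝒜 q),
    f ∈ 𝒜 r → (∀ a, fX.1 a = f * X.1 a) → val fX Y = σ₁ r • (f * val X Y)
  smul_right : ∀ {r p q : ZMod 2} (f : A) (X : der 𝒜 p) (Y : der 𝒜 q) (fY : der 𝒜 (r + q)),
    f ∈ 𝒜 r → (∀ a, fY.1 a = f * Y.1 a) → val X fY = σ₂ p r • (f * val X Y)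

variable {σ₁ : ZMod 2 → ℝ} {σ₂ : ZMod 2 → ZMod 2 → ℝ}

theorem SuperForm.val_smul_left (H : SuperForm 𝒜 σ₁ σ₂) (h𝒜 : IsSupercommutative 𝒜)
    {r p p' q : ZMod 2} (f : A) (hf : f ∈ 𝒜 r) (X : der 𝒜 p) (h : p' = r + p) (Y : der 𝒜 q) :
    H.val (smulDer h𝒜 f hf X h) Y = σ₁ r • (f * H.val X Y) := by
  subst h; exact H.smul_left f X _ Y hf fun _ => rfl

theorem SuperForm.val_smul_right (H : SuperForm 𝒜 σ₁ σ₂) (h𝒜 : IsSupercommutative 𝒜)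
    {r p q q' : ZMod 2} (f : A) (hf : f ∈ 𝒜 r) (X : der 𝒜 p) (Y : der 𝒜 q) (h : q' = r + q) :
    H.val X (smulDer h𝒜 f hf Y h) = σ₂ p r • (f * H.val X Y) := by
  subst h; exact H.smul_right f X Y _ hf fun _ => rfl

/-- The form given by a metric. -/
def metricForm {ε : ZMod 2} (g : SuperAlg.Metric 𝒜 ε) :
    SuperForm 𝒜 (fun r => koszul ε r) (fun p r => koszul p r * koszul ε r) where
  val := g.val
  left_zero := koszul_zero_right ε
  right_zero p := by rw [koszul_zero_right, koszul_zero_right, mul_one]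
  smul_left f X fX Y hf hX := g.smul_left f X fX Y hf hX
  smul_right {r p q} f X Y fY hf hY := by
    -- Swapping the arguments twice moves linearity from the first slot to the second; the swap
    -- signs leave only the factor from passing `f` over `X`.
    rw [g.supersymm, g.smul_left f Y fY X hf hY, g.supersymm Y X, mul_smul_comm, smul_smul,
      smul_smul, koszul_add_right, koszul_comm q p]
    congr 1
    linear_combination (koszul p r * koszul ε r) * koszul_mul_self p q

/-- The Hessian `(X, Y) ↦ X (Y f) - (∇_X Y) f` of a superfunction. -/
def hessForm (nabla : Connection 𝒜) (f : A) : SuperForm 𝒜 (fun _ => 1) koszul where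
  val {p q} := LinearMap.mk₂ ℝ (fun (X : der 𝒜 p) (Y : der 𝒜 q) =>
      X.1 (Y.1 f) - (nabla.nabla X Y).1 f)
    (fun X X' Y => by
      rw [map_add, LinearMap.add_apply]
      change X.1 (Y.1 f) + X'.1 (Y.1 f) - ((nabla.nabla X Y).1 f + (nabla.nabla X' Y).1 f) = _
      abel)
    (fun c X Y => by
      rw [map_smul, LinearMap.smul_apply]
      change c • X.1 (Y.1 f) - c • (nabla.nabla X Y).1 f = _
      rw [smul_sub])
    (fun X Y Y' => by
      rw [map_add]
      change X.1 (Y.1 f + Y'.1 f) - ((nabla.nabla X Y).1 f + (nabla.nabla X Y').1 f) = _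
      rw [map_add]
      abel)
    (fun c X Y => by
      rw [map_smul]
      change X.1 (c • Y.1 f) - c • (nabla.nabla X Y).1 f = _
      rw [map_smul, smul_sub])
  left_zero := rfl
  right_zero p := koszul_zero_right p
  smul_left {r p q} k X kX Y hk hX := by
    rw [LinearMap.mk₂_apply, LinearMap.mk₂_apply, nabla.smul_left k X kX Y hk hX, hX, mul_sub,
      one_smul]
  smul_right {r p q} k X Y kY hk hY := by
    -- The term `X(k) · Y f` occurs in the Leibniz rules of both `X` and `∇_X` and cancels, which
    -- makes the Hessian tensorial in `Y`.
    have h1 : X.1 (k * Y.1 f) = X.1 k * Y.1 f + koszul p r • (k * X.1 (Y.1 f)) := X.2.2 r k hk _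
    rw [LinearMap.mk₂_apply, LinearMap.mk₂_apply, nabla.leibniz k X Y kY hk hY, hY, h1, mul_sub,
      smul_sub, add_sub_add_left_eq_sub]

theorem hessForm_val (nabla : Connection 𝒜) (f : A) {p q : ZMod 2} (X : der 𝒜 p) (Y : der 𝒜 q) :
    (hessForm nabla f).val X Y = X.1 (Y.1 f) - (nabla.nabla X Y).1 f := rfl

/-- Since `φ χ = 1`, replacing `X` and `Y` by `χ X` and `χ Y` does not change the value under `φ`.
These have global expansions in the `D c`, to which bilinearity applies. -/
theorem SuperForm.map_val_eq_sum {C : Type*} [CommRing C] [Algebra ℝ C]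
    (h𝒜 : IsSupercommutative 𝒜) (H : SuperForm 𝒜 σ₁ σ₂) (φ : A →ₐ[ℝ] C) {χ : A}
    (hχ : χ ∈ 𝒜 0) (hφ : φ χ = 1) {ι : Type*} [Fintype ι] {par : ι → ZMod 2}
    (D : ∀ c, der 𝒜 (par c)) {p q : ZMod 2} (X : der 𝒜 p) (Y : der 𝒜 q) {a b : ι → A}
    (ha : ∀ c, a c ∈ 𝒜 (p + par c)) (hb : ∀ c, b c ∈ 𝒜 (q + par c))
    (hX : ∀ f, χ * X.1 f = ∑ c, a c * (D c).1 f) (hY : ∀ f, χ * Y.1 f = ∑ c, b c * (D c).1 f) :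
    φ (H.val X Y) = ∑ c, ∑ d, (σ₁ (p + par c) * σ₂ (par c) (q + par d)) •
      (φ (a c) * φ (b d) * φ (H.val (D c) (D d))) := by
  have h0 : ∀ p q : ZMod 2, p = p + q + q := fun p q => by
    rw [add_assoc, parity_add_self, add_zero]
  have e1 : φ (H.val (smulDer h𝒜 χ hχ X (zero_add p).symm)
      (smulDer h𝒜 χ hχ Y (zero_add q).symm)) = φ (H.val X Y) := by
    rw [H.val_smul_left, H.val_smul_right, H.left_zero, H.right_zero, one_smul, one_smul, map_mul,
      map_mul, hφ, one_mul, one_mul]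
  have e2 : smulDer h𝒜 χ hχ X (zero_add p).symm =
      ∑ c, smulDer h𝒜 (a c) (ha c) (D c) (h0 p (par c)) := by
    refine Subtype.ext (LinearMap.ext fun f => ?_)
    rw [AddSubmonoidClass.coe_finsetSum, LinearMap.sum_apply]
    exact hX f
  have e3 : smulDer h𝒜 χ hχ Y (zero_add q).symm =
      ∑ c, smulDer h𝒜 (b c) (hb c) (D c) (h0 q (par c)) := by
    refine Subtype.ext (LinearMap.ext fun f => ?_)
    rw [AddSubmonoidClass.coe_finsetSum, LinearMap.sum_apply]
    exact hY f
  rw [← e1, e2, e3, map_sum (H.val (p := p) (q := q)), LinearMap.sum_apply, map_sum]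
  refine Finset.sum_congr rfl fun c _ => ?_
  rw [map_sum, map_sum]
  refine Finset.sum_congr rfl fun d _ => ?_
  rw [H.val_smul_left, H.val_smul_right]
  simp only [map_smul, map_mul, mul_smul_comm, smul_smul, mul_assoc]

theorem SuperForm.map_val_eq_sum_of_cutoff {C : Type*} [CommRing C] [Algebra ℝ C]
    (h𝒜 : IsSupercommutative 𝒜) (H : SuperForm 𝒜 σ₁ σ₂) (φ : A →ₐ[ℝ] C)
    {ι : Type*} [Fintype ι] {par : ι → ZMod 2}
    (D : ∀ c, der 𝒜 (par c)) {z : ι → A} (hz : ∀ c, z c ∈ 𝒜 (par c))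
    (h : ∃ χ ∈ 𝒜 0, φ χ = 1 ∧ ∀ (p : ZMod 2) (X : der 𝒜 p) (f),
      χ * X.1 f = ∑ c, χ * X.1 (z c) * (D c).1 f) {p q : ZMod 2} (X : der 𝒜 p) (Y : der 𝒜 q) :
    φ (H.val X Y) = ∑ c, ∑ d, (σ₁ (p + par c) * σ₂ (par c) (q + par d)) •
      (φ (X.1 (z c)) * φ (Y.1 (z d)) * φ (H.val (D c) (D d))) := by
  obtain ⟨χ, hχ, hφ, h⟩ := h
  have hp : ∀ {p : ZMod 2} (X : der 𝒜 p) (c : ι), χ * X.1 (z c) ∈ 𝒜 (p + par c) := fun {p} X c => by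
    have := h𝒜.mul_mem hχ (X.2.1 _ _ (hz c))
    rwa [zero_add] at this
  have h := H.map_val_eq_sum h𝒜 φ hχ hφ D X Y (hp X) (hp Y) (h p X) (h q Y)
  simpa only [map_mul, hφ, one_mul] using h

end

/-! ### Descent of bilinear operations to the tangent bundle of `E`. -/

noncomputable section

variable {B F : Type*} [NormedAddCommGroup B] [NormedSpace ℝ B] [FiniteDimensional ℝ B]
  [NormedAddCommGroup F] [NormedSpace ℝ F] [FiniteDimensional ℝ F]
  {M : Type*} [TopologicalSpace M] [T2Space M] [ChartedSpace B M] [IsManifold 𝓘(ℝ, B) ∞ M]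
  {E : M → Type*} [∀ x, AddCommGroup (E x)] [∀ x, Module ℝ (E x)]
  [TopologicalSpace (TotalSpace F E)] [∀ x, TopologicalSpace (E x)] [FiberBundle F E]
  [VectorBundle ℝ F E] [ContMDiffVectorBundle ∞ F E 𝓘(ℝ, B)]
  {σ₁ : ZMod 2 → ℝ} {σ₂ : ZMod 2 → ZMod 2 → ℝ}
  {x₀ : M} (fr : Frame B F E x₀)

/-- The evaluation of superfunctions at a point of `M`. -/
def evPoint (x : M) : superFun B F E →ₐ[ℝ] ExteriorAlgebra ℝ (Module.Dual ℝ (E x)) :=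
  (Pi.evalAlgHom ℝ _ x).comp (superFun B F E).val

theorem der_apply_eq_sum {p : ZMod 2} (X : der (parity B F E) p) {x : M} (hx : x ∈ fr.dom)
    (f : superFun B F E) :
    (X.1 f).1 x = ∑ c, (X.1 (fr.z c)).1 x * ((fr.D c).1 f).1 x := by
  have h1 : IsPoint (evPoint x : superFun B F E →ₐ[ℝ] _) x := fun c hc => rfl
  have h2 : IsLeibniz (evPoint x) p ((evPoint x : superFun B F E →ₐ[ℝ] _).toLinearMap ∘ₗ X.1) := by
    intro q f hf g
    have h3 : X.1 (f * g) = X.1 f * g + koszul p q • (f * X.1 g) := X.2.2 q f hf g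
    change evPoint x (X.1 (f * g)) = evPoint x (X.1 f) * evPoint x g +
      koszul p q • (evPoint x f * evPoint x (X.1 g))
    rw [h3, map_add, map_mul, map_smul, map_mul]
  exact h2.eq_sum h1 fr hx (fun c q f hf =>
    ExteriorAlgebra.mul_eq_koszul_smul_mul (X.2.1 _ _ (fr.z_mem c) x) (hf x)) f

theorem isSupercommutative_parity : IsSupercommutative (parity B F E) :=
  ⟨fun hf hg => mul_mem_parity hf hg, fun hf hg => superFun_mul_comm hf hg⟩

theorem sum_apply_superFun {ι : Type*} [Fintype ι] (a : ι → superFun B F E) (x : M) :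
    (∑ c, a c).1 x = ∑ c, (a c).1 x := by
  rw [AddSubmonoidClass.coe_finsetSum, Finset.sum_apply]

theorem superFun_coe_mul (f g : superFun B F E) (x : M) : (f * g).1 x = f.1 x * g.1 x := rfl

/-- Expansion of a superderivation in coordinates, with a cut-off. -/
theorem fn_mul_der_eq_sum {p : ZMod 2} (X : der (parity B F E) p) {χ : M → ℝ} (hχ)
    (hχd : tsupport χ ⊆ fr.dom) (f : superFun B F E) :
    fn χ hχ * X.1 f = ∑ c, fn χ hχ * X.1 (fr.z c) * (fr.D c).1 f := by
  refine Subtype.ext (funext fun x => ?_)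
  rw [sum_apply_superFun]
  simp only [superFun_coe_mul]
  by_cases hx : x ∈ tsupport χ
  · rw [der_apply_eq_sum fr X (hχd hx), Finset.mul_sum]
    simp only [mul_assoc]
  · have h0 : (fn χ hχ : superFun B F E).1 x = 0 := by
      change algebraMap ℝ _ (χ x) = 0
      rw [image_eq_zero_of_notMem_tsupport hx, map_zero]
    simp only [h0, zero_mul, Finset.sum_const_zero]

theorem exists_cutoff {v : TotalSpace F E} (hv : v.1 ∈ fr.dom) :
    ∃ χ ∈ parity B F E 0, evAt v χ = 1 ∧ ∀ (p : ZMod 2) (X : der (parity B F E) p) (f),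
      χ * X.1 f = ∑ c, χ * X.1 (fr.z c) * (fr.D c).1 f := by
  obtain ⟨χ, hχ, h1, h2⟩ := exists_contMDiff_bump (B := B) (fr.isOpen_dom.mem_nhds hv)
  refine ⟨fn χ hχ, fn_mem_parity χ hχ, ?_, fun p X f => fn_mul_der_eq_sum fr X hχ h2 f⟩
  rw [evAt_fn, h1.self_of_nhds, map_one]

theorem evAt_val_eq_sum (H : SuperForm (parity B F E) σ₁ σ₂) {p q : ZMod 2}
    (X : der (parity B F E) p) (Y : der (parity B F E) q) {v : TotalSpace F E}
    (hv : v.1 ∈ fr.dom) :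
    evAt v (H.val X Y) = ∑ c, ∑ d, (σ₁ (p + par c) * σ₂ (par c) (q + par d)) •
      (evAt v (X.1 (fr.z c)) * evAt v (Y.1 (fr.z d)) * evAt v (H.val (fr.D c) (fr.D d))) := by
  have h1 : IsSupercommutative (parity B F E) := isSupercommutative_parity
  have h2 := exists_cutoff fr hv
  exact H.map_val_eq_sum_of_cutoff h1 (evAt v) fr.D fr.z_mem h2 X Y

/-- The sign check that makes the descent to `E` possible. In each combination of parities either
the signs on the two sides agree or both sides vanish, by `τ² = 0` or because a homogeneous factor
has no component left. -/
theorem tot_eps_mul_tot_eps (h1 : σ₁ 0 = 1) (h2 : ∀ p, σ₂ p 0 = 1) (p q c d : ZMod 2)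
    {a b : DualNumber ℝ} (ha : a ∈ dualParity (p + c)) (hb : b ∈ dualParity (q + d))
    (k : DualNumber ℝ) :
    tot (eps p * a) * tot (eps q * b) * (σ₁ c * σ₂ 0 d * tot (eps c * eps d * k)) =
      σ₁ p * σ₂ 0 q * (σ₁ (p + c) * σ₂ c (q + d) * tot (eps p * eps q * (a * b * k))) := by
  have h11 : (1 : ZMod 2) + 1 = 0 := parity_add_self 1
  rcases parity_cases p with rfl | rfl <;> rcases parity_cases q with rfl | rfl <;>
  rcases parity_cases c with rfl | rfl <;> rcases parity_cases d with rfl | rfl <;>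
  simp only [zero_add, add_zero, h11, mem_dualParity_zero, mem_dualParity_one] at ha hb <;>
  simp [tot_apply, ha, hb, h1, h2, h11] <;> ring

theorem sum_tot_eps {ι : Type*} [Fintype ι] {par : ι → ZMod 2} (h1 : σ₁ 0 = 1)
    (h2 : ∀ p, σ₂ p 0 = 1) {p q : ZMod 2} {a b : ι → DualNumber ℝ}
    (ha : ∀ c, a c ∈ dualParity (p + par c)) (hb : ∀ c, b c ∈ dualParity (q + par c))
    {k : ι → ι → DualNumber ℝ} {r : DualNumber ℝ}
    (hr : r = ∑ c, ∑ d, (σ₁ (p + par c) * σ₂ (par c) (q + par d)) • (a c * b d * k c d)) :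
    ∑ c, ∑ d, tot (eps p * a c) * tot (eps q * b d) *
      (σ₁ (par c) * σ₂ 0 (par d) * tot (eps (par c) * eps (par d) * k c d)) =
      σ₁ p * σ₂ 0 q * tot (eps p * eps q * r) := by
  rw [hr, Finset.mul_sum, map_sum, Finset.mul_sum]
  refine Finset.sum_congr rfl fun c _ => ?_
  rw [Finset.mul_sum, map_sum, Finset.mul_sum]
  refine Finset.sum_congr rfl fun d _ => ?_
  rw [tot_eps_mul_tot_eps h1 h2 p q (par c) (par d) (ha c) (hb d), mul_smul_comm, map_smul,
    smul_eq_mul]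

/-- The coefficients of the bilinear form on `E`. -/
def SuperForm.coeff (H : SuperForm (parity B F E) σ₁ σ₂) (c d : Idx B F) (v : TotalSpace F E) : ℝ :=
  σ₁ (par c) * σ₂ 0 (par d) * tot (eps (par c) * eps (par d) * evAt v (H.val (fr.D c) (fr.D d)))

/-- The bilinear form on the tangent space of `E` in coordinates. -/
def SuperForm.formIn (H : SuperForm (parity B F E) σ₁ σ₂) (v : TotalSpace F E) :
    TangentSpace (𝓘(ℝ, B).prod 𝓘(ℝ, F)) v →L[ℝ] TangentSpace (𝓘(ℝ, B).prod 𝓘(ℝ, F)) v →L[ℝ] ℝ :=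
  ∑ c, ∑ d, (mvfderiv (𝓘(ℝ, B).prod 𝓘(ℝ, F)) (affinePart (fr.z c)) v).smulRight
    (H.coeff fr c d v • mvfderiv (𝓘(ℝ, B).prod 𝓘(ℝ, F)) (affinePart (fr.z d)) v)

theorem SuperForm.formIn_apply (H : SuperForm (parity B F E) σ₁ σ₂) {v : TotalSpace F E}
    (w w' : TangentSpace (𝓘(ℝ, B).prod 𝓘(ℝ, F)) v) : H.formIn fr v w w' =
      ∑ c, ∑ d, mvfderiv (𝓘(ℝ, B).prod 𝓘(ℝ, F)) (affinePart (fr.z c)) v w *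
        mvfderiv (𝓘(ℝ, B).prod 𝓘(ℝ, F)) (affinePart (fr.z d)) v w' * H.coeff fr c d v := by
  simp only [SuperForm.formIn, _root_.sum_apply]
  refine Finset.sum_congr rfl fun c _ => Finset.sum_congr rfl fun d _ => ?_
  rw [ContinuousLinearMap.smulRight_apply, _root_.smul_apply,
    _root_.smul_apply]
  simp only [smul_eq_mul]
  ring

/-- Expanding `X` and `Y` in the frame, the right side no longer refers to it. This is the link
between `H` and the geometry of `E`. -/
theorem SuperForm.formIn_tanVec (H : SuperForm (parity B F E) σ₁ σ₂) {p q : ZMod 2}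
    (X : der (parity B F E) p) (Y : der (parity B F E) q) {v : TotalSpace F E}
    (hv : v.1 ∈ fr.dom) :
    H.formIn fr v (tanVec X v) (tanVec Y v) =
      σ₁ p * σ₂ 0 q * tot (eps p * eps q * evAt v (H.val X Y)) := by
  have hX := fun c => evAt_mem_dualParity v (X.2.1 _ _ (fr.z_mem c))
  have hY := fun c => evAt_mem_dualParity v (Y.2.1 _ _ (fr.z_mem c))
  have hs := evAt_val_eq_sum fr H X Y hv
  rw [H.formIn_apply]
  simp only [mvfderiv_tanVec, SuperForm.coeff]
  exact sum_tot_eps H.left_zero H.right_zero hX hY hs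

/-- The bilinear form on `E` given by a bilinear operation on superderivations. -/
def SuperForm.form (H : SuperForm (parity B F E) σ₁ σ₂) (v : TotalSpace F E) :
    TangentSpace (𝓘(ℝ, B).prod 𝓘(ℝ, F)) v →L[ℝ] TangentSpace (𝓘(ℝ, B).prod 𝓘(ℝ, F)) v →L[ℝ] ℝ := H.formIn (frameAt v.1) v

theorem SuperForm.form_tanVec (H : SuperForm (parity B F E) σ₁ σ₂) {p q : ZMod 2}
    (X : der (parity B F E) p) (Y : der (parity B F E) q) (v : TotalSpace F E) :
    H.form v (tanVec X v) (tanVec Y v) =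
      σ₁ p * σ₂ 0 q * tot (eps p * eps q * evAt v (H.val X Y)) :=
  H.formIn_tanVec _ X Y (frameAt v.1).mem_dom

/-- Bilinear forms coincide if they do so on the coordinate vector fields. -/
theorem bilin_ext {v : TotalSpace F E} (hv : v.1 ∈ fr.dom)
    {h h' : TangentSpace (𝓘(ℝ, B).prod 𝓘(ℝ, F)) v →L[ℝ] TangentSpace (𝓘(ℝ, B).prod 𝓘(ℝ, F)) v →L[ℝ] ℝ}
    (H : ∀ c d, h (bas fr c v) (bas fr d v) = h' (bas fr c v) (bas fr d v)) : h = h' := by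
  ext w w'
  rw [eq_sum_bas fr hv w, eq_sum_bas fr hv w']
  simp only [map_sum, map_smul, _root_.sum_apply, _root_.smul_apply, H]

theorem contMDiff_tot_eps (p : ZMod 2) (f : superFun B F E) :
    ContMDiff (𝓘(ℝ, B).prod 𝓘(ℝ, F)) 𝓘(ℝ, ℝ) ∞ (fun v : TotalSpace F E => tot (eps p * evAt v f)) := by
  rcases parity_cases p with rfl | rfl
  · simp only [eps_zero, one_mul, ← affinePart_eq_tot]
    exact contMDiff_affinePart f
  · simp only [tot_eps_one_mul, fst_evAt]
    exact (contMDiff_body f).comp (contMDiff_proj E)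

theorem SuperForm.contMDiff_coeff (H : SuperForm (parity B F E) σ₁ σ₂) (c d : Idx B F) :
    ContMDiff (𝓘(ℝ, B).prod 𝓘(ℝ, F)) 𝓘(ℝ, ℝ) ∞ (H.coeff fr c d) := by
  unfold SuperForm.coeff
  refine contMDiff_const.mul ?_
  by_cases h : par c = 1 ∧ par d = 1
  · have h0 : (DualNumber.eps * DualNumber.eps : DualNumber ℝ) = 0 := DualNumber.eps_mul_eps
    simp only [h.1, h.2, eps_one, h0, zero_mul, map_zero]
    exact contMDiff_const
  · simp only [eps_mul_eps h]
    exact contMDiff_tot_eps _ _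

/-- The values on the fields `tanVec (fr.D c)` do not depend on the frame used, and these fields
form a basis. So `form`, whose frame varies with the point, is locally given by one frame, and this
yields its smoothness. -/
theorem SuperForm.form_eq_formIn (H : SuperForm (parity B F E) σ₁ σ₂) {v : TotalSpace F E}
    (hv : v.1 ∈ fr.dom) : H.form v = H.formIn fr v := by
  refine bilin_ext fr hv fun c d => ?_
  rw [bas_eq_tanVec fr hv, bas_eq_tanVec fr hv, H.form_tanVec, H.formIn_tanVec fr _ _ hv]

theorem SuperForm.contMDiff_form (H : SuperForm (parity B F E) σ₁ σ₂) :
    ContMDiff (𝓘(ℝ, B).prod 𝓘(ℝ, F)) ((𝓘(ℝ, B).prod 𝓘(ℝ, F)).prod 𝓘(ℝ, (B × F) →L[ℝ] (B × F) →L[ℝ] ℝ)) ∞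
      (fun v => TotalSpace.mk' ((B × F) →L[ℝ] (B × F) →L[ℝ] ℝ) (E := fun v : TotalSpace F E =>
        TangentSpace (𝓘(ℝ, B).prod 𝓘(ℝ, F)) v →L[ℝ] TangentSpace (𝓘(ℝ, B).prod 𝓘(ℝ, F)) v →L[ℝ] ℝ) v (H.form v)) := by
  intro v
  set fr := frameAt (B := B) (F := F) (E := E) v.1
  have hv : v.1 ∈ fr.dom := (frameAt v.1).mem_dom
  have hdz : ∀ (c i : Idx B F), ContMDiffAt (𝓘(ℝ, B).prod 𝓘(ℝ, F)) 𝓘(ℝ, ℝ) ∞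
      (fun u : TotalSpace F E => mvfderiv (𝓘(ℝ, B).prod 𝓘(ℝ, F)) (affinePart (fr.z c)) u
        ((trivializationAt (B × F) (TangentSpace (𝓘(ℝ, B).prod 𝓘(ℝ, F)) : TotalSpace F E → Type _) v).localFrame
          ((Module.finBasis ℝ B).prod (Module.finBasis ℝ F)) i u)) v := fun c i =>
    (contMDiff_affinePart (fr.z c)).contMDiffAt.mvfderiv_apply
      (contMDiffAt_localFrame_of_mem (I := (𝓘(ℝ, B).prod 𝓘(ℝ, F))) ∞ _ _ i
        (FiberBundle.mem_baseSet_trivializationAt' v))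
  refine contMDiffAt_hom_of_localFrame ((Module.finBasis ℝ B).prod (Module.finBasis ℝ F))
    fun i => ?_
  refine contMDiffAt_hom_of_localFrame (E₂ := Bundle.Trivial (TotalSpace F E) ℝ)
    ((Module.finBasis ℝ B).prod (Module.finBasis ℝ F)) fun j => ?_
  refine contMDiffAt_totalSpace.2 ⟨contMDiffAt_id, ?_⟩
  have h : ContMDiffAt (𝓘(ℝ, B).prod 𝓘(ℝ, F)) 𝓘(ℝ, ℝ) ∞ (fun u : TotalSpace F E => ∑ c, ∑ d,
      mvfderiv (𝓘(ℝ, B).prod 𝓘(ℝ, F)) (affinePart (fr.z c)) u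
        ((trivializationAt (B × F) (TangentSpace (𝓘(ℝ, B).prod 𝓘(ℝ, F)) : TotalSpace F E → Type _) v).localFrame
          ((Module.finBasis ℝ B).prod (Module.finBasis ℝ F)) i u) *
      mvfderiv (𝓘(ℝ, B).prod 𝓘(ℝ, F)) (affinePart (fr.z d)) u
        ((trivializationAt (B × F) (TangentSpace (𝓘(ℝ, B).prod 𝓘(ℝ, F)) : TotalSpace F E → Type _) v).localFrame
          ((Module.finBasis ℝ B).prod (Module.finBasis ℝ F)) j u) * H.coeff fr c d u) v :=
    contMDiffAt_finsetSum fun c _ => contMDiffAt_finsetSum fun d _ =>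
      ((hdz c i).mul (hdz d j)).mul (H.contMDiff_coeff fr c d).contMDiffAt
  refine h.congr_of_eventuallyEq ?_
  filter_upwards [(fr.isOpen_dom.preimage (FiberBundle.continuous_proj F E)).mem_nhds hv] with u hu
  rw [← H.formIn_apply fr, ← H.form_eq_formIn fr hu]
  rfl

end

end BatchelorModel

/-! ### The connection on `E` -/

section

variable {V : Type*} [NormedAddCommGroup V] [NormedSpace ℝ V]
  {H : Type*} [TopologicalSpace H] {I : ModelWithCorners ℝ V H}
  {N : Type*} [TopologicalSpace N] [ChartedSpace H N]

theorem mvfderiv_sum_mul {ι : Type*} [Fintype ι] {f g : ι → N → ℝ} {x : N}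
    (hf : ∀ i, MDifferentiableAt I 𝓘(ℝ, ℝ) (f i) x) (hg : ∀ i, MDifferentiableAt I 𝓘(ℝ, ℝ) (g i) x)
    (v : TangentSpace I x) : mvfderiv I (fun y => ∑ i, f i y * g i y) x v =
      ∑ i, (mvfderiv I (f i) x v * g i x + f i x * mvfderiv I (g i) x v) := by
  have h := mvfderiv_sum_smul (I := I) (r := fun i y => f i y * g i y) (fun _ => (1 : ℝ))
    (fun i => (hf i).mul (hg i)) v
  simp only [smul_eq_mul, mul_one] at h
  rw [h]
  refine Finset.sum_congr rfl fun i _ => ?_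
  rw [mvfderiv_fun_mul (hf i) (hg i)]
  simp only [_root_.add_apply, _root_.smul_apply, smul_eq_mul]
  ring

end

namespace BatchelorModel

open SuperAlg

noncomputable section

variable {B F : Type*} [NormedAddCommGroup B] [NormedSpace ℝ B] [FiniteDimensional ℝ B]
  [NormedAddCommGroup F] [NormedSpace ℝ F] [FiniteDimensional ℝ F]
  {M : Type*} [TopologicalSpace M] [T2Space M] [ChartedSpace B M] [IsManifold 𝓘(ℝ, B) ∞ M]
  {E : M → Type*} [∀ x, AddCommGroup (E x)] [∀ x, Module ℝ (E x)]
  [TopologicalSpace (TotalSpace F E)] [∀ x, TopologicalSpace (E x)] [FiberBundle F E]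
  [VectorBundle ℝ F E] [ContMDiffVectorBundle ∞ F E 𝓘(ℝ, B)]
  {σ₁ : ZMod 2 → ℝ} {σ₂ : ZMod 2 → ZMod 2 → ℝ}
  {x₀ : M} (fr : Frame B F E x₀) {v : TotalSpace F E}

theorem eventually_mem_dom (hv : v.1 ∈ fr.dom) : ∀ᶠ u : TotalSpace F E in 𝓝 v, u.1 ∈ fr.dom :=
  (fr.isOpen_dom.preimage (FiberBundle.continuous_proj F E)).mem_nhds hv

theorem contMDiffAt_form_apply (H : SuperForm (parity B F E) σ₁ σ₂)
    {X Y : ∀ u : TotalSpace F E, TangentSpace (𝓘(ℝ, B).prod 𝓘(ℝ, F)) u}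
    (hX : ContMDiffAt (𝓘(ℝ, B).prod 𝓘(ℝ, F)) (𝓘(ℝ, B).prod 𝓘(ℝ, F)).tangent ∞
      (fun u => (⟨u, X u⟩ : TangentBundle (𝓘(ℝ, B).prod 𝓘(ℝ, F)) (TotalSpace F E))) v)
    (hY : ContMDiffAt (𝓘(ℝ, B).prod 𝓘(ℝ, F)) (𝓘(ℝ, B).prod 𝓘(ℝ, F)).tangent ∞
      (fun u => (⟨u, Y u⟩ : TangentBundle (𝓘(ℝ, B).prod 𝓘(ℝ, F)) (TotalSpace F E))) v) :
    ContMDiffAt (𝓘(ℝ, B).prod 𝓘(ℝ, F)) 𝓘(ℝ, ℝ) ∞ (fun u => H.form u (X u) (Y u)) v := by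
  have h : ContMDiffAt (𝓘(ℝ, B).prod 𝓘(ℝ, F)) 𝓘(ℝ, ℝ) ∞ (fun u : TotalSpace F E => ∑ c, ∑ d,
      mvfderiv (𝓘(ℝ, B).prod 𝓘(ℝ, F)) (affinePart ((frameAt v.1).z c)) u (X u) *
      mvfderiv (𝓘(ℝ, B).prod 𝓘(ℝ, F)) (affinePart ((frameAt v.1).z d)) u (Y u) *
        H.coeff (frameAt v.1) c d u) v :=
    contMDiffAt_finsetSum fun c _ => contMDiffAt_finsetSum fun d _ =>
      (((contMDiff_affinePart _).contMDiffAt.mvfderiv_apply hX).mul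
        ((contMDiff_affinePart _).contMDiffAt.mvfderiv_apply hY)).mul
          (H.contMDiff_coeff _ c d).contMDiffAt
  refine h.congr_of_eventuallyEq ?_
  filter_upwards [eventually_mem_dom (frameAt (B := B) (F := F) (E := E) v.1)
    (frameAt v.1).mem_dom] with u hu
  rw [← H.formIn_apply (frameAt v.1), ← H.form_eq_formIn _ hu]

/-- The derivative of the function on `E` given by `f` in the direction of a coordinate. -/
def pd (c : Idx B F) (f : superFun B F E) (v : TotalSpace F E) : ℝ :=
  tot (eps (par c) * evAt v ((fr.D c).1 f))

theorem mvfderiv_tot_eps (p : ZMod 2) (f : superFun B F E) (w : TangentSpace (𝓘(ℝ, B).prod 𝓘(ℝ, F)) v) :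
    mvfderiv (𝓘(ℝ, B).prod 𝓘(ℝ, F)) (fun u : TotalSpace F E => tot (eps p * evAt u f)) v w =
      tot (eps p * vecAt v w f) := by
  rcases parity_cases p with rfl | rfl
  · simp only [eps_zero, one_mul, ← affinePart_eq_tot, tot_vecAt]
  · simp only [tot_eps_one_mul, fst_evAt, fst_vecAt]

theorem mdifferentiableAt_pd (c : Idx B F) (f : superFun B F E) :
    MDifferentiableAt (𝓘(ℝ, B).prod 𝓘(ℝ, F)) 𝓘(ℝ, ℝ) (pd fr c f) v :=
  (contMDiff_tot_eps _ _).contMDiffAt.mdifferentiableAt (by simp)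

theorem mvfderiv_affinePart_eq_sum (hv : v.1 ∈ fr.dom) (f : superFun B F E)
    (w : TangentSpace (𝓘(ℝ, B).prod 𝓘(ℝ, F)) v) : mvfderiv (𝓘(ℝ, B).prod 𝓘(ℝ, F)) (affinePart f) v w =
      ∑ c, mvfderiv (𝓘(ℝ, B).prod 𝓘(ℝ, F)) (affinePart (fr.z c)) v w * pd fr c f v := by
  conv_lhs => rw [eq_sum_bas fr hv w]
  simp only [map_sum, map_smul, smul_eq_mul]
  refine Finset.sum_congr rfl fun c _ => ?_
  rw [bas_eq_tanVec fr hv, mvfderiv_tanVec (fr.D c) v f]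
  rfl

theorem isLeibniz_comp {C : Type*} [Ring C] [Algebra ℝ C] (φ : superFun B F E →ₐ[ℝ] C) {p : ZMod 2}
    (X : der (parity B F E) p) : IsLeibniz φ p (φ.toLinearMap ∘ₗ X.1) := by
  intro q f hf g
  have h : X.1 (f * g) = X.1 f * g + koszul p q • (f * X.1 g) := X.2.2 q f hf g
  change φ (X.1 (f * g)) = φ (X.1 f) * φ g + koszul p q • (φ f * φ (X.1 g))
  rw [h, map_add, map_mul, map_smul, map_mul]

theorem evAt_D_D_z (hv : v.1 ∈ fr.dom) (b d c : Idx B F) :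
    evAt v ((fr.D b).1 ((fr.D d).1 (fr.z c))) = 0 := by
  have h := isLeibniz_comp (evAt v) (fr.D b)
  have h1 : ∀ᶠ y in 𝓝 v.1, ((fr.D d).1 (fr.z c)).1 y =
      (if d = c then 1 else 0 : superFun B F E).1 y := by
    filter_upwards [fr.isOpen_dom.mem_nhds hv] with y hy
    rw [fr.D_z d c y hy]
    split_ifs <;> rfl
  refine (h.congr (isPoint_evAt v) h1).trans ?_
  split_ifs
  · exact h.map_one_eq_zero
  · exact map_zero _

theorem tot_mul_map_hessForm {A : Type*} [Ring A] [Algebra ℝ A] {𝒜 : ZMod 2 → Submodule ℝ A}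
    (φ : A →ₐ[ℝ] DualNumber ℝ) (a : DualNumber ℝ) (nabla : Connection 𝒜) (f : A) {p q : ZMod 2}
    (X : der 𝒜 p) (Y : der 𝒜 q) : 1 * koszul 0 q * tot (a * φ ((hessForm nabla f).val X Y)) =
      tot (a * φ (X.1 (Y.1 f))) - tot (a * φ ((nabla.nabla X Y).1 f)) := by
  rw [hessForm_val, map_sub, mul_sub, map_sub, koszul_zero_left, one_mul, one_mul]

theorem hessForm_form_tanVec (nabla : Connection (parity B F E)) (f : superFun B F E) {p q : ZMod 2}
    (X : der (parity B F E) p) (Y : der (parity B F E) q) (v : TotalSpace F E) :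
    (hessForm nabla f).form v (tanVec X v) (tanVec Y v) =
      tot (eps p * eps q * evAt v (X.1 (Y.1 f))) -
        tot (eps p * eps q * evAt v ((nabla.nabla X Y).1 f)) := by
  have h := (hessForm nabla f).form_tanVec X Y v
  exact h.trans (tot_mul_map_hessForm (evAt v) _ nabla f X Y)

theorem hessForm_form_bas (nabla : Connection (parity B F E)) (hv : v.1 ∈ fr.dom)
    (f : superFun B F E) (b d : Idx B F) :
    (hessForm nabla f).form v (bas fr b v) (bas fr d v) =
      tot (eps (par b) * eps (par d) * evAt v ((fr.D b).1 ((fr.D d).1 f))) -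
        tot (eps (par b) * eps (par d) * evAt v ((nabla.nabla (fr.D b) (fr.D d)).1 f)) :=
  (congrArg₂ (fun w y => (hessForm nabla f).form v w y) (bas_eq_tanVec fr hv b)
    (bas_eq_tanVec fr hv d)).trans (hessForm_form_tanVec nabla f _ _ v)

theorem mvfderiv_pd_bas (hv : v.1 ∈ fr.dom) (f : superFun B F E) (b d : Idx B F) :
    mvfderiv (𝓘(ℝ, B).prod 𝓘(ℝ, F)) (pd fr d f) v (bas fr b v) =
      tot (eps (par b) * eps (par d) * evAt v ((fr.D b).1 ((fr.D d).1 f))) := by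
  refine (mvfderiv_tot_eps (par d) ((fr.D d).1 f) (bas fr b v)).trans ?_
  have h := vecAt_tanVec (fr.D b) v ((fr.D d).1 f)
  simp only [bas_eq_tanVec fr hv, h]
  ring_nf

/-- For two odd indices both sides vanish. Otherwise the two factors combine to `eps (p + q)`, and
the identity is the chain rule for the tangent vector of `X`. -/
theorem tot_nabla_eq_sum {p q : ZMod 2} (hv : v.1 ∈ fr.dom) (X : der (parity B F E) (p + q))
    (f : superFun B F E) : tot (eps p * eps q * evAt v (X.1 f)) =
      ∑ c, pd fr c f v * tot (eps p * eps q * evAt v (X.1 (fr.z c))) := by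
  by_cases h : p = 1 ∧ q = 1
  · obtain ⟨rfl, rfl⟩ := h
    have h0 : (DualNumber.eps * DualNumber.eps : DualNumber ℝ) = 0 := DualNumber.eps_mul_eps
    simp only [eps_one, h0, zero_mul, map_zero, mul_zero, Finset.sum_const_zero]
  · have h1 := mvfderiv_affinePart_eq_sum fr hv f (tanVec X v)
    simp only [mvfderiv_tanVec, ← eps_mul_eps h] at h1
    simpa only [mul_comm (pd fr _ _ _)] using h1

/-- The second derivatives of a superfunction in terms of the Hessians. -/
theorem sum_smulRight_eq_hess (nabla : Connection (parity B F E)) (hv : v.1 ∈ fr.dom)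
    (f : superFun B F E) :
    ∑ c, (mvfderiv (𝓘(ℝ, B).prod 𝓘(ℝ, F)) (pd fr c f) v).smulRight (mvfderiv (𝓘(ℝ, B).prod 𝓘(ℝ, F)) (affinePart (fr.z c)) v) =
      (hessForm nabla f).form v - ∑ c, pd fr c f v • (hessForm nabla (fr.z c)).form v := by
  -- On coordinate fields the Hessian of a coordinate has no second-derivative part, so its only
  -- contribution is from `∇`; this cancels the `∇` part of the Hessian of `f`.
  refine bilin_ext fr hv fun b d => ?_
  simp only [_root_.sum_apply, _root_.sub_apply, _root_.smul_apply,
    ContinuousLinearMap.smulRight_apply, smul_eq_mul, mvfderiv_z_bas fr hv,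
    hessForm_form_bas fr nabla hv, evAt_D_D_z fr hv, mul_zero, map_zero, zero_sub, mul_neg,
    Finset.sum_neg_distrib, sub_neg_eq_add, mvfderiv_pd_bas fr hv,
    tot_nabla_eq_sum fr hv _ f, mul_ite, mul_one, Finset.sum_ite_eq, Finset.mem_univ, if_true,
    sub_add_cancel]

theorem _root_.MDifferentiableAt.mvfderiv_affinePart {Y : ∀ u : TotalSpace F E, TangentSpace (𝓘(ℝ, B).prod 𝓘(ℝ, F)) u}
    (hY : MDifferentiableAt (𝓘(ℝ, B).prod 𝓘(ℝ, F)) (𝓘(ℝ, B).prod 𝓘(ℝ, F)).tangent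
      (fun u => (⟨u, Y u⟩ : TangentBundle (𝓘(ℝ, B).prod 𝓘(ℝ, F)) (TotalSpace F E))) v) (f : superFun B F E) :
    MDifferentiableAt (𝓘(ℝ, B).prod 𝓘(ℝ, F)) 𝓘(ℝ, ℝ) (fun u => mvfderiv (𝓘(ℝ, B).prod 𝓘(ℝ, F)) (affinePart f) u (Y u)) v := by
  have h1 : ContMDiffAt (𝓘(ℝ, B).prod 𝓘(ℝ, F)) 𝓘(ℝ, (B × F) →L[ℝ] ℝ) ∞ _ v :=
    (contMDiff_affinePart f).contMDiffAt.mfderiv_const (m := ∞) (by simp)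
  have h3 := MDifferentiableAt.clm_apply_of_inCoordinates (b₁ := fun u : TotalSpace F E => u)
    (b₂ := affinePart f)
    (ϕ := fun u => mfderiv (𝓘(ℝ, B).prod 𝓘(ℝ, F)) 𝓘(ℝ, ℝ) (affinePart f) u)
    (E₂ := (TangentSpace 𝓘(ℝ, ℝ) : ℝ → Type _))
    (F₂ := ℝ) (h1.mdifferentiableAt (by simp)) hY (mdifferentiableAt_affinePart f v)
  exact ((contMDiff_snd_tangentBundle_modelSpace (n := 1) ℝ 𝓘(ℝ, ℝ)).contMDiffAt.mdifferentiableAt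
    (by simp)).comp v h3

/-- The form on `E` with its second argument fixed. -/
def SuperForm.flipAt (H : SuperForm (parity B F E) σ₁ σ₂) (y : TangentSpace (𝓘(ℝ, B).prod 𝓘(ℝ, F)) v) :
    TangentSpace (𝓘(ℝ, B).prod 𝓘(ℝ, F)) v →L[ℝ] ℝ :=
  (show (B × F) →L[ℝ] (B × F) →L[ℝ] ℝ from H.form v).flip y

theorem SuperForm.flipAt_apply (H : SuperForm (parity B F E) σ₁ σ₂) (y w : TangentSpace (𝓘(ℝ, B).prod 𝓘(ℝ, F)) v) :
    H.flipAt y w = H.form v w y := rfl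

/-- The covariant derivative of a vector field on `E`. -/
def covAt (nabla : Connection (parity B F E)) (Y : ∀ u : TotalSpace F E, TangentSpace (𝓘(ℝ, B).prod 𝓘(ℝ, F)) u)
    (v : TotalSpace F E) : TangentSpace (𝓘(ℝ, B).prod 𝓘(ℝ, F)) v →L[ℝ] TangentSpace (𝓘(ℝ, B).prod 𝓘(ℝ, F)) v :=
  ∑ c, (mvfderiv (𝓘(ℝ, B).prod 𝓘(ℝ, F)) (fun u => mvfderiv (𝓘(ℝ, B).prod 𝓘(ℝ, F)) (affinePart ((frameAt v.1).z c)) u (Y u)) v -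
    (hessForm nabla ((frameAt v.1).z c)).flipAt (Y v)).smulRight (bas (frameAt v.1) c v)

theorem mvfderiv_z_covAt (nabla : Connection (parity B F E))
    (Y : ∀ u : TotalSpace F E, TangentSpace (𝓘(ℝ, B).prod 𝓘(ℝ, F)) u) (v : TotalSpace F E)
    (w : TangentSpace (𝓘(ℝ, B).prod 𝓘(ℝ, F)) v) (c : Idx B F) :
    mvfderiv (𝓘(ℝ, B).prod 𝓘(ℝ, F)) (affinePart ((frameAt v.1).z c)) v (covAt nabla Y v w) =
      mvfderiv (𝓘(ℝ, B).prod 𝓘(ℝ, F)) (fun u => mvfderiv (𝓘(ℝ, B).prod 𝓘(ℝ, F)) (affinePart ((frameAt v.1).z c)) u (Y u)) v w -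
        (hessForm nabla ((frameAt v.1).z c)).form v w (Y v) := by
  simp only [covAt, _root_.sum_apply, ContinuousLinearMap.smulRight_apply, map_sum, map_smul,
    mvfderiv_z_bas _ (frameAt v.1).mem_dom]
  simp [SuperForm.flipAt_apply]

/-- True for coordinates by construction. For general `f`, differentiating the chain rule produces
second derivatives of `f`, and `sum_smulRight_eq_hess` says that these account for the difference of
the Hessians. The formula is therefore independent of coordinates. -/
theorem mvfderiv_covAt (nabla : Connection (parity B F E))
    {Y : ∀ u : TotalSpace F E, TangentSpace (𝓘(ℝ, B).prod 𝓘(ℝ, F)) u}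
    (hY : MDifferentiableAt (𝓘(ℝ, B).prod 𝓘(ℝ, F)) (𝓘(ℝ, B).prod 𝓘(ℝ, F)).tangent
      (fun u => (⟨u, Y u⟩ : TangentBundle (𝓘(ℝ, B).prod 𝓘(ℝ, F)) (TotalSpace F E))) v)
    (w : TangentSpace (𝓘(ℝ, B).prod 𝓘(ℝ, F)) v) (f : superFun B F E) :
    mvfderiv (𝓘(ℝ, B).prod 𝓘(ℝ, F)) (affinePart f) v (covAt nabla Y v w) =
      mvfderiv (𝓘(ℝ, B).prod 𝓘(ℝ, F)) (fun u => mvfderiv (𝓘(ℝ, B).prod 𝓘(ℝ, F)) (affinePart f) u (Y u)) v w -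
        (hessForm nabla f).form v w (Y v) := by
  have hv := (frameAt (B := B) (F := F) (E := E) v.1).mem_dom
  set fr := frameAt (B := B) (F := F) (E := E) v.1
  have h1 : (fun u => mvfderiv (𝓘(ℝ, B).prod 𝓘(ℝ, F)) (affinePart f) u (Y u)) =ᶠ[𝓝 v] fun u =>
      ∑ c, mvfderiv (𝓘(ℝ, B).prod 𝓘(ℝ, F)) (affinePart (fr.z c)) u (Y u) * pd fr c f u := by
    filter_upwards [eventually_mem_dom fr hv] with u hu
      using mvfderiv_affinePart_eq_sum fr hu f (Y u)
  have h2 := congrArg (fun L => L w (Y v)) (sum_smulRight_eq_hess fr nabla hv f)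
  simp only [_root_.sum_apply, _root_.sub_apply, _root_.smul_apply,
    ContinuousLinearMap.smulRight_apply, smul_eq_mul] at h2
  rw [h1.mvfderiv_eq, mvfderiv_sum_mul (fun c => hY.mvfderiv_affinePart (fr.z c))
    (fun c => mdifferentiableAt_pd fr c f), mvfderiv_affinePart_eq_sum fr hv]
  simp only [fr, mvfderiv_z_covAt]
  simp only [sub_mul, Finset.sum_sub_distrib, Finset.sum_add_distrib]
  simp only [mul_comm (mvfderiv (𝓘(ℝ, B).prod 𝓘(ℝ, F)) (pd fr _ f) v w), mul_comm (pd fr _ f v)] at h2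
  rw [h2]
  ring

/-- The connection on `E` associated to a connection on the supermanifold. -/
def assocConnection (nabla : Connection (parity B F E)) :
    CovariantDerivative (𝓘(ℝ, B).prod 𝓘(ℝ, F)) (B × F) (TangentSpace (𝓘(ℝ, B).prod 𝓘(ℝ, F)) : TotalSpace F E → Type _) where
  toFun := covAt nabla
  isCovariantDerivativeOnUniv := by
    refine ⟨fun {X Y v} hX hY _ => ?_, fun {X g v} hX hg _ => ?_⟩
    · refine ContinuousLinearMap.ext fun w => tangent_ext (frameAt v.1) (frameAt v.1).mem_dom
        fun c => ?_
      have h1 : (fun u => mvfderiv (𝓘(ℝ, B).prod 𝓘(ℝ, F)) (affinePart ((frameAt v.1).z c)) u ((X + Y) u)) =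
          fun u => mvfderiv (𝓘(ℝ, B).prod 𝓘(ℝ, F)) (affinePart ((frameAt v.1).z c)) u (X u) +
            mvfderiv (𝓘(ℝ, B).prod 𝓘(ℝ, F)) (affinePart ((frameAt v.1).z c)) u (Y u) := funext fun u => map_add _ _ _
      rw [_root_.add_apply, map_add, mvfderiv_z_covAt, mvfderiv_z_covAt, mvfderiv_z_covAt, h1,
        mvfderiv_fun_add (hX.mvfderiv_affinePart _) (hY.mvfderiv_affinePart _), Pi.add_apply,
        map_add, _root_.add_apply]
      ring
    · refine ContinuousLinearMap.ext fun w => tangent_ext (frameAt v.1) (frameAt v.1).mem_dom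
        fun c => ?_
      have h1 : (fun u => mvfderiv (𝓘(ℝ, B).prod 𝓘(ℝ, F)) (affinePart ((frameAt v.1).z c)) u ((g • X) u)) =
          fun u => g u * mvfderiv (𝓘(ℝ, B).prod 𝓘(ℝ, F)) (affinePart ((frameAt v.1).z c)) u (X u) :=
        funext fun u => map_smul (mvfderiv (𝓘(ℝ, B).prod 𝓘(ℝ, F)) (affinePart ((frameAt v.1).z c)) u) (g u) (X u)
      rw [_root_.add_apply, _root_.smul_apply, ContinuousLinearMap.smulRight_apply, map_add,
        map_smul, map_smul, mvfderiv_z_covAt, mvfderiv_z_covAt, h1,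
        mvfderiv_fun_mul hg (hX.mvfderiv_affinePart _), Pi.smul_apply', map_smul]
      simp only [_root_.add_apply, _root_.smul_apply, smul_eq_mul]
      ring

theorem assocConnection_apply (nabla : Connection (parity B F E))
    (Y : ∀ u : TotalSpace F E, TangentSpace (𝓘(ℝ, B).prod 𝓘(ℝ, F)) u) (v : TotalSpace F E) :
    assocConnection nabla Y v = covAt nabla Y v := rfl

theorem contMDiffCovariantDerivative_assocConnection (nabla : Connection (parity B F E)) :
    (assocConnection nabla).ContMDiffCovariantDerivative ∞ := by
  refine ⟨⟨fun {Y} hY => ?_⟩⟩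
  rw [contMDiffOn_univ] at hY ⊢
  intro v
  have hv := (frameAt (B := B) (F := F) (E := E) v.1).mem_dom
  refine contMDiffAt_hom_of_localFrame ((Module.finBasis ℝ B).prod (Module.finBasis ℝ F))
    fun i => ?_
  have hL := contMDiffAt_localFrame_of_mem (I := (𝓘(ℝ, B).prod 𝓘(ℝ, F))) ∞
    (trivializationAt (B × F) (TangentSpace (𝓘(ℝ, B).prod 𝓘(ℝ, F)) : TotalSpace F E → Type _) v)
    ((Module.finBasis ℝ B).prod (Module.finBasis ℝ F)) i
    (FiberBundle.mem_baseSet_trivializationAt' v)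
  refine contMDiffAt_sum_smul_bas (frameAt v.1) hv (r := fun c u =>
    mvfderiv (𝓘(ℝ, B).prod 𝓘(ℝ, F)) (affinePart ((frameAt v.1).z c)) u (assocConnection nabla Y u
      ((trivializationAt (B × F) (TangentSpace (𝓘(ℝ, B).prod 𝓘(ℝ, F)) : TotalSpace F E → Type _) v).localFrame
          ((Module.finBasis ℝ B).prod (Module.finBasis ℝ F)) i u))) (fun c => ?_)
    fun u hu => eq_sum_bas _ hu _
  simp only [assocConnection_apply]
  have hYs : ∀ u, ContMDiffAt (𝓘(ℝ, B).prod 𝓘(ℝ, F)) (𝓘(ℝ, B).prod 𝓘(ℝ, F)).tangent ∞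
      (fun u => (⟨u, Y u⟩ : TangentBundle (𝓘(ℝ, B).prod 𝓘(ℝ, F)) (TotalSpace F E))) u := fun u => hY u
  have hYd := fun u => (hYs u).mdifferentiableAt (by simp)
  simp only [fun u => mvfderiv_covAt nabla (hYd u)]
  have h1 : ∀ u, ContMDiffAt (𝓘(ℝ, B).prod 𝓘(ℝ, F)) 𝓘(ℝ, ℝ) ∞ (fun u => mvfderiv (𝓘(ℝ, B).prod 𝓘(ℝ, F))
      (affinePart ((frameAt v.1).z c)) u (Y u)) u := fun u =>
    (contMDiff_affinePart _).contMDiffAt.mvfderiv_apply (hYs u)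
  exact ((h1 v).mvfderiv_apply hL).sub (contMDiffAt_form_apply _ hL (hYs v))

/-- The derivative term is the affine part of `X(Y s)`; subtracting the Hessian leaves that of `(∇_X
Y) s`. -/
theorem mvfderiv_covAt_tanVec (nabla : Connection (parity B F E)) (X Y : der (parity B F E) 0)
    (s : superFun B F E) (v : TotalSpace F E) :
    mvfderiv (𝓘(ℝ, B).prod 𝓘(ℝ, F)) (affinePart s) v (covAt nabla (tanVec Y) v (tanVec X v)) =
      affinePart ((nabla.nabla X Y).1 s) v := by
  have hYd := (isSmoothField_tanVec Y v).mdifferentiableAt (by simp)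
  refine (mvfderiv_covAt nabla hYd (tanVec X v) s).trans ?_
  have h1 := hessForm_form_tanVec nabla s X Y v
  have h2 : (fun u => mvfderiv (𝓘(ℝ, B).prod 𝓘(ℝ, F)) (affinePart s) u (tanVec Y u)) = affinePart (Y.1 s) :=
    funext fun u => mvfderiv_tanVec_even Y u s
  have h3 := mvfderiv_tanVec_even X v (Y.1 s)
  simp only [eps_zero, one_mul, ← affinePart_eq_tot] at h1
  exact (congrArg₂ (fun a b => mvfderiv (𝓘(ℝ, B).prod 𝓘(ℝ, F)) a v (tanVec X v) - b) h2 h1).trans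
    ((congrArg (fun a => a - _) h3).trans (sub_sub_cancel _ _))

theorem isAssociatedConnection_assocConnection (nabla : Connection (parity B F E)) :
    IsAssociatedConnection nabla (assocConnection nabla) := by
  refine ⟨contMDiffCovariantDerivative_assocConnection nabla, ?_⟩
  intro X Y X' Y' _ _ hX hY s _ v
  rw [hX.eq_tanVec, hY.eq_tanVec]
  exact mvfderiv_covAt_tanVec nabla X Y s v

end

end BatchelorModel

/-! ### Uniqueness of the associated objects -/

section

variable {V : Type*} [NormedAddCommGroup V] [NormedSpace ℝ V]
  {H : Type*} [TopologicalSpace H] {I : ModelWithCorners ℝ V H}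
  {N : Type*} [TopologicalSpace N] [ChartedSpace H N] [IsManifold I ∞ N] [IsManifold I 1 N]

theorem contMDiffAt_bilin_apply
    {h : ∀ x : N, TangentSpace I x →L[ℝ] TangentSpace I x →L[ℝ] ℝ} {x : N}
    (hh : ContMDiffAt I (I.prod 𝓘(ℝ, V →L[ℝ] V →L[ℝ] ℝ)) ∞
      (fun x => TotalSpace.mk' (V →L[ℝ] V →L[ℝ] ℝ) (E := fun x : N =>
        TangentSpace I x →L[ℝ] TangentSpace I x →L[ℝ] ℝ) x (h x)) x)
    {Y Z : ∀ x : N, TangentSpace I x}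
    (hY : ContMDiffAt I I.tangent ∞ (fun x => (⟨x, Y x⟩ : TangentBundle I N)) x)
    (hZ : ContMDiffAt I I.tangent ∞ (fun x => (⟨x, Z x⟩ : TangentBundle I N)) x) :
    ContMDiffAt I 𝓘(ℝ, ℝ) ∞ (fun x => h x (Y x) (Z x)) x := by
  have h1 := (hh.clm_bundle_apply (b := fun x => x) hY)
  have h2 := ContMDiffAt.clm_bundle_apply (E₂ := Bundle.Trivial N ℝ) (F₂ := ℝ) (b := fun x => x)
    h1 hZ
  exact (contMDiffAt_totalSpace.1 h2).2

theorem mdifferentiableAt_bilin_apply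
    {h : ∀ x : N, TangentSpace I x →L[ℝ] TangentSpace I x →L[ℝ] ℝ} {x : N}
    (hh : ContMDiffAt I (I.prod 𝓘(ℝ, V →L[ℝ] V →L[ℝ] ℝ)) ∞
      (fun x => TotalSpace.mk' (V →L[ℝ] V →L[ℝ] ℝ) (E := fun x : N =>
        TangentSpace I x →L[ℝ] TangentSpace I x →L[ℝ] ℝ) x (h x)) x)
    {Y Z : ∀ x : N, TangentSpace I x}
    (hY : MDifferentiableAt I I.tangent (fun x => (⟨x, Y x⟩ : TangentBundle I N)) x)
    (hZ : MDifferentiableAt I I.tangent (fun x => (⟨x, Z x⟩ : TangentBundle I N)) x) :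
    MDifferentiableAt I 𝓘(ℝ, ℝ) (fun x => h x (Y x) (Z x)) x := by
  have h1 := MDifferentiableAt.clm_bundle_apply (b := fun x => x)
    (hh.mdifferentiableAt (by simp)) hY
  have h2 := MDifferentiableAt.clm_bundle_apply (E₂ := Bundle.Trivial N ℝ) (F₂ := ℝ)
    (b := fun x => x) h1 hZ
  exact ((mdifferentiableAt_totalSpace _ _).1 h2).2

/-- The failure of compatibility of a connection with a bilinear form. -/
noncomputable def compatDefect (cov : CovariantDerivative I V (TangentSpace I : N → Type _))
    (h : ∀ x : N, TangentSpace I x →L[ℝ] TangentSpace I x →L[ℝ] ℝ) (x : N) (w : TangentSpace I x)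
    (Z Y : ∀ x : N, TangentSpace I x) : ℝ :=
  mvfderiv I (fun y => h y (Y y) (Z y)) x w - h x (cov Y x w) (Z x) - h x (Y x) (cov Z x w)

variable {cov : CovariantDerivative I V (TangentSpace I : N → Type _)}
    {h : ∀ x : N, TangentSpace I x →L[ℝ] TangentSpace I x →L[ℝ] ℝ} 

/-- The derivative of `f` in `h(f Y, Z)` cancels against the one in `∇(f Y)`, so the defect depends
on `Y` only through its value at `x`. Symmetry of `h` gives the same for `Z`. -/
theorem tensorialAt_compatDefect (hh : Classical.IsSmoothSymmetricForm h) {x : N}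
    (w : TangentSpace I x) {Z : ∀ x : N, TangentSpace I x}
    (hZ : MDifferentiableAt I I.tangent (fun x => (⟨x, Z x⟩ : TangentBundle I N)) x) :
    TensorialAt I V (compatDefect cov h x w Z) x where
  smul {f Y} hf hY := by
    have h1 : (fun y => h y ((f • Y) y) (Z y)) = fun y => f y * h y (Y y) (Z y) :=
      funext fun y => by simp
    rw [compatDefect, compatDefect, h1,
      mvfderiv_fun_mul hf (mdifferentiableAt_bilin_apply (hh.smooth x) hY hZ),
      cov.isCovariantDerivativeOnUniv.leibniz hY hf]
    simp
    ring
  add {Y Y'} hY hY' := by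
    have h1 : (fun y => h y ((Y + Y') y) (Z y)) = fun y => h y (Y y) (Z y) + h y (Y' y) (Z y) :=
      funext fun y => by simp
    rw [compatDefect, compatDefect, compatDefect, h1,
      mvfderiv_fun_add (mdifferentiableAt_bilin_apply (hh.smooth x) hY hZ)
        (mdifferentiableAt_bilin_apply (hh.smooth x) hY' hZ),
      cov.isCovariantDerivativeOnUniv.add hY hY']
    simp
    ring

theorem compatDefect_comm (hh : Classical.IsSmoothSymmetricForm h) {x : N}
    (w : TangentSpace I x) (Y Z : ∀ x : N, TangentSpace I x) :
    compatDefect cov h x w Z Y = compatDefect cov h x w Y Z := by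
  have h1 : (fun y => h y (Y y) (Z y)) = fun y => h y (Z y) (Y y) := funext fun y => hh.symm _ _ _
  rw [compatDefect, compatDefect, h1, hh.symm _ (cov Y x w), hh.symm _ (Y x)]
  ring

theorem compatDefect_congr [FiniteDimensional ℝ V] (hh : Classical.IsSmoothSymmetricForm h) {x : N}
    (w : TangentSpace I x) {Y Y' Z Z' : ∀ x : N, TangentSpace I x}
    (hY : MDifferentiableAt I I.tangent (fun x => (⟨x, Y x⟩ : TangentBundle I N)) x)
    (hY' : MDifferentiableAt I I.tangent (fun x => (⟨x, Y' x⟩ : TangentBundle I N)) x)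
    (hZ : MDifferentiableAt I I.tangent (fun x => (⟨x, Z x⟩ : TangentBundle I N)) x)
    (hZ' : MDifferentiableAt I I.tangent (fun x => (⟨x, Z' x⟩ : TangentBundle I N)) x)
    (e : Y x = Y' x) (e' : Z x = Z' x) :
    compatDefect cov h x w Z Y = compatDefect cov h x w Z' Y' := by
  rw [(tensorialAt_compatDefect hh w hZ).pointwise hY hY' e, compatDefect_comm hh,
    (tensorialAt_compatDefect hh w hY').pointwise hZ hZ' e', compatDefect_comm hh]

end

namespace BatchelorModel

open SuperAlg

noncomputable section

variable {B F : Type*} [NormedAddCommGroup B] [NormedSpace ℝ B] [FiniteDimensional ℝ B]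
  [NormedAddCommGroup F] [NormedSpace ℝ F] [FiniteDimensional ℝ F]
  {M : Type*} [TopologicalSpace M] [T2Space M] [ChartedSpace B M] [IsManifold 𝓘(ℝ, B) ∞ M]
  {E : M → Type*} [∀ x, AddCommGroup (E x)] [∀ x, Module ℝ (E x)]
  [TopologicalSpace (TotalSpace F E)] [∀ x, TopologicalSpace (E x)] [FiberBundle F E]
  [VectorBundle ℝ F E] [ContMDiffVectorBundle ∞ F E 𝓘(ℝ, B)]
  {x₀ : M} {v : TotalSpace F E}

/-- The points of `E` at which the superderivations preserving affine superfunctions span the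
tangent space. -/
def IsRegular (v : TotalSpace F E) : Prop :=
  ∀ _ : Fin (Module.finrank ℝ F), ∃ b, affinePart ((frameAt (B := B) v.1).z (Sum.inr b)) v ≠ 0

/-- A point fails to be regular only if the rank is positive and all its fibre coordinates vanish;
the dummy index in `IsRegular` makes every point regular in rank zero. Adding `t` times a basis
vector with `t ≠ 0` gives regular points of the same fibre tending to it. -/
theorem mem_closure_isRegular (v : TotalSpace F E) :
    v ∈ closure {u : TotalSpace F E | IsRegular (B := B) u} := by
  by_cases hv : IsRegular (B := B) v
  · exact subset_closure hv
  obtain ⟨a, ha⟩ := not_forall.1 hv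
  obtain ⟨x, e⟩ := v
  let fr := frameAt (B := B) (F := F) (E := E) x
  have hx := fr.dom_subset_baseSet fr.mem_dom
  let T := trivializationAt F E x
  let c : ℝ → TotalSpace F E := fun t =>
    ⟨x, T.symmₗ ℝ x (T.linearMapAt ℝ x e + t • Module.finBasis ℝ F a)⟩
  have hc0 : c 0 = ⟨x, e⟩ := by
    simp only [c, zero_smul, add_zero]
    rw [T.symmₗ_linearMapAt hx]
  have hc : Continuous c := by
    have h1 : c = fun t => T.toOpenPartialHomeomorph.symm
        (x, T.linearMapAt ℝ x e + t • Module.finBasis ℝ F a) :=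
      funext fun t => by
        simp only [c, T.symmₗ_apply hx]
        exact T.mk_symm hx _
    rw [h1]
    have h2 : ContinuousOn T.toOpenPartialHomeomorph.symm T.target :=
      T.toOpenPartialHomeomorph.continuousOn_symm
    refine h2.comp_continuous (by fun_prop) fun t => ?_
    rw [T.mem_target]
    exact hx
  have hg : ∀ t ≠ 0, IsRegular (B := B) (c t) := by
    intro t ht _
    refine ⟨a, ?_⟩
    have h0 : affinePart (fr.z (Sum.inr a)) ⟨x, e⟩ = 0 := not_not.1 fun h => ha ⟨a, h⟩
    have h1 : ∀ e, affinePart (fr.z (Sum.inr a)) ⟨x, e⟩ =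
        (Module.finBasis ℝ F).coord a (T.linearMapAt ℝ x e) := by
      intro e
      rw [affinePart_eq_tot, evAt_z_odd fr a _ fr.mem_dom]
      simp [tot_apply, T]
    change affinePart (fr.z (Sum.inr a)) (c t) ≠ 0
    rw [h1, T.linearMapAt_symmₗ hx, map_add, ← h1, h0]
    simpa using ht
  have h3 : Tendsto c (𝓝[≠] 0) (𝓝 ⟨x, e⟩) := hc0 ▸ (hc.tendsto 0).mono_left nhdsWithin_le_nhds
  exact mem_closure_of_tendsto h3 (eventually_nhdsWithin_of_forall fun t ht => hg t ht)

/-- Continuous functions coincide if they coincide at regular points. -/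
theorem eq_of_eq_isRegular {g g' : TotalSpace F E → ℝ} (hg : ContinuousAt g v)
    (hg' : ContinuousAt g' v) (h : ∀ᶠ u in 𝓝 v, IsRegular (B := B) u → g u = g' u) : g v = g' v := by
  refine tendsto_nhds_unique_of_frequently_eq hg hg' ?_
  exact ((mem_closure_iff_frequently.1 (mem_closure_isRegular (B := B) v)).and_eventually h).mono
    fun u hu => hu.2 hu.1

theorem der_sum_apply {A : Type*} [Ring A] [Algebra ℝ A] {𝒜 : ZMod 2 → Submodule ℝ A} {p : ZMod 2}
    {ι : Type*} [Fintype ι] (X : ι → der 𝒜 p) (r : ι → ℝ) (f : A) :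
    (∑ i, r i • X i).1 f = ∑ i, r i • (X i).1 f := by
  rw [AddSubmonoidClass.coe_finsetSum, LinearMap.sum_apply]
  rfl

theorem superFun_coe_smul (r : ℝ) (f : superFun B F E) (x : M) : (r • f).1 x = r • f.1 x := rfl

theorem isAffine_mul_of_const {f g : superFun B F E} (hf : IsAffine f)
    (hg : ∀ x, ∃ r : ℝ, g.1 x = algebraMap ℝ _ r) : IsAffine (f * g) := by
  intro x
  obtain ⟨c, η, h⟩ := hf x
  obtain ⟨r, hr⟩ := hg x
  refine ⟨c * r, r • η, ?_⟩
  rw [superFun_coe_mul, h, hr, add_mul, map_mul, map_smul, Algebra.smul_def,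
    Algebra.commutes r (ExteriorAlgebra.ι ℝ η)]

theorem isAffine_sum {ι : Type*} [Fintype ι] {f : ι → superFun B F E}
    (hf : ∀ i, IsAffine (f i)) (r : ι → ℝ) : IsAffine (∑ i, r i • f i) := by
  intro x
  choose c η h using fun i => hf i x
  refine ⟨∑ i, r i • c i, ∑ i, r i • η i, ?_⟩
  rw [sum_apply_superFun]
  simp only [superFun_coe_smul, h, smul_add, Finset.sum_add_distrib, map_sum, map_smul,
    Algebra.algebraMap_eq_smul_one, smul_assoc]

/-- The product of an odd superfunction and an odd coordinate superderivation. -/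
def oddMul (fr : Frame B F E x₀) (f : superFun B F E) (hf : f ∈ parity B F E 1)
    (a : Fin (Module.finrank ℝ F)) : der (parity B F E) 0 :=
  smulDer (isSupercommutative_parity (B := B) (F := F) (E := E)) f hf (fr.D (Sum.inr a))
    (parity_add_self 1).symm

/-- An odd coordinate superderivation sends affine superfunctions to functions on `M`; multiplying
these by an affine superfunction stays in degree at most one. -/
theorem preservesAffine_oddMul (fr : Frame B F E x₀) (f : superFun B F E)
    (hf : f ∈ parity B F E 1) (hfa : IsAffine f) (a : Fin (Module.finrank ℝ F)) :
    PreservesAffine (oddMul fr f hf a) := by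
  intro s hs
  have h := isAffine_mul_of_const hfa (fr.D_odd_affine a s hs)
  exact h

/-- The vertical fields obtained from affine-preserving superderivations of this kind carry a
coefficient that vanishes on the zero section, so spanning needs regular points, where some
coefficient can be inverted. -/
theorem tanVec_oddMul (fr : Frame B F E x₀) (f : superFun B F E) (hf : f ∈ parity B F E 1)
    (a : Fin (Module.finrank ℝ F)) (hv : v.1 ∈ fr.dom) :
    tanVec (oddMul fr f hf a) v = affinePart f v • bas fr (Sum.inr a) v := by
  refine tangent_ext fr hv fun c => ?_
  have h : mvfderiv (𝓘(ℝ, B).prod 𝓘(ℝ, F)) (affinePart (fr.z c)) v (tanVec (oddMul fr f hf a) v) =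
      tot (evAt v (f * (fr.D (Sum.inr a)).1 (fr.z c))) := by
    rw [mvfderiv_tanVec_even, ← affinePart_eq_tot]
    rfl
  rw [h, map_mul, (isPoint_evAt v).map_D_z fr hv, map_smul, mvfderiv_z_bas fr hv, affinePart_eq_tot]
  split_ifs <;> simp

theorem tanVec_sum {ι : Type*} [Fintype ι] (X : ι → der (parity B F E) 0) (r : ι → ℝ) :
    tanVec (∑ i, r i • X i) v = ∑ i, r i • tanVec (X i) v := by
  refine tangent_ext (frameAt v.1) (frameAt v.1).mem_dom fun c => ?_
  have h : (∑ i, r i • X i).1 ((frameAt v.1).z c) = ∑ i, r i • (X i).1 ((frameAt v.1).z c) :=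
    der_sum_apply X r _
  have h2 := mvfderiv_tanVec_even (∑ i, r i • X i) v ((frameAt v.1).z c)
  rw [h2, h, affinePart_eq_tot]
  simp only [map_sum, map_smul, mvfderiv_tanVec_even, affinePart_eq_tot]

theorem preservesAffine_sum {ι : Type*} [Fintype ι] {X : ι → der (parity B F E) 0}
    (hX : ∀ i, PreservesAffine (X i)) (r : ι → ℝ) : PreservesAffine (∑ i, r i • X i) := by
  intro s hs
  have h : (∑ i, r i • X i).1 s = ∑ i, r i • (X i).1 s := der_sum_apply X r s
  have h2 := isAffine_sum (fun i => hX i s hs) r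
  rwa [← h] at h2

theorem exists_tanVec_eq_bas (hv : IsRegular (B := B) v) (c : Idx B F) :
    ∃ X : der (parity B F E) 0, PreservesAffine X ∧
      ∃ r : ℝ, r • tanVec X v = bas (frameAt v.1) c v := by
  let fr := frameAt (B := B) (F := F) (E := E) v.1
  have hd : v.1 ∈ fr.dom := fr.mem_dom
  change ∃ X : der (parity B F E) 0, PreservesAffine X ∧ ∃ r : ℝ, r • tanVec X v = bas fr c v
  rcases c with i | a
  · refine ⟨_, fr.D_even_affine i, 1, ?_⟩
    rw [one_smul, bas_eq_tanVec fr hd]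
    rfl
  · obtain ⟨b, hb⟩ := hv a
    have hz : fr.z (Sum.inr b) ∈ parity B F E 1 := fr.z_mem (Sum.inr b)
    refine ⟨_, preservesAffine_oddMul fr _ hz (fr.z_affine _) a,
      (affinePart (fr.z (Sum.inr b)) v)⁻¹, ?_⟩
    rw [tanVec_oddMul _ _ _ _ hd, smul_smul, inv_mul_cancel₀ hb, one_smul]

/-- At regular points, every tangent vector comes from a superderivation preserving affine
superfunctions. -/
theorem exists_tanVec_eq (hv : IsRegular (B := B) v) (w : TangentSpace (𝓘(ℝ, B).prod 𝓘(ℝ, F)) v) :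
    ∃ X : der (parity B F E) 0, PreservesAffine X ∧ tanVec X v = w := by
  choose X hX r h using exists_tanVec_eq_bas (B := B) hv
  refine ⟨_, preservesAffine_sum hX fun c =>
    mvfderiv (𝓘(ℝ, B).prod 𝓘(ℝ, F)) (affinePart ((frameAt v.1).z c)) v w * r c, ?_⟩
  rw [tanVec_sum]
  simp only [mul_smul, h]
  exact (eq_sum_bas _ (frameAt v.1).mem_dom w).symm

end

end BatchelorModel

/-! ### Properties of the associated connection and forms -/

section

variable {V : Type*} [NormedAddCommGroup V] [NormedSpace ℝ V]
  {H : Type*} [TopologicalSpace H] {I : ModelWithCorners ℝ V H}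
  {N : Type*} [TopologicalSpace N] [ChartedSpace H N] [IsManifold I ∞ N] [IsManifold I 1 N]

theorem contMDiffAt_cov_apply {cov : CovariantDerivative I V (TangentSpace I : N → Type _)}
    (hcov : cov.ContMDiffCovariantDerivative ∞) {X Y : ∀ x : N, TangentSpace I x} {x : N}
    (hY : Classical.IsSmoothField Y)
    (hX : ContMDiffAt I I.tangent ∞ (fun x => (⟨x, X x⟩ : TangentBundle I N)) x) :
    ContMDiffAt I I.tangent ∞ (fun x => (⟨x, cov Y x (X x)⟩ : TangentBundle I N)) x := by
  have h := hcov.contMDiff.contMDiff (σ := Y) (contMDiffOn_univ.2 hY)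
  rw [contMDiffOn_univ] at h
  exact (h x).clm_bundle_apply (b := fun x => x) hX

/-- The brackets of coordinate vector fields vanish. -/
theorem mlieBracket_localFrame [CompleteSpace V] {x z : N} (hz : z ∈ (chartAt H x).source)
    {ι : Type*} (b : Module.Basis ι ℝ V) (i j : ι) : VectorField.mlieBracket I
      ((trivializationAt V (TangentSpace I : N → Type _) x).localFrame b i)
      ((trivializationAt V (TangentSpace I : N → Type _) x).localFrame b j) z = 0 := by
  let c (i : ι) (y : V) : TangentSpace 𝓘(ℝ, V) y := b i
  -- Near `z` the frame is the pullback of constant fields under the chart, and brackets commute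
  -- with pullback.
  have h1 : ∀ i, (trivializationAt V (TangentSpace I : N → Type _) x).localFrame b i =ᶠ[𝓝 z]
      VectorField.mpullback I 𝓘(ℝ, V) (extChartAt I x) (c i) := by
    intro i
    filter_upwards [(chartAt H x).open_source.mem_nhds hz] with y hy
    have h2 := BatchelorModel.mvfderiv_extChartAt_localFrame (I := I) hy b i
    have h3 := isInvertible_mfderiv_extChartAt (I := I) (y := y) (x := x)
      (by rwa [extChartAt_source])
    exact (h3.inverse_apply_eq.2 h2.symm).symm
  have h2 : ∀ i, MDifferentiableAt 𝓘(ℝ, V) 𝓘(ℝ, V).tangent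
      (fun y => (⟨y, c i y⟩ : TangentBundle 𝓘(ℝ, V) V)) (extChartAt I x z) := fun i =>
    ((contMDiff_vectorSpace_iff_contDiff (n := 1)).2 contDiff_const).contMDiffAt.mdifferentiableAt
      (by simp)
  have hm : minSmoothness ℝ 2 = 2 := by simp
  have : IsManifold I (minSmoothness ℝ 2) N := 
    IsManifold.of_le (n := ∞) (by rw [hm]; exact WithTop.coe_le_coe.2 le_top)
  have h3 := VectorField.mpullback_mlieBracket (n := ∞) (h2 i) (h2 j)
    (contMDiffAt_extChartAt' (I := I) hz) (by rw [hm]; exact WithTop.coe_le_coe.2 le_top)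
  rw [(h1 i).mlieBracket_vectorField_eq (h1 j), ← h3, VectorField.mpullback_apply]
  have h4 : VectorField.mlieBracket 𝓘(ℝ, V) (c i) (c j) = 0 := by
    funext y
    rw [← VectorField.mlieBracketWithin_univ, VectorField.mlieBracketWithin_eq_lieBracketWithin]
    simp [VectorField.lieBracketWithin, c]
    rfl
  rw [h4]
  exact map_zero _

end

namespace BatchelorModel

open SuperAlg

noncomputable section

variable {B F : Type*} [NormedAddCommGroup B] [NormedSpace ℝ B] [FiniteDimensional ℝ B]
  [NormedAddCommGroup F] [NormedSpace ℝ F] [FiniteDimensional ℝ F]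
  {M : Type*} [TopologicalSpace M] [T2Space M] [ChartedSpace B M] [IsManifold 𝓘(ℝ, B) ∞ M]
  {E : M → Type*} [∀ x, AddCommGroup (E x)] [∀ x, Module ℝ (E x)]
  [TopologicalSpace (TotalSpace F E)] [∀ x, TopologicalSpace (E x)] [FiberBundle F E]
  [VectorBundle ℝ F E] [ContMDiffVectorBundle ∞ F E 𝓘(ℝ, B)]
  {x₀ : M} {v : TotalSpace F E} {nabla : Connection (parity B F E)}

/-- The superderivation `∇_X Y` of even arguments has parity `0 + 0`; keeping the parity as a
variable with an equation avoids transport. -/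
theorem mvfderiv_tanVec_of_eq_zero {p : ZMod 2} (hp : p = 0) (X : der (parity B F E) p)
    (v : TotalSpace F E) (f : superFun B F E) :
    mvfderiv (𝓘(ℝ, B).prod 𝓘(ℝ, F)) (affinePart f) v (tanVec X v) = affinePart (X.1 f) v := by
  subst hp
  exact mvfderiv_tanVec_even X v f

theorem IsAssociatedConnection.apply_tanVec
    {cov : CovariantDerivative (𝓘(ℝ, B).prod 𝓘(ℝ, F)) (B × F) (TangentSpace (𝓘(ℝ, B).prod 𝓘(ℝ, F)) : TotalSpace F E → Type _)}
    (hcov : IsAssociatedConnection nabla cov) {X Y : der (parity B F E) 0}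
    (hX : PreservesAffine X) (hY : PreservesAffine Y) (v : TotalSpace F E) :
    cov (tanVec Y) v (tanVec X v) = tanVec (nabla.nabla X Y) v := by
  refine tangent_ext (frameAt v.1) (frameAt v.1).mem_dom fun c => ?_
  exact (hcov.associated X Y _ _ hX hY (corresponds_tanVec X) (corresponds_tanVec Y) _
    ((frameAt v.1).z_affine c) v).trans (mvfderiv_tanVec_of_eq_zero (add_zero 0) _ v _).symm

theorem mdifferentiableAt_tanVec (X : der (parity B F E) 0) (v : TotalSpace F E) :
    MDifferentiableAt (𝓘(ℝ, B).prod 𝓘(ℝ, F)) (𝓘(ℝ, B).prod 𝓘(ℝ, F)).tangent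
      (fun u => (⟨u, tanVec X u⟩ : TangentBundle (𝓘(ℝ, B).prod 𝓘(ℝ, F)) (TotalSpace F E))) v :=
  (isSmoothField_tanVec X v).mdifferentiableAt (by simp)

/-- The difference of two connections is tensorial in `Y`, so `Y` may be replaced by some `tanVec
Y'` with the same value at `v`, and the direction likewise. There both connections are prescribed.
-/
theorem IsAssociatedConnection.eq_of_isRegular
    {cov cov' : CovariantDerivative (𝓘(ℝ, B).prod 𝓘(ℝ, F)) (B × F) (TangentSpace (𝓘(ℝ, B).prod 𝓘(ℝ, F)) : TotalSpace F E → Type _)}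
    (hcov : IsAssociatedConnection nabla cov) (hcov' : IsAssociatedConnection nabla cov')
    (hv : IsRegular (B := B) v) {Y : ∀ u : TotalSpace F E, TangentSpace (𝓘(ℝ, B).prod 𝓘(ℝ, F)) u}
    (hY : Classical.IsSmoothField Y) : cov Y v = cov' Y v := by
  have hYd := (hY v).mdifferentiableAt (by simp)
  obtain ⟨Y', hY', h⟩ := exists_tanVec_eq hv (Y v)
  rw [← sub_eq_zero]
  have h1 := IsCovariantDerivativeOn.difference_apply cov.isCovariantDerivativeOnUniv
    cov'.isCovariantDerivativeOnUniv (x := v) trivial hYd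
  have h2 := IsCovariantDerivativeOn.difference_apply cov.isCovariantDerivativeOnUniv
    cov'.isCovariantDerivativeOnUniv (x := v) trivial (mdifferentiableAt_tanVec Y' v)
  rw [h] at h2
  refine (h1.symm.trans h2).trans ?_
  refine ContinuousLinearMap.ext fun w => ?_
  obtain ⟨X, hX, rfl⟩ := exists_tanVec_eq hv w
  have h3 := hcov.apply_tanVec hX hY' v
  have h4 := hcov'.apply_tanVec hX hY' v
  exact sub_eq_zero.2 (h3.trans h4.symm)

/-- Smoothness of `Y` and of both connections makes the coordinates of their values on coordinate
fields continuous; they agree on the dense set of regular points. -/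
theorem IsAssociatedConnection.unique
    {cov cov' : CovariantDerivative (𝓘(ℝ, B).prod 𝓘(ℝ, F)) (B × F) (TangentSpace (𝓘(ℝ, B).prod 𝓘(ℝ, F)) : TotalSpace F E → Type _)}
    (hcov : IsAssociatedConnection nabla cov) (hcov' : IsAssociatedConnection nabla cov')
    {Y : ∀ u : TotalSpace F E, TangentSpace (𝓘(ℝ, B).prod 𝓘(ℝ, F)) u} (hY : Classical.IsSmoothField Y) :
    cov Y = cov' Y := by
  funext v
  let fr := frameAt (B := B) (F := F) (E := E) v.1
  have hv : v.1 ∈ fr.dom := fr.mem_dom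
  refine ContinuousLinearMap.ext fun w => ?_
  have h : ∀ d, cov Y v (bas fr d v) = cov' Y v (bas fr d v) := fun d =>
    tangent_ext fr hv fun c => eq_of_eq_isRegular (B := B)
      (g := fun u => mvfderiv (𝓘(ℝ, B).prod 𝓘(ℝ, F)) (affinePart (fr.z c)) u (cov Y u (bas fr d u)))
      (g' := fun u => mvfderiv (𝓘(ℝ, B).prod 𝓘(ℝ, F)) (affinePart (fr.z c)) u (cov' Y u (bas fr d u)))
      ((contMDiff_affinePart _).contMDiffAt.mvfderiv_apply
        (contMDiffAt_cov_apply hcov.smooth hY (contMDiffAt_bas fr hv d))).continuousAt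
      ((contMDiff_affinePart _).contMDiffAt.mvfderiv_apply
        (contMDiffAt_cov_apply hcov'.smooth hY (contMDiffAt_bas fr hv d))).continuousAt
      (Eventually.of_forall fun u hu => by rw [hcov.eq_of_isRegular hcov' hu hY])
  rw [eq_sum_bas fr hv w]
  simp only [map_sum, map_smul, h]

variable {ε : ZMod 2} {g : SuperAlg.Metric (parity B F E) ε}

theorem koszul_mul_tot_eps_zero (ε : ZMod 2) (z : DualNumber ℝ) :
    koszul ε 0 * (koszul 0 0 * koszul ε 0) * tot (eps 0 * eps 0 * z) = tot z := by
  simp [koszul_zero_right]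

theorem koszul_mul_tot_eps_comm (ε p q : ZMod 2) {z z' : DualNumber ℝ} (h : z = koszul p q • z') :
    koszul ε p * (koszul 0 q * koszul ε q) * tot (eps p * eps q * z) =
      koszul ε q * (koszul 0 p * koszul ε p) * tot (eps q * eps p * z') := by
  subst h
  rcases parity_cases p with rfl | rfl <;> rcases parity_cases q with rfl | rfl <;>
  simp [koszul_zero_right, koszul_zero_left]

theorem metricForm_form_tanVec {p q : ZMod 2} (hp : p = 0) (hq : q = 0) (X : der (parity B F E) p)
    (Y : der (parity B F E) q) (v : TotalSpace F E) :
    (metricForm g).form v (tanVec X v) (tanVec Y v) = affinePart (g.val X Y) v := by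
  subst hp hq
  have h := (metricForm g).form_tanVec X Y v
  exact h.trans ((koszul_mul_tot_eps_zero ε _).trans (affinePart_eq_tot _ _).symm)

/-- Supersymmetry differs from symmetry only for two odd arguments, and there `τ² = 0` makes the
form vanish. -/
theorem metricForm_form_bas_comm (v : TotalSpace F E) (c d : Idx B F) :
    (metricForm g).form v (bas (frameAt v.1) c v) (bas (frameAt v.1) d v) =
      (metricForm g).form v (bas (frameAt v.1) d v) (bas (frameAt v.1) c v) := by
  simp only [bas_eq_tanVec _ (frameAt v.1).mem_dom]
  have h1 := (metricForm g).form_tanVec ((frameAt v.1).D c) ((frameAt v.1).D d) v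
  have h2 := (metricForm g).form_tanVec ((frameAt v.1).D d) ((frameAt v.1).D c) v
  have h3 := (congrArg (evAt v) (g.supersymm ((frameAt v.1).D c) ((frameAt v.1).D d))).trans
    (map_smul (evAt v) _ _)
  exact h1.trans ((koszul_mul_tot_eps_comm ε _ _ h3).trans h2.symm)

theorem metricForm_form_symm (v : TotalSpace F E) (w w' : TangentSpace (𝓘(ℝ, B).prod 𝓘(ℝ, F)) v) :
    (metricForm g).form v w w' = (metricForm g).form v w' w := by
  have hv := (frameAt (B := B) (F := F) (E := E) v.1).mem_dom
  rw [eq_sum_bas _ hv w, eq_sum_bas _ hv w']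
  simp only [map_sum, map_smul, _root_.sum_apply, _root_.smul_apply, smul_eq_mul,
    metricForm_form_bas_comm v, Finset.mul_sum]
  rw [Finset.sum_comm]
  refine Finset.sum_congr rfl fun c _ => Finset.sum_congr rfl fun d _ => ?_
  rw [metricForm_form_bas_comm v]
  ring

theorem tot_map_metric {A : Type*} [Ring A] [Algebra ℝ A] (φ : A →ₐ[ℝ] DualNumber ℝ) (ε : ZMod 2)
    {x y z : A} (h : koszul ε 0 • x - y - koszul 0 0 • z = 0) :
    tot (φ x) - tot (φ y) - tot (φ z) = 0 := by
  rw [koszul_zero_right, koszul_zero_right, one_smul, one_smul] at h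
  rw [← map_sub, ← map_sub, ← map_sub, ← map_sub, h, map_zero, map_zero]

theorem isAssociatedForm_metricForm : IsAssociatedForm g (metricForm g).form := by
  refine ⟨⟨metricForm_form_symm, (metricForm g).contMDiff_form⟩, ?_⟩
  intro X Y X' Y' _ _ hX hY v
  rw [hX.eq_tanVec, hY.eq_tanVec]
  exact metricForm_form_tanVec rfl rfl X Y v

theorem IsAssociatedForm.unique {h h' : ∀ v : TotalSpace F E, TangentSpace (𝓘(ℝ, B).prod 𝓘(ℝ, F)) v →L[ℝ]
      TangentSpace (𝓘(ℝ, B).prod 𝓘(ℝ, F)) v →L[ℝ] ℝ} (hh : IsAssociatedForm g h) (hh' : IsAssociatedForm g h') :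
    h = h' := by
  funext v
  let fr := frameAt (B := B) (F := F) (E := E) v.1
  have hv : v.1 ∈ fr.dom := fr.mem_dom
  refine bilin_ext fr hv fun c d => eq_of_eq_isRegular (B := B)
    (g := fun u => h u (bas fr c u) (bas fr d u)) (g' := fun u => h' u (bas fr c u) (bas fr d u))
    (contMDiffAt_bilin_apply (hh.smooth.smooth v) (contMDiffAt_bas fr hv c)
      (contMDiffAt_bas fr hv d)).continuousAt
    (contMDiffAt_bilin_apply (hh'.smooth.smooth v) (contMDiffAt_bas fr hv c)
      (contMDiffAt_bas fr hv d)).continuousAt (Eventually.of_forall fun u hu => ?_)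
  obtain ⟨X, hX, h1⟩ := exists_tanVec_eq hu (bas fr c u)
  obtain ⟨Y, hY, h2⟩ := exists_tanVec_eq hu (bas fr d u)
  rw [← h1, ← h2, hh.associated X Y _ _ hX hY (corresponds_tanVec X) (corresponds_tanVec Y),
    hh'.associated X Y _ _ hX hY (corresponds_tanVec X) (corresponds_tanVec Y)]

theorem existsUnique_isAssociatedForm (g : SuperAlg.Metric (parity B F E) ε) :
    ∃! h, IsAssociatedForm g h :=
  ⟨_, isAssociatedForm_metricForm, fun _ h => h.unique isAssociatedForm_metricForm⟩

theorem compatDefect_tanVec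
    {cov : CovariantDerivative (𝓘(ℝ, B).prod 𝓘(ℝ, F)) (B × F) (TangentSpace (𝓘(ℝ, B).prod 𝓘(ℝ, F)) : TotalSpace F E → Type _)}
    (hcov : IsAssociatedConnection nabla cov) (hg : nabla.IsMetric g) {X Y Z : der (parity B F E) 0}
    (hX : PreservesAffine X) (hY : PreservesAffine Y) (hZ : PreservesAffine Z)
    (v : TotalSpace F E) :
    compatDefect cov (metricForm g).form v (tanVec X v) (tanVec Z) (tanVec Y) = 0 := by
  have h1 : (fun u => (metricForm g).form u (tanVec Y u) (tanVec Z u)) = affinePart (g.val Y Z) :=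
    funext fun u => metricForm_form_tanVec rfl rfl Y Z u
  have h2 := mvfderiv_tanVec_even X v (g.val Y Z)
  have h3 : (metricForm g).form v (tanVec (nabla.nabla X Y) v) (tanVec Z v) = _ :=
    metricForm_form_tanVec (add_zero 0) rfl (nabla.nabla X Y) Z v
  have h4 : (metricForm g).form v (tanVec Y v) (tanVec (nabla.nabla X Z) v) = _ :=
    metricForm_form_tanVec rfl (add_zero 0) Y (nabla.nabla X Z) v
  have h5 := tot_map_metric (evAt v) ε (hg 0 0 0 X Y Z)
  simp only [← affinePart_eq_tot] at h5
  have e1 := (congrArg (fun a => mvfderiv (𝓘(ℝ, B).prod 𝓘(ℝ, F)) a v (tanVec X v)) h1).trans h2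
  have e2 := (congrArg (fun a => (metricForm g).form v a (tanVec Z v))
    (hcov.apply_tanVec hX hY v)).trans h3
  have e3 := (congrArg (fun a => (metricForm g).form v (tanVec Y v) a)
    (hcov.apply_tanVec hX hZ v)).trans h4
  exact (congrArg₂ (fun a b => a - b) (congrArg₂ (fun a b => a - b) e1 e2) e3).trans h5

/-- At a regular point the three fields can be replaced by `tanVec` fields of affine-preserving
superderivations, because the defect is tensorial; there compatibility is the super identity
evaluated at the point. Both sides are continuous, so the remaining points follow. -/
theorem isCompatible_of_isMetric
    {cov : CovariantDerivative (𝓘(ℝ, B).prod 𝓘(ℝ, F)) (B × F) (TangentSpace (𝓘(ℝ, B).prod 𝓘(ℝ, F)) : TotalSpace F E → Type _)}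
    (hcov : IsAssociatedConnection nabla cov) (hg : nabla.IsMetric g) {h} (hh : IsAssociatedForm g h) :
    Classical.IsCompatible cov h := by
  obtain rfl := hh.unique isAssociatedForm_metricForm
  intro X Y Z hX hY hZ v
  have hs := (isAssociatedForm_metricForm (g := g)).smooth
  have hd : ∀ {Y : ∀ u : TotalSpace F E, TangentSpace (𝓘(ℝ, B).prod 𝓘(ℝ, F)) u}, Classical.IsSmoothField Y → ∀ u,
      MDifferentiableAt (𝓘(ℝ, B).prod 𝓘(ℝ, F)) (𝓘(ℝ, B).prod 𝓘(ℝ, F)).tangent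
        (fun u => (⟨u, Y u⟩ : TangentBundle (𝓘(ℝ, B).prod 𝓘(ℝ, F)) (TotalSpace F E))) u := fun hY u =>
    (hY u).mdifferentiableAt (by simp)
  refine eq_of_eq_isRegular (B := B)
    (g := fun v => mvfderiv (𝓘(ℝ, B).prod 𝓘(ℝ, F)) (fun y => (metricForm g).form y (Y y) (Z y)) v (X v))
    (g' := fun v => (metricForm g).form v (cov Y v (X v)) (Z v) +
      (metricForm g).form v (Y v) (cov Z v (X v)))
    (ContMDiffAt.mvfderiv_apply (contMDiffAt_form_apply _ (hY v) (hZ v)) (hX v)).continuousAt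
    ((contMDiffAt_form_apply _ (contMDiffAt_cov_apply hcov.smooth hY (hX v)) (hZ v)).add
      (contMDiffAt_form_apply _ (hY v)
        (contMDiffAt_cov_apply hcov.smooth hZ (hX v)))).continuousAt
    (Eventually.of_forall fun u hu => ?_)
  obtain ⟨X', hX', e1⟩ := exists_tanVec_eq hu (X u)
  obtain ⟨Y', hY', e2⟩ := exists_tanVec_eq hu (Y u)
  obtain ⟨Z', hZ', e3⟩ := exists_tanVec_eq hu (Z u)
  have h1 := compatDefect_tanVec hcov hg hX' hY' hZ' u
  rw [compatDefect_congr hs _ (mdifferentiableAt_tanVec _ _) (hd hY u) (mdifferentiableAt_tanVec _ _)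
    (hd hZ u) e2 e3, e1, compatDefect] at h1
  linarith

end

end BatchelorModel

/-! ### The torsion of the associated connection -/

namespace BatchelorModel

open SuperAlg

noncomputable section

variable {B F : Type*} [NormedAddCommGroup B] [NormedSpace ℝ B] [FiniteDimensional ℝ B]
  [NormedAddCommGroup F] [NormedSpace ℝ F] [FiniteDimensional ℝ F]
  {M : Type*} [TopologicalSpace M] [T2Space M] [ChartedSpace B M] [IsManifold 𝓘(ℝ, B) ∞ M]
  {E : M → Type*} [∀ x, AddCommGroup (E x)] [∀ x, Module ℝ (E x)]
  [TopologicalSpace (TotalSpace F E)] [∀ x, TopologicalSpace (E x)] [FiberBundle F E]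
  [VectorBundle ℝ F E] [ContMDiffVectorBundle ∞ F E 𝓘(ℝ, B)]
  {x₀ : M} {v : TotalSpace F E} {nabla : Connection (parity B F E)}

theorem isSmoothField_tanVec_of_parity {p : ZMod 2} (X : der (parity B F E) p) :
    Classical.IsSmoothField (I := (𝓘(ℝ, B).prod 𝓘(ℝ, F))) (tanVec X : ∀ _ : TotalSpace F E, _) := fun v =>
  contMDiffAt_sum_smul_bas (frameAt v.1) (frameAt v.1).mem_dom
    (r := fun c u => tot (eps p * evAt u (X.1 ((frameAt v.1).z c))))
    (fun _ => (contMDiff_tot_eps _ _).contMDiffAt) fun u hu => by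
      rw [eq_sum_bas _ hu (tanVec X u)]
      simp only [mvfderiv_tanVec]

/-- The Koszul sign is `-1` only for two odd indices, and then every term contains `τ² = 0`. -/
theorem tot_eps_sub_comm_of_torsion (p q : ZMod 2) {a b a' b' : DualNumber ℝ}
    (h : b - koszul p q • b' - (a - koszul p q • a') = 0) :
    tot (eps p * eps q * a) - tot (eps p * eps q * b) =
      tot (eps q * eps p * a') - tot (eps q * eps p * b') := by
  by_cases hpq : p = 1 ∧ q = 1
  · obtain ⟨rfl, rfl⟩ := hpq
    have h0 : (DualNumber.eps * DualNumber.eps : DualNumber ℝ) = 0 := DualNumber.eps_mul_eps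
    simp only [eps_one, h0, zero_mul]
  · have hk : koszul p q = 1 := by
      rcases parity_cases p with rfl | rfl
      · exact koszul_zero_left _
      rcases parity_cases q with rfl | rfl
      · exact koszul_zero_right _
      exact absurd ⟨rfl, rfl⟩ hpq
    rw [hk, one_smul, one_smul] at h
    have h' : a - b = a' - b' := by linear_combination -h
    rw [← map_sub, ← map_sub, ← mul_sub, ← mul_sub, h', mul_comm (eps p)]

theorem map_torsion {A : Type*} [Ring A] [Algebra ℝ A] (φ : A →ₐ[ℝ] DualNumber ℝ) {k : ℝ}
    {a b a' b' : A} (h : b - k • b' - (a - k • a') = 0) :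
    φ b - k • φ b' - (φ a - k • φ a') = 0 := by
  rw [← map_smul, ← map_smul, ← map_sub, ← map_sub, ← map_sub, h, map_zero]

/-- The super-antisymmetric part of the Hessian of `f` is minus the torsion applied to `f`. -/
theorem hessForm_form_tanVec_comm (h : nabla.IsTorsionFree) (f : superFun B F E) {p q : ZMod 2}
    (X : der (parity B F E) p) (Y : der (parity B F E) q) (v : TotalSpace F E) :
    (hessForm nabla f).form v (tanVec X v) (tanVec Y v) =
      (hessForm nabla f).form v (tanVec Y v) (tanVec X v) :=
  (hessForm_form_tanVec nabla f X Y v).trans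
    ((tot_eps_sub_comm_of_torsion p q (map_torsion (evAt v) (h p q X Y f))).trans
      (hessForm_form_tanVec nabla f Y X v).symm)

/-- Coordinate fields have constant coordinates, so only the Hessian term survives: the Christoffel
symbols are the negative Hessians of the coordinates. -/
theorem mvfderiv_z_covAt_tanVec_D (nabla : Connection (parity B F E)) (v : TotalSpace F E)
    (b c d : Idx B F) :
    mvfderiv (𝓘(ℝ, B).prod 𝓘(ℝ, F)) (affinePart ((frameAt v.1).z b)) v
      (covAt nabla (tanVec ((frameAt v.1).D d)) v (tanVec ((frameAt v.1).D c) v)) =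
    -(hessForm nabla ((frameAt v.1).z b)).form v (tanVec ((frameAt v.1).D c) v)
      (tanVec ((frameAt v.1).D d) v) := by
  rw [mvfderiv_z_covAt]
  have h : (fun u => mvfderiv (𝓘(ℝ, B).prod 𝓘(ℝ, F)) (affinePart ((frameAt (B := B) (F := F) (E := E) v.1).z b)) u
      (tanVec ((frameAt v.1).D d) u)) =ᶠ[𝓝 v] fun _ => if d = b then (1 : ℝ) else 0 := by
    filter_upwards [eventually_mem_dom (frameAt (B := B) (F := F) (E := E) v.1)
      (frameAt v.1).mem_dom] with u hu
    rw [← bas_eq_tanVec _ hu, mvfderiv_z_bas _ hu]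
  rw [h.mvfderiv_eq, mvfderiv_const]
  simp

theorem mlieBracket_tanVec_D [CompleteSpace (B × F)] (fr : Frame B F E x₀) (hv : v.1 ∈ fr.dom)
    (c d : Idx B F) :
    VectorField.mlieBracket (𝓘(ℝ, B).prod 𝓘(ℝ, F)) (tanVec (fr.D c)) (tanVec (fr.D d)) v = 0 := by
  have h : ∀ c, (tanVec (fr.D c) : ∀ _ : TotalSpace F E, _) =ᶠ[𝓝 v] bas fr c := fun c => by
    filter_upwards [eventually_mem_dom fr hv] with u hu using (bas_eq_tanVec fr hu c).symm
  rw [(h c).mlieBracket_vectorField_eq (h d)]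
  exact mlieBracket_localFrame (mem_chart_source_of_mem_dom fr hv) _ c d

/-- Torsion is tensorial, so coordinate fields suffice. Their brackets vanish, and their covariant
derivatives are symmetric because the Hessians of the coordinates are. -/
theorem isTorsionFree_of_isTorsionFree
    {cov : CovariantDerivative (𝓘(ℝ, B).prod 𝓘(ℝ, F)) (B × F) (TangentSpace (𝓘(ℝ, B).prod 𝓘(ℝ, F)) : TotalSpace F E → Type _)}
    (hcov : IsAssociatedConnection nabla cov) (h : nabla.IsTorsionFree) :
    Classical.IsTorsionFree cov := by
  have : CompleteSpace (B × F) := FiniteDimensional.complete ℝ (B × F)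
  change cov.torsion = 0
  funext v
  have hv := (frameAt (B := B) (F := F) (E := E) v.1).mem_dom
  let fr := frameAt (B := B) (F := F) (E := E) v.1
  suffices key : ∀ c d, cov.torsion v (bas fr c v) (bas fr d v) = 0 by
    refine ContinuousLinearMap.ext fun w => ContinuousLinearMap.ext fun w' => ?_
    change cov.torsion v w w' = 0
    rw [eq_sum_bas fr hv w, eq_sum_bas fr hv w']
    simp only [map_sum, map_smul, _root_.sum_apply, _root_.smul_apply, key, smul_zero,
      Finset.sum_const_zero]
  intro c d
  have hd : ∀ c, MDifferentiableAt (𝓘(ℝ, B).prod 𝓘(ℝ, F)) (𝓘(ℝ, B).prod 𝓘(ℝ, F)).tangent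
      (fun u => (⟨u, tanVec (fr.D c) u⟩ : TangentBundle (𝓘(ℝ, B).prod 𝓘(ℝ, F)) (TotalSpace F E))) v := fun c =>
    (isSmoothField_tanVec_of_parity (fr.D c) v).mdifferentiableAt (by simp)
  have h1 := cov.torsion_apply (hd c) (hd d)
  rw [mlieBracket_tanVec_D fr hv, sub_zero,
    hcov.unique (isAssociatedConnection_assocConnection nabla) (isSmoothField_tanVec_of_parity _),
    hcov.unique (isAssociatedConnection_assocConnection nabla) (isSmoothField_tanVec_of_parity _)]
    at h1
  rw [bas_eq_tanVec fr hv, bas_eq_tanVec fr hv]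
  refine h1.trans (sub_eq_zero.2 (tangent_ext fr hv fun b => ?_))
  exact (mvfderiv_z_covAt_tanVec_D nabla v b c d).trans ((congrArg Neg.neg
    (hessForm_form_tanVec_comm h _ _ _ v)).trans (mvfderiv_z_covAt_tanVec_D nabla v b d c).symm)

end

end BatchelorModel

/-! ### Supercurves and their associated curves -/

namespace BatchelorModel

open SuperAlg

noncomputable section

theorem isSupercommutative_lineParity : IsSupercommutative lineParity where
  mul_mem hf hg t := dual_mul_mem (hf t) (hg t)
  comm hf hg := Subtype.ext (funext fun t => dual_mul_comm (hf t) (hg t))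

/-- The evaluation of superfunctions on `ℝ^{1|1}` at a time. -/
def lineEval (t : ℝ) : lineAlg →ₐ[ℝ] DualNumber ℝ :=
  (Pi.evalAlgHom ℝ (fun _ : ℝ => DualNumber ℝ) t).comp lineAlg.val

theorem lineEval_apply (t : ℝ) (b : lineAlg) : lineEval t b = b.1 t := rfl

theorem contDiff_tot (b : lineAlg) : ContDiff ℝ ∞ (fun t => tot (b.1 t)) := b.2.1.add b.2.2

theorem deriv_tot (b : lineAlg) (t : ℝ) :
    deriv (fun s => tot (b.1 s)) t = tot ((dt b).1 t) :=
  deriv_add (b.2.1.differentiable (by simp) t) (b.2.2.differentiable (by simp) t)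

variable {B F : Type*} [NormedAddCommGroup B] [NormedSpace ℝ B] [FiniteDimensional ℝ B]
  [NormedAddCommGroup F] [NormedSpace ℝ F] [FiniteDimensional ℝ F]
  {M : Type*} [TopologicalSpace M] [T2Space M] [ChartedSpace B M] [IsManifold 𝓘(ℝ, B) ∞ M]
  {E : M → Type*} [∀ x, AddCommGroup (E x)] [∀ x, Module ℝ (E x)]
  [TopologicalSpace (TotalSpace F E)] [∀ x, TopologicalSpace (E x)] [FiberBundle F E]
  [VectorBundle ℝ F E] [ContMDiffVectorBundle ∞ F E 𝓘(ℝ, B)]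
  {Φ : Supercurve B F E} {γ : ℝ → TotalSpace F E}

/-- Restricting a supercurve to a time `t` gives a dual-number point of `ΠE`, that is, a point of
`E`. -/
theorem Supercurve.exists_eq_evAt (Φ : Supercurve B F E) (t : ℝ) :
    ∃ e : E (Φ.base t), (lineEval t).comp Φ.pullback = evAt (⟨Φ.base t, e⟩ : TotalSpace F E) :=
  BatchelorModel.exists_eq_evAt _ (fun p f hf => Φ.even p f hf t) fun f => Φ.body_pullback f t

/-- The curve in `E` associated to a supercurve. -/
def Supercurve.curve (Φ : Supercurve B F E) (t : ℝ) : TotalSpace F E :=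
  ⟨Φ.base t, (Φ.exists_eq_evAt t).choose⟩

theorem Supercurve.evAt_curve (Φ : Supercurve B F E) (t : ℝ) (f : superFun B F E) :
    evAt (Φ.curve t) f = (Φ.pullback f).1 t :=
  (DFunLike.congr_fun (Φ.exists_eq_evAt t).choose_spec f).symm

theorem Supercurve.affinePart_curve (Φ : Supercurve B F E) (t : ℝ) (f : superFun B F E) :
    affinePart f (Φ.curve t) = tot ((Φ.pullback f).1 t) := by
  rw [affinePart_eq_tot, Φ.evAt_curve]

theorem Supercurve.contMDiff_curve (Φ : Supercurve B F E) :
    ContMDiff 𝓘(ℝ, ℝ) (𝓘(ℝ, B).prod 𝓘(ℝ, F)) ∞ Φ.curve := by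
  intro t₀
  rw [contMDiffAt_totalSpace]
  refine ⟨Φ.smooth_base t₀, ?_⟩
  have hx := (frameAt (B := B) (F := F) (E := E) (Φ.base t₀)).mem_dom
  let fr := frameAt (B := B) (F := F) (E := E) (Φ.base t₀)
  have h : ContMDiffAt 𝓘(ℝ, ℝ) 𝓘(ℝ, F) ∞ (fun t => ∑ a,
      tot ((Φ.pullback (fr.z (Sum.inr a))).1 t) • Module.finBasis ℝ F a) t₀ :=
    ContDiff.contMDiff (ContDiff.sum fun a _ => (contDiff_tot _).smul contDiff_const) t₀
  refine h.congr_of_eventuallyEq ?_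
  filter_upwards [(Φ.smooth_base t₀).continuousAt.preimage_mem_nhds
    (fr.isOpen_dom.mem_nhds hx)] with t ht
  have h1 : ((trivializationAt F E (Φ.base t₀)) (Φ.curve t)).2 =
      (trivializationAt F E (Φ.base t₀)).linearMapAt ℝ (Φ.base t) (Φ.curve t).2 := by
    rw [Trivialization.coe_linearMapAt_of_mem _ (fr.dom_subset_baseSet ht)]
    rfl
  refine h1.trans ?_
  rw [← (Module.finBasis ℝ F).sum_repr ((trivializationAt F E (Φ.base t₀)).linearMapAt ℝ (Φ.base t)
    (Φ.curve t).2)]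
  refine Finset.sum_congr rfl fun a _ => ?_
  congr 1
  rw [← Φ.evAt_curve, evAt_z_odd fr a (Φ.curve t) ht, tot_apply, TrivSqZeroExt.fst_inr,
    TrivSqZeroExt.snd_inr, zero_add]
  rfl

theorem Supercurve.isAssociatedCurve_curve (Φ : Supercurve B F E) :
    IsAssociatedCurve Φ Φ.curve :=
  ⟨Φ.contMDiff_curve, fun s _ t => Φ.affinePart_curve t s⟩

theorem IsAssociatedCurve.eq_curve (h : IsAssociatedCurve Φ γ) : γ = Φ.curve :=
  funext fun t => eq_of_affinePart_eq fun s hs =>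
    (h.2 s hs t).trans (Φ.affinePart_curve t s).symm

theorem existsUnique_isAssociatedCurve (Φ : Supercurve B F E) : ∃! γ, IsAssociatedCurve Φ γ :=
  ⟨Φ.curve, Φ.isAssociatedCurve_curve, fun _ h => h.eq_curve⟩

theorem mvfderiv_velocity {g : TotalSpace F E → ℝ} {t : ℝ}
    (hg : MDifferentiableAt (𝓘(ℝ, B).prod 𝓘(ℝ, F)) 𝓘(ℝ, ℝ) g (γ t)) (hγ : ContMDiff 𝓘(ℝ, ℝ) (𝓘(ℝ, B).prod 𝓘(ℝ, F)) ∞ γ) :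
    mvfderiv (𝓘(ℝ, B).prod 𝓘(ℝ, F)) g (γ t) (Classical.velocity γ t) = deriv (fun s => g (γ s)) t := by
  have h := mvfderiv_comp_apply (I' := 𝓘(ℝ, ℝ)) t hg ((hγ t).mdifferentiableAt (by simp)) (1 : ℝ)
  refine h.symm.trans ?_
  rw [mvfderiv, mfderiv_eq_fderiv]
  change fderiv ℝ (g ∘ γ) t 1 = _
  rw [fderiv_apply_one_eq_deriv]
  rfl

theorem Supercurve.mvfderiv_velocity_curve (Φ : Supercurve B F E) (t : ℝ) (f : superFun B F E) :
    mvfderiv (𝓘(ℝ, B).prod 𝓘(ℝ, F)) (affinePart f) (Φ.curve t) (Classical.velocity Φ.curve t) =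
      tot ((dt (Φ.pullback f)).1 t) := by
  rw [mvfderiv_velocity (mdifferentiableAt_affinePart f _) Φ.contMDiff_curve, ← deriv_tot]
  simp only [Φ.affinePart_curve]

theorem eq_velocity_of_hasInitialCondition {A : InitialCondition B F E}
    {α : TangentBundle (𝓘(ℝ, B).prod 𝓘(ℝ, F)) (TotalSpace F E)} (hγ : IsAssociatedCurve Φ γ)
    (hα : IsAssociatedVector A α) (hA : HasInitialCondition Φ A) :
    (⟨γ 0, Classical.velocity γ 0⟩ : TangentBundle (𝓘(ℝ, B).prod 𝓘(ℝ, F)) (TotalSpace F E)) = α := by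
  obtain rfl := hγ.eq_curve
  refine tangentBundle_ext (fun s hs => ?_) fun s hs => ?_
  · rw [(hα s hs).1, hA.2.1]
    exact Φ.affinePart_curve 0 s
  · rw [(hα s hs).2, hA.2.2]
    exact Φ.mvfderiv_velocity_curve 0 s

/-! ### Covariant derivatives along curves -/

theorem contDiff_mvfderiv_along {X : ∀ t, TangentSpace (𝓘(ℝ, B).prod 𝓘(ℝ, F)) (γ t)}
    (hX : Classical.IsSmoothAlong γ X) (f : superFun B F E) :
    ContDiff ℝ ∞ (fun t => mvfderiv (𝓘(ℝ, B).prod 𝓘(ℝ, F)) (affinePart f) (γ t) (X t)) :=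
  contMDiff_iff_contDiff.1 fun t => (contMDiff_affinePart f).contMDiffAt.mvfderiv_apply (hX t)

/-- The covariant derivative along a curve in `E`. -/
def covAlong (nabla : Connection (parity B F E)) (γ : ℝ → TotalSpace F E)
    (X : ∀ t, TangentSpace (𝓘(ℝ, B).prod 𝓘(ℝ, F)) (γ t)) (t : ℝ) : TangentSpace (𝓘(ℝ, B).prod 𝓘(ℝ, F)) (γ t) :=
  ∑ c, (deriv (fun s => mvfderiv (𝓘(ℝ, B).prod 𝓘(ℝ, F)) (affinePart ((frameAt (γ t).1).z c)) (γ s) (X s)) t -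
    (hessForm nabla ((frameAt (γ t).1).z c)).form (γ t) (Classical.velocity γ t) (X t)) •
      bas (frameAt (γ t).1) c (γ t)

theorem mvfderiv_z_covAlong (nabla : Connection (parity B F E)) (γ : ℝ → TotalSpace F E)
    (X : ∀ t, TangentSpace (𝓘(ℝ, B).prod 𝓘(ℝ, F)) (γ t)) (t : ℝ) (c : Idx B F) :
    mvfderiv (𝓘(ℝ, B).prod 𝓘(ℝ, F)) (affinePart ((frameAt (γ t).1).z c)) (γ t) (covAlong nabla γ X t) =
      deriv (fun s => mvfderiv (𝓘(ℝ, B).prod 𝓘(ℝ, F)) (affinePart ((frameAt (γ t).1).z c)) (γ s) (X s)) t -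
        (hessForm nabla ((frameAt (γ t).1).z c)).form (γ t) (Classical.velocity γ t) (X t) := by
  simp only [covAlong, map_sum, map_smul, mvfderiv_z_bas _ (frameAt (γ t).1).mem_dom]
  simp

/-- Additivity and the Leibniz rule are those of the derivative in `t`. For restricted fields,
uniqueness replaces `cov` by the explicit connection, and the chain rule matches its coordinate
formula. -/
theorem isCovariantDerivativeAlong_covAlong {nabla : Connection (parity B F E)}
    {cov : CovariantDerivative (𝓘(ℝ, B).prod 𝓘(ℝ, F)) (B × F) (TangentSpace (𝓘(ℝ, B).prod 𝓘(ℝ, F)) : TotalSpace F E → Type _)}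
    (hcov : IsAssociatedConnection nabla cov) (hγ : ContMDiff 𝓘(ℝ, ℝ) (𝓘(ℝ, B).prod 𝓘(ℝ, F)) ∞ γ) :
    Classical.IsCovariantDerivativeAlong cov γ (covAlong nabla γ) where
  add X Y hX hY := by
    funext t
    refine tangent_ext (frameAt (γ t).1) (frameAt (γ t).1).mem_dom fun c => ?_
    have h := deriv_fun_add
      ((contDiff_mvfderiv_along hX ((frameAt (γ t).1).z c)).differentiable (by simp) t)
      ((contDiff_mvfderiv_along hY ((frameAt (γ t).1).z c)).differentiable (by simp) t)
    simp only [Pi.add_apply, map_add, mvfderiv_z_covAlong, h]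
    ring
  leibniz f X hf hX := by
    funext t
    refine tangent_ext (frameAt (γ t).1) (frameAt (γ t).1).mem_dom fun c => ?_
    have h := deriv_fun_mul (hf.differentiable (by simp) t)
      ((contDiff_mvfderiv_along hX ((frameAt (γ t).1).z c)).differentiable (by simp) t)
    simp only [map_add, map_smul, smul_eq_mul, mvfderiv_z_covAlong, h]
    ring
  pullback Y hY := by
    rw [hcov.unique (isAssociatedConnection_assocConnection nabla) hY]
    funext t
    refine tangent_ext (frameAt (γ t).1) (frameAt (γ t).1).mem_dom fun c => ?_
    have h := mvfderiv_velocity (((hY (γ t)).mdifferentiableAt (by simp)).mvfderiv_affinePart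
      ((frameAt (γ t).1).z c)) hγ
    rw [mvfderiv_z_covAlong, ← h]
    exact (mvfderiv_z_covAt nabla Y (γ t) _ c).symm

end

end BatchelorModel

/-! ### Geodesics -/

namespace BatchelorModel

open SuperAlg

noncomputable section

theorem eq_tot_smul_eps {p : ZMod 2} {a : DualNumber ℝ} (ha : a ∈ dualParity p) :
    a = tot a • eps p := by
  refine ext_of_tot ha (Submodule.smul_mem _ _ (eps_mem p)) ?_
  rw [map_smul, tot_eps, smul_eq_mul, mul_one]

/-- A homogeneous dual number is `tot a • eps p`, so products regain the multiplicativity that `tot`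
lacks in general. This converts the quadratic term of the super geodesic equation into the classical
one. -/
theorem tot_mul_tot_mul_tot_eps {p q : ZMod 2} {a b : DualNumber ℝ} (ha : a ∈ dualParity p)
    (hb : b ∈ dualParity q) (z : DualNumber ℝ) :
    tot a * tot b * tot (eps p * eps q * z) = tot (b * (a * z)) := by
  conv_rhs => rw [eq_tot_smul_eps ha, eq_tot_smul_eps hb]
  simp only [smul_mul_assoc, mul_smul_comm, map_smul, smul_eq_mul]
  rw [mul_left_comm (eps q), ← mul_assoc (eps p)]
  ring

theorem tot_mul_sub_tot_mul {a x y z : DualNumber ℝ} (hx : x = 0) (hy : y = z) :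
    tot (a * x) - tot (a * y) = -tot (a * z) := by
  rw [hx, hy, mul_zero, map_zero, zero_sub]

theorem dt_apply_congr {b b' : lineAlg} {t : ℝ} (h : ∀ᶠ s in 𝓝 t, b.1 s = b'.1 s) :
    (dt b).1 t = (dt b').1 t :=
  Prod.ext (Filter.EventuallyEq.deriv_eq (h.mono fun _ hs => congrArg TrivSqZeroExt.fst hs))
    (Filter.EventuallyEq.deriv_eq (h.mono fun _ hs => congrArg TrivSqZeroExt.snd hs))

theorem coe_map_sum_apply {A C : Type*} [AddCommGroup A] [Module ℝ A] [AddCommGroup C] [Module ℝ C]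
    {S : Submodule ℝ (A →ₗ[ℝ] C)} (D : S →ₗ[ℝ] S) {ι : Type*} [Fintype ι] (W : ι → S) (f : A) :
    (D (∑ i, W i)).1 f = ∑ i, (D (W i)).1 f := by
  rw [map_sum]
  simp only [Submodule.coe_sum, LinearMap.sum_apply]

theorem dt_one : dt 1 = 0 := by
  have h := dt_mul 1 1
  rw [mul_one, one_mul, mul_one] at h
  exact left_eq_add.1 h

theorem lineEval_dt_mul {b a : lineAlg} {t : ℝ} (h : ∀ᶠ s in 𝓝 t, b.1 s = 1) :
    lineEval t (dt (b * a)) = lineEval t (dt a) :=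
  dt_apply_congr (h.mono fun s hs => by
    change b.1 s * a.1 s = a.1 s
    rw [hs, one_mul])

variable {B F : Type*} [NormedAddCommGroup B] [NormedSpace ℝ B] [FiniteDimensional ℝ B]
  [NormedAddCommGroup F] [NormedSpace ℝ F] [FiniteDimensional ℝ F]
  {M : Type*} [TopologicalSpace M] [T2Space M] [ChartedSpace B M] [IsManifold 𝓘(ℝ, B) ∞ M]
  {E : M → Type*} [∀ x, AddCommGroup (E x)] [∀ x, Module ℝ (E x)]
  [TopologicalSpace (TotalSpace F E)] [∀ x, TopologicalSpace (E x)] [FiberBundle F E]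
  [VectorBundle ℝ F E] [ContMDiffVectorBundle ∞ F E 𝓘(ℝ, B)]
  {x₀ : M} {nabla : Connection (parity B F E)} {Φ : Supercurve B F E} {γ : ℝ → TotalSpace F E}
  {D : ∀ p : ZMod 2, Φ.Der p →ₗ[ℝ] Φ.Der p}

theorem IsSuperCovariantDerivativeAlong.leibniz_of_eq
    (hD : IsSuperCovariantDerivativeAlong nabla Φ D) {r p q : ZMod 2} (h : q = r + p) {b : lineAlg}
    {V : Φ.Der p} {bV : Φ.Der q} (hb : b ∈ lineParity r) (hbV : ∀ f, bV.1 f = b * V.1 f)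
    (f : superFun B F E) : (D _ bV).1 f = dt b * V.1 f + b * (D _ V).1 f := by
  subst h
  exact hD.leibniz r p b V bV hb hbV f

theorem Supercurve.isPoint (Φ : Supercurve B F E) (t : ℝ) :
    IsPoint ((lineEval t).comp Φ.pullback) (Φ.base t) := by
  obtain ⟨e, he⟩ := Φ.exists_eq_evAt t
  rw [he]
  exact isPoint_evAt _

/-- The coordinates of the velocity of a supercurve. -/
def Supercurve.velocityCoord (Φ : Supercurve B F E) (fr : Frame B F E x₀) (c : Idx B F) : lineAlg :=
  dt (Φ.pullback (fr.z c))

theorem Supercurve.velocityCoord_mem (Φ : Supercurve B F E) (fr : Frame B F E x₀) (c : Idx B F) :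
    Φ.velocityCoord fr c ∈ lineParity (par c) :=
  dt_mem_lineParity (Φ.even _ _ (fr.z_mem c))

theorem Supercurve.isLeibniz_velocity (Φ : Supercurve B F E) (t : ℝ) :
    IsLeibniz ((lineEval t).comp Φ.pullback) 0 ((lineEval t).toLinearMap ∘ₗ Φ.velocity.1) := by
  intro q f hf g
  have h : Φ.velocity.1 (f * g) = Φ.velocity.1 f * Φ.pullback g +
    koszul 0 q • (Φ.pullback f * Φ.velocity.1 g) := Φ.velocity.2.2 q f hf g
  change lineEval t (Φ.velocity.1 (f * g)) = lineEval t (Φ.velocity.1 f) * lineEval t (Φ.pullback g)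
    + koszul 0 q • (lineEval t (Φ.pullback f) * lineEval t (Φ.velocity.1 g))
  rw [h, map_add, map_smul, map_mul, map_mul]

theorem Supercurve.velocity_eq_sum (Φ : Supercurve B F E) (fr : Frame B F E x₀) {t : ℝ}
    (ht : Φ.base t ∈ fr.dom) (f : superFun B F E) :
    (Φ.velocity.1 f).1 t =
      ∑ c, (Φ.velocityCoord fr c).1 t * (Φ.pullback ((fr.D c).1 f)).1 t :=
  (Φ.isLeibniz_velocity t).eq_sum (Φ.isPoint t) fr ht (fun c q f hf => by
    rw [zero_add]
    exact dual_mul_comm (Φ.velocityCoord_mem fr c t) (Φ.even q f hf t)) f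

/-- A function which is `1` near `t₀`, as a superfunction on `ℝ^{1|1}`, with which the velocity of a
supercurve can be expanded in coordinates. -/
theorem Supercurve.exists_cutoff (Φ : Supercurve B F E) (fr : Frame B F E x₀) {t₀ : ℝ}
    (ht : Φ.base t₀ ∈ fr.dom) : ∃ b ∈ lineParity 0, (∀ᶠ t in 𝓝 t₀, b.1 t = 1) ∧
      ∀ f, b * Φ.velocity.1 f =
        ∑ c, b * Φ.velocityCoord fr c * (Φ.restrict (fr.D c)).1 f := by
  obtain ⟨χ, hχ, h1, h2⟩ := exists_contMDiff_bump (B := B) (fr.isOpen_dom.mem_nhds ht)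
  have h3 : ∀ t, (Φ.pullback (fn χ hχ)).1 t = algebraMap ℝ _ (χ (Φ.base t)) := fun t =>
    Φ.isPoint t χ hχ
  refine ⟨Φ.pullback (fn χ hχ), Φ.even 0 _ (fn_mem_parity χ hχ), ?_, fun f => ?_⟩
  · filter_upwards [(Φ.smooth_base t₀).continuousAt.eventually h1] with t ht
    rw [h3, ht, map_one]
  · refine Subtype.ext (funext fun t => ?_)
    change lineEval t (Φ.pullback (fn χ hχ) * Φ.velocity.1 f) = lineEval t
      (∑ c, Φ.pullback (fn χ hχ) * Φ.velocityCoord fr c * (Φ.restrict (fr.D c)).1 f)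
    simp only [map_sum, map_mul]
    by_cases ht : Φ.base t ∈ fr.dom
    · simp only [mul_assoc, ← Finset.mul_sum]
      exact congrArg _ (Φ.velocity_eq_sum fr ht f)
    · have h4 : lineEval t (Φ.pullback (fn χ hχ)) = 0 := by
        rw [lineEval_apply, h3, image_eq_zero_of_notMem_tsupport fun h => ht (h2 h), map_zero]
      simp only [h4, zero_mul, Finset.sum_const_zero]

theorem IsSuperCovariantDerivativeAlong.restrict_eq_sum
    (hD : IsSuperCovariantDerivativeAlong nabla Φ D) (fr : Frame B F E x₀) {t : ℝ}
    (ht : Φ.base t ∈ fr.dom) {q : ZMod 2} (X : der (parity B F E) q) (f : superFun B F E) :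
    ((D q (Φ.restrict X)).1 f).1 t =
      ∑ c, (Φ.velocityCoord fr c).1 t * (Φ.pullback ((nabla.nabla (fr.D c) X).1 f)).1 t := by
  -- The pullback rule is phrased for families over `Fin n`, so the coordinate indices are
  -- renumbered.
  let e := (Fintype.equivFin (Idx B F)).symm
  have h := hD.pullback t _ (fun j => par (e j)) (fun j => Φ.velocityCoord fr (e j))
    (fun j => fr.D (e j)) (fun j => Φ.velocityCoord_mem fr (e j)) (fun f => by
      filter_upwards [(Φ.smooth_base t).continuousAt.preimage_mem_nhds
        (fr.isOpen_dom.mem_nhds ht)] with s hs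
      rw [Φ.velocity_eq_sum fr hs]
      exact (e.sum_comp _).symm) q X f
  exact h.self_of_nhds.trans (e.sum_comp (fun c => (Φ.velocityCoord fr c).1 t *
    (Φ.pullback ((nabla.nabla (fr.D c) X).1 f)).1 t))

/-- The coefficients of the connection, along a supercurve. -/
def Supercurve.nablaCoord (Φ : Supercurve B F E) (nabla : Connection (parity B F E))
    (fr : Frame B F E x₀) (t : ℝ) (c d k : Idx B F) : DualNumber ℝ :=
  (Φ.pullback ((nabla.nabla (fr.D c) (fr.D d)).1 (fr.z k))).1 t

/-- The operator `D` applies to globally defined fields only, hence the cut-off `b`. Computing `D`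
of `b` times the velocity in two ways, once with `D 0 Φ.velocity = 0` and once through the
expansion, gives the identity. -/
theorem IsSuperCovariantDerivativeAlong.exists_sum_eq_zero
    (hD : IsSuperCovariantDerivativeAlong nabla Φ D) (h0 : D 0 Φ.velocity = 0)
    {b : lineAlg} (hb : b ∈ lineParity 0) {ι : Type*} [Fintype ι] {p : ι → ZMod 2} {a : ι → lineAlg}
    {V : ∀ i, Φ.Der (p i)} (ha : ∀ i, a i ∈ lineParity (p i))
    (h : ∀ f, b * Φ.velocity.1 f = ∑ i, b * a i * (V i).1 f) (f : superFun B F E) :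
    dt b * Φ.velocity.1 f = ∑ i, (dt (b * a i) * (V i).1 f + b * a i * (D _ (V i)).1 f) := by
  have hmem : ∀ i, b * a i ∈ lineParity (p i) := fun i => by
    have := isSupercommutative_lineParity.mul_mem hb (ha i)
    rwa [zero_add] at this
  have hW : ∀ i, ∃ W : Φ.Der 0, ∀ f, W.1 f = b * a i * (V i).1 f := fun i =>
    ⟨⟨_, parity_add_self (p i) ▸ mulLeft_comp_mem_derAlong isSupercommutative_lineParity Φ.even
      (hmem i) (V i).2⟩, fun _ => rfl⟩
  choose W hW using hW
  have hsum : ∀ f, (∑ i, W i).1 f = b * Φ.velocity.1 f := fun f => by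
    rw [h]
    simp only [← hW, Submodule.coe_sum, LinearMap.sum_apply]
  have e1 := hD.leibniz_of_eq (zero_add 0).symm hb hsum f
  have e2 := fun i => hD.leibniz_of_eq (parity_add_self (p i)).symm (hmem i) (hW i) f
  rw [h0] at e1
  have e3 : (D 0 (∑ i, W i)).1 f = ∑ i, (D 0 (W i)).1 f := coe_map_sum_apply (D 0) W f
  have e4 : dt b * Φ.velocity.1 f = dt b * Φ.velocity.1 f + b * (0 : Φ.Der 0).1 f := by
    change _ = _ + b * 0
    rw [mul_zero, add_zero]
  exact e4.trans (e1.symm.trans (e3.trans (Finset.sum_congr rfl fun i _ => e2 i)))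

/-- Near `t` the cut-off is constant, so its derivative drops out, and the Kronecker delta picks the
acceleration of the coordinate `k`. -/
theorem lineEval_dt_add_sum_eq_zero {ι : Type*} [Fintype ι] [DecidableEq ι] {b x : lineAlg}
    {a r s : ι → lineAlg} {t : ℝ} {k : ι} (hb : ∀ᶠ u in 𝓝 t, b.1 u = 1)
    (h : dt b * x = ∑ i, (dt (b * a i) * r i + b * a i * s i))
    (hr : ∀ i, lineEval t (r i) = if i = k then 1 else 0) :
    lineEval t (dt (a k)) + ∑ i, lineEval t (a i) * lineEval t (s i) = 0 := by
  have hdt : lineEval t (dt b) = 0 := by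
    have := lineEval_dt_mul (a := 1) hb
    rwa [mul_one, dt_one, map_zero] at this
  have hbt : lineEval t b = 1 := hb.self_of_nhds
  have e := congrArg (lineEval t) h
  simp only [map_sum, map_add, map_mul, hdt, hbt, hr, lineEval_dt_mul hb] at e
  simp only [zero_mul, one_mul, mul_ite, mul_one, mul_zero, Finset.sum_add_distrib,
    Finset.sum_ite_eq', Finset.mem_univ, if_true] at e
  exact e.symm

/-- The geodesic equation in coordinates. -/
theorem IsSuperCovariantDerivativeAlong.geodesic_equation
    (hD : IsSuperCovariantDerivativeAlong nabla Φ D) (h0 : D 0 Φ.velocity = 0)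
    (fr : Frame B F E x₀) {t : ℝ} (ht : Φ.base t ∈ fr.dom) (k : Idx B F) :
    (dt (Φ.velocityCoord fr k)).1 t + ∑ d, (Φ.velocityCoord fr d).1 t *
      ∑ c, (Φ.velocityCoord fr c).1 t * Φ.nablaCoord nabla fr t c d k = 0 := by
  obtain ⟨b, hb, hb1, hbv⟩ := Φ.exists_cutoff fr ht
  have h1 := lineEval_dt_add_sum_eq_zero hb1
    (hD.exists_sum_eq_zero h0 hb (Φ.velocityCoord_mem fr) hbv (fr.z k))
    (fun c => (Φ.isPoint t).map_D_z fr ht c k)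
  refine Eq.trans ?_ h1
  exact congrArg _ (Finset.sum_congr rfl fun d _ => congrArg _
    (hD.restrict_eq_sum fr ht (fr.D d) (fr.z k)).symm)

/-- Expanding the velocity in coordinate fields leaves only the connection coefficients, since
second coordinate derivatives of a coordinate vanish. Its components are `tot` of the homogeneous
super velocities, so the double sum is `tot` of the quadratic term upstairs. -/
theorem hessForm_velocity_curve (nabla : Connection (parity B F E)) (fr : Frame B F E x₀) {t : ℝ}
    (ht : Φ.base t ∈ fr.dom) (k : Idx B F) :
    (hessForm nabla (fr.z k)).form (Φ.curve t) (Classical.velocity Φ.curve t)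
        (Classical.velocity Φ.curve t) =
      -tot (∑ d, (Φ.velocityCoord fr d).1 t * ∑ c, (Φ.velocityCoord fr c).1 t *
        Φ.nablaCoord nabla fr t c d k) := by
  have hv : (Φ.curve t).1 ∈ fr.dom := ht
  have hb : ∀ c d, (hessForm nabla (fr.z k)).form (Φ.curve t) (bas fr c (Φ.curve t))
      (bas fr d (Φ.curve t)) =
        -tot (eps (par c) * eps (par d) * Φ.nablaCoord nabla fr t c d k) := fun c d =>
    (hessForm_form_bas fr nabla hv (fr.z k) c d).trans (tot_mul_sub_tot_mul
      (evAt_D_D_z fr hv c d k) (Φ.evAt_curve t _))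
  have ha : ∀ c, mvfderiv (𝓘(ℝ, B).prod 𝓘(ℝ, F)) (affinePart (fr.z c)) (Φ.curve t) (Classical.velocity Φ.curve t) =
      tot ((Φ.velocityCoord fr c).1 t) := fun c => Φ.mvfderiv_velocity_curve t (fr.z c)
  rw [eq_sum_bas fr hv (Classical.velocity Φ.curve t)]
  simp only [map_sum, map_smul, _root_.sum_apply, _root_.smul_apply, smul_eq_mul, hb, mul_neg,
    Finset.sum_neg_distrib, Finset.mul_sum, ha]
  refine congrArg Neg.neg (Finset.sum_congr rfl fun d _ => Finset.sum_congr rfl fun c _ => ?_)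
  rw [← tot_mul_tot_mul_tot_eps (Φ.velocityCoord_mem fr c t) (Φ.velocityCoord_mem fr d t)]
  ring

/-- Applying `tot` to the super geodesic equation in coordinates gives exactly the coordinates of
the covariant derivative of the velocity along the curve. -/
theorem isGeodesic_of_isSuperGeodesic
    {cov : CovariantDerivative (𝓘(ℝ, B).prod 𝓘(ℝ, F)) (B × F) (TangentSpace (𝓘(ℝ, B).prod 𝓘(ℝ, F)) : TotalSpace F E → Type _)}
    (hcov : IsAssociatedConnection nabla cov) (hγ : IsAssociatedCurve Φ γ)
    (hΦ : IsSuperGeodesic nabla Φ) : Classical.IsGeodesic cov γ := by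
  obtain rfl := hγ.eq_curve
  obtain ⟨D, hD, h0⟩ := hΦ
  refine ⟨Φ.contMDiff_curve, covAlong nabla Φ.curve,
    isCovariantDerivativeAlong_covAlong hcov Φ.contMDiff_curve, funext fun t => ?_⟩
  let fr := frameAt (B := B) (F := F) (E := E) (Φ.curve t).1
  have ht : Φ.base t ∈ fr.dom := (frameAt (B := B) (F := F) (E := E) (Φ.curve t).1).mem_dom
  refine tangent_ext fr ht fun k => ?_
  have h1 := mvfderiv_z_covAlong nabla Φ.curve (Classical.velocity Φ.curve) t k
  have h2 : (fun s => mvfderiv (𝓘(ℝ, B).prod 𝓘(ℝ, F)) (affinePart (fr.z k)) (Φ.curve s)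
      (Classical.velocity Φ.curve s)) = fun s => tot ((Φ.velocityCoord fr k).1 s) :=
    funext fun s => Φ.mvfderiv_velocity_curve s (fr.z k)
  have h3 := congrArg tot (hD.geodesic_equation h0 fr ht k)
  have h4 := (congrArg (fun g => deriv g t) h2).trans (deriv_tot (Φ.velocityCoord fr k) t)
  have h5 := h1.trans (congrArg₂ (fun a b => a - b) h4 (hessForm_velocity_curve nabla fr ht k))
  rw [map_add, map_zero] at h3
  refine h5.trans ?_
  rw [sub_neg_eq_add, h3]
  exact (map_zero _).symm

end

end BatchelorModel

theorem theorem1p1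
    {B F : Type*} [NormedAddCommGroup B] [NormedSpace ℝ B] [FiniteDimensional ℝ B]
    [NormedAddCommGroup F] [NormedSpace ℝ F] [FiniteDimensional ℝ F]
    {M : Type*} [TopologicalSpace M] [T2Space M] [SecondCountableTopology M]
    [ChartedSpace B M] [IsManifold 𝓘(ℝ, B) ∞ M]
    {E : M → Type*} [∀ x, AddCommGroup (E x)] [∀ x, Module ℝ (E x)]
    [TopologicalSpace (TotalSpace F E)] [∀ x, TopologicalSpace (E x)] [FiberBundle F E]
    [VectorBundle ℝ F E] [ContMDiffVectorBundle ∞ F E 𝓘(ℝ, B)]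
    (nabla : SuperAlg.Connection (BatchelorModel.parity B F E)) :
    -- existence and uniqueness of the associated objects on `E`
    (∃ cov : CovariantDerivative (𝓘(ℝ, B).prod 𝓘(ℝ, F)) (B × F)
        (TangentSpace (𝓘(ℝ, B).prod 𝓘(ℝ, F)) : TotalSpace F E → Type _),
      BatchelorModel.IsAssociatedConnection nabla cov ∧
      ∀ cov', BatchelorModel.IsAssociatedConnection nabla cov' →
        ∀ Y, Classical.IsSmoothField Y → cov' Y = cov Y) ∧
    (∀ (ε : ZMod 2) (g : SuperAlg.Metric (BatchelorModel.parity B F E) ε),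
      ∃! h, BatchelorModel.IsAssociatedForm g h) ∧
    (∀ Φ : BatchelorModel.Supercurve B F E, ∃! γ, BatchelorModel.IsAssociatedCurve Φ γ) ∧
    (∀ A : BatchelorModel.InitialCondition B F E,
      ∃! α, BatchelorModel.IsAssociatedVector A α) ∧
    -- the two statements on the associated connection
    ∀ cov : CovariantDerivative (𝓘(ℝ, B).prod 𝓘(ℝ, F)) (B × F)
        (TangentSpace (𝓘(ℝ, B).prod 𝓘(ℝ, F)) : TotalSpace F E → Type _),
      BatchelorModel.IsAssociatedConnection nabla cov →
      ((nabla.IsTorsionFree → Classical.IsTorsionFree cov) ∧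
        (∀ (ε : ZMod 2) (g : SuperAlg.Metric (BatchelorModel.parity B F E) ε) (h : _),
          BatchelorModel.IsAssociatedForm g h → nabla.IsMetric g →
            Classical.IsCompatible cov h)) ∧
      (∀ (Φ : BatchelorModel.Supercurve B F E) (A : BatchelorModel.InitialCondition B F E)
          (γ : ℝ → TotalSpace F E)
          (α : TangentBundle (𝓘(ℝ, B).prod 𝓘(ℝ, F)) (TotalSpace F E)),
        BatchelorModel.IsAssociatedCurve Φ γ → BatchelorModel.IsAssociatedVector A α →
        BatchelorModel.IsSuperGeodesic nabla Φ → BatchelorModel.HasInitialCondition Φ A →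
          Classical.IsGeodesic cov γ ∧
            (⟨γ 0, Classical.velocity γ 0⟩ :
              TangentBundle (𝓘(ℝ, B).prod 𝓘(ℝ, F)) (TotalSpace F E)) = α) := by
  open BatchelorModel in
  exact ⟨⟨assocConnection nabla, isAssociatedConnection_assocConnection nabla,
      fun cov' h Y hY => h.unique (isAssociatedConnection_assocConnection nabla) hY⟩,
    fun ε g => existsUnique_isAssociatedForm g, existsUnique_isAssociatedCurve,
    existsUnique_isAssociatedVector, fun cov hcov =>
    ⟨⟨isTorsionFree_of_isTorsionFree hcov, fun ε g h hh hg => isCompatible_of_isMetric hcov hg hh⟩,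
      fun Φ A γ α hγ hα hΦ hA => ⟨isGeodesic_of_isSuperGeodesic hcov hγ hΦ,
        eq_velocity_of_hasInitialCondition hγ hα hA⟩⟩⟩
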